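/- **Theorem 3.1 (a priori energy bound on the limiting hierarchy).** Let $d\in\{1,2\}$, let $p_0\ge 1$ be an integer, and for $1\le p\le p_0$ let $V^{(p)}\in W^{p,\infty}(\mathbb{R}^{pd})$, $V^{(p)}\ge 0$, be such that $V^{(p)}(x_1-x_2,\dots,x_1-x_{p+1})$ is invariant under permutations of $x_1,\dots,x_{p+1}$. Let $\kappa>0$, and let $\alpha\in\mathbb{R}$ with $\alpha\le 1$ if $d=1$ and $\alpha<1$ if $d=2$. Then there is a constant $C_\alpha>0$, depending only on $\alpha,\kappa,p_0,d$ and the $V^{(p)}$, such that the following holds. Let $0<\beta<\frac1{2dp_0+2}$, $T>0$, let $\chi:\mathbb{R}\to[0,1]$ be smooth with $\chi(s)=0$ for $s\ge 2$, and for $N\ge 1$ let $\psi_N\in L^2(\mathbb{R}^{dN})$ be permutation symmetric with $\|\psi_N\|=1$. Put $$H_N=\sum_{i=1}^N(-\Delta_{x_i})+\sum_{p=1}^{p_0}\frac1{N^p}\sum_{1\le i_1<\dots<i_{p+1}\le N}N^{pd\beta}V^{(p)}\big(N^\beta(x_{i_1}-x_{i_2}),\dots,N^\beta(x_{i_1}-x_{i_{p+1}})\big),$$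 $$\tilde\psi_N=\frac{\chi(\frac{\kappa}{N}H_N)\psi_N}{\|\chi(\frac{\kappa}{N}H_N)\psi_N\|}\quad(\tilde\psi_N=0\text{ if the denominator vanishes}),\qquad \tilde\psi_{N,t}=e^{-itH_N}\tilde\psi_N,$$ and let $\tilde\gamma^{(k)}_{N,t}$ be the $k$-particle marginal of $\tilde\psi_{N,t}$, i.e. the operator on $L^2(\mathbb{R}^{dk})$ with kernel $\int\tilde\psi_{N,t}(\mathbf{x}_k,\mathbf{y})\,\overline{\tilde\psi_{N,t}(\mathbf{x}'_k,\mathbf{y})}\,d\mathbf{y}$ for $k\le N$, and $0$ for $k>N$. For each $k\ge1$ let $(J^{(k)}_i)_{i\ge1}$ be compact operators on $L^2(\mathbb{R}^{dk})$ of norm at most $1$, dense in the unit ball of the compact operators, and put $\eta_k(\gamma,\gamma')=\sum_{i\ge1}2^{-i}|\mathrm{Tr}\,J^{(k)}_i(\gamma-\gamma')|$. Let $\Gamma_{\infty,t}=\{\gamma^{(k)}_{\infty,t}\}_{k\ge1}$ be a limit point of $\{\tilde\gamma^{(k)}_{N,t}\}_k$ as $N\to\infty$: each $t\mapsto\gamma^{(k)}_{\infty,t}$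 is an $\eta_k$-continuous path of trace class operators on $[0,T]$, and along some subsequence of $N$ one has $\sup_{t\in[0,T]}\eta_k(\tilde\gamma^{(k)}_{N,t},\gamma^{(k)}_{\infty,t})\to0$ for every $k\ge1$. Then for all $1\le p\le p_0$, $k\ge1$, $1\le j\le k$ and $t\in[0,T]$, $$\big\|S^{(k,\alpha)}B_{j;k+1,\dots,k+p}\gamma^{(k+p)}_{\infty,t}\big\|_{L^2(\mathbb{R}^{dk}\times\mathbb{R}^{dk})}\le C_\alpha^{k+p}.$$ Here $S^{(k,\alpha)}=\prod_{l=1}^k(1-\Delta_{x_l})^{\alpha/2}(1-\Delta_{x'_l})^{\alpha/2}$ and $B_{j;k+1,\dots,k+p}=B^+-B^-$, where $$(B^+\gamma)(\mathbf{x}_k;\mathbf{x}'_k)=\int\prod_{l=1}^p\delta(x_j-x_{k+l})\,\delta(x_j-x'_{k+l})\;\gamma(\mathbf{x}_{k+p};\mathbf{x}'_{k+p})\,dx_{k+1}dx'_{k+1}\cdots dx_{k+p}dx'_{k+p},$$ $B^-$ is the same with $x_j$ replaced by $x'_j$ in the delta functions, and the integrals mean the limit, in the sense of distributions, as $\varepsilon\to0^+$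 with each $\delta$ replaced by $h_\varepsilon(x)=\varepsilon^{-d}h(x/\varepsilon)$, for every smooth compactly supported $h\ge0$ with $\int h=1$. It is part of the assertion that the limit exists and that $B_{j;k+1,\dots,k+p}\gamma^{(k+p)}_{\infty,t}$ and its image under $S^{(k,\alpha)}$ are square integrable. -/

import Mathlib

open MeasureTheory Filter Topology Set
open scoped ContDiff ENNReal InnerProductSpace FourierTransform Laplacian SchwartzMap

noncomputable section

namespace GPHierarchy

/-! ### Configurations, `L²` spaces -/

/-- Configurations of particles in `ℝ^d` labelled by `ι`, with the Euclidean structure and Lebesgue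
measure of `ℝ^{d|ι|}`. For density matrices `γ(x; x')` the label type is `ι ⊕ ι`: the left copy
holds the unprimed and the right copy the primed positions. -/
abbrev Conf (ι : Type) (d : ℕ) : Type := EuclideanSpace ℝ (ι × Fin d)

/-- The position in `ℝ^d` of the particle `i`. -/
def Conf.pos {ι : Type} {d : ℕ} (x : Conf ι d) (i : ι) : EuclideanSpace ℝ (Fin d) :=
  WithLp.toLp 2 fun a => x (i, a)

/-- The configuration with prescribed positions. -/
def Conf.mk {ι : Type} {d : ℕ} (q : ι → EuclideanSpace ℝ (Fin d)) : Conf ι d :=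
  WithLp.toLp 2 fun ia => q ia.1 ia.2

/-- The pair `(x; x')` as one configuration. -/
def glue {ι κ : Type} {d : ℕ} (x : Conf ι d) (x' : Conf κ d) : Conf (ι ⊕ κ) d :=
  Conf.mk (Sum.elim x.pos x'.pos)

/-- `(x₁, …, x_k, y₁, …, y_m)` as a configuration of `n` particles (used with `n = k + m`). -/
def join {k m d : ℕ} (n : ℕ) (hn : n ≤ k + m) (x : Conf (Fin k) d) (y : Conf (Fin m) d) :
    Conf (Fin n) d :=
  Conf.mk fun i => if h : i.1 < k then x.pos ⟨i.1, h⟩ else y.pos ⟨i.1 - k, by omega⟩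

/-- The complex Hilbert space `L²(ℝ^{d|ι|})`. -/
abbrev L2 (ι : Type) [Fintype ι] (d : ℕ) : Type := Lp ℂ 2 (volume : Measure (Conf ι d))

/-- Bounded operators on `L²(ℝ^{d|ι|})`. -/
abbrev Op (ι : Type) [Fintype ι] (d : ℕ) : Type := L2 ι d →L[ℂ] L2 ι d

/-- Bosonic wave functions: `ψ(x_{σ(1)}, …, x_{σ(N)}) = ψ(x₁, …, x_N)` for all permutations. -/
def IsBosonic {N d : ℕ} (ψ : L2 (Fin N) d) : Prop :=
  ∀ σ : Equiv.Perm (Fin N), ∀ᵐ x : Conf (Fin N) d, ψ (Conf.mk fun i => x.pos (σ i)) = ψ x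

/-! ### Interaction potentials -/

/-- `V ∈ W^{m,∞}(E)`: every weak derivative of `V` of order at most `m` (`V` itself included) is
essentially bounded. -/
def MemSobolevInfty {E : Type} [NormedAddCommGroup E] [InnerProductSpace ℝ E]
    [FiniteDimensional ℝ E] [MeasurableSpace E] [BorelSpace E] (m : ℕ) (V : E → ℝ) : Prop :=
  MemLp V ∞ volume ∧
  ∀ n ≤ m, ∀ v : Fin n → E, ∃ g : E → ℝ, MemLp g ∞ volume ∧
    ∀ φ : E → ℝ, ContDiff ℝ ∞ φ → HasCompactSupport φ →
      ∫ x, V x * iteratedFDeriv ℝ n φ x v = (-1) ^ n * ∫ x, g x * φ x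

/-- The `(p+1)`-body interaction `V(x₀ - x₁, …, x₀ - x_p)`, translation invariant by
construction. -/
def bodyInteraction {p d : ℕ} (V : Conf (Fin p) d → ℝ) (x : Conf (Fin (p + 1)) d) : ℝ :=
  V (Conf.mk fun l : Fin p => x.pos 0 - x.pos l.succ)

/-- The assumptions on the `(p+1)`-body potential: `V ∈ W^{p,∞}(ℝ^{pd})`, `V ≥ 0`, and the
interaction does not depend on how the `p+1` identical particles are numbered, so that the
Hamiltonian acts on bosonic wave functions. -/
structure IsAdmissiblePotential {p d : ℕ} (V : Conf (Fin p) d → ℝ) : Prop where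
  sobolev : MemSobolevInfty p V
  nonneg : ∀ᵐ y, 0 ≤ V y
  symmetric : ∀ σ : Equiv.Perm (Fin (p + 1)), ∀ᵐ x : Conf (Fin (p + 1)) d,
    bodyInteraction V (Conf.mk fun i => x.pos (σ i)) = bodyInteraction V x

open Classical in
/-- The interaction energy
`∑_{p=1}^{p₀} N^{-p} ∑_{i₁<⋯<i_{p+1}} N^{pdβ} V^{(p)}(N^β(x_{i₁}-x_{i₂}), …, N^β(x_{i₁}-x_{i_{p+1}}))`. -/
def interaction (d p₀ : ℕ) (V : ∀ p : ℕ, Conf (Fin p) d → ℝ) (β : ℝ) (N : ℕ)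
    (x : Conf (Fin N) d) : ℝ :=
  ∑ p ∈ Finset.Icc 1 p₀, ((N : ℝ) ^ p)⁻¹ *
    ∑ i : Fin (p + 1) → Fin N with StrictMono i,
      (N : ℝ) ^ ((p : ℝ) * d * β) *
        V p (Conf.mk fun l : Fin p => (N : ℝ) ^ β • (x.pos (i 0) - x.pos (i l.succ)))

/-! ### The Hamiltonian and its functional calculus -/

/-- The graph of the `N`-particle Hamiltonian `H_N = ∑ᵢ (-Δ_{xᵢ}) + interaction` on
`L²(ℝ^{dN})`: the pairs `(ψ, φ)` with `φ = -Δψ + Vψ` in the sense of tempered distributions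
(here `Δ` is the Laplacian of `ℝ^{dN}`, the sum of the one-particle Laplacians). The domain is
`{ψ ∈ L² | Δψ ∈ L²} = H²`, since the interaction is bounded. -/
def hamiltonianGraph (d p₀ : ℕ) (V : ∀ p : ℕ, Conf (Fin p) d → ℝ) (β : ℝ) (N : ℕ) :
    Set (L2 (Fin N) d × L2 (Fin N) d) :=
  {q | ∃ w : L2 (Fin N) d, (∀ᵐ x, w x = (interaction d p₀ V β N x : ℂ) * q.1 x) ∧
    (q.2 : 𝓢'(Conf (Fin N) d, ℂ)) = -Δ (q.1 : 𝓢'(Conf (Fin N) d, ℂ)) + w}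

section FunctionalCalculus

variable {E : Type} [NormedAddCommGroup E] [InnerProductSpace ℂ E] [CompleteSpace E]

open Classical in
/-- `(A + 1)⁻¹` for an operator `A` given by its graph: the bounded operator `R` such that `R f` is
the unique `u` in the domain with `A u + u = f`. (It exists when `A` is self-adjoint and
nonnegative, the only case in which it is used; the default value is `0`.) -/
def invAddOne (A : Set (E × E)) : E →L[ℂ] E :=
  if h : ∃ R : E →L[ℂ] E, ∀ f u, R f = u ↔ (u, f - u) ∈ A then h.choose else 0

/-- `f(A)` for a nonnegative self-adjoint operator `A` and a continuous function `f` on `[0, ∞)`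
that vanishes at infinity. With `R = (A + 1)⁻¹` this is `g(R)`, where `g(r) = f(1/r - 1)` and
`g(0) = 0`; `g` is continuous on the spectrum of `R`, which lies in `[0, 1]`. -/
def funcCalcZero (A : Set (E × E)) (f : ℝ → ℂ) : E →L[ℂ] E :=
  cfc (fun r : ℂ => if r = 0 then 0 else f (r.re⁻¹ - 1)) (invAddOne A)

/-- `f(A) ψ` for a nonnegative self-adjoint operator `A` and a bounded continuous `f`, as the limit
of `f_n(A) ψ` for the functions `f_n(s) = f(s) / (1 + s/(n+1))`, which vanish at infinity. -/
def funcCalc (A : Set (E × E)) (f : ℝ → ℂ) (ψ : E) : E :=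
  limUnder atTop fun n : ℕ => funcCalcZero A (fun s => f s / (1 + s / (n + 1))) ψ

/-- `e^{-itA} ψ`. -/
def evolution (A : Set (E × E)) (t : ℝ) (ψ : E) : E :=
  funcCalc A (fun s => Complex.exp (-(Complex.I * t * s))) ψ

/-- The regularized datum `χ((κ/N) A) ψ / ‖χ((κ/N) A) ψ‖`. -/
def regularize (A : Set (E × E)) (χ : ℝ → ℝ) (κ : ℝ) (N : ℕ) (ψ : E) : E :=
  ‖funcCalc A (fun s => (χ (κ / N * s) : ℂ)) ψ‖⁻¹ •
    funcCalc A (fun s => (χ (κ / N * s) : ℂ)) ψ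

end FunctionalCalculus

/-! ### Density matrices -/

/-- The operator `A` has the square integrable kernel `K`: `(A f)(x) = ∫ K(x; x') f(x') dx'`. -/
def HasKernel {ι : Type} [Fintype ι] {d : ℕ} (A : Op ι d) (K : Conf (ι ⊕ ι) d → ℂ) : Prop :=
  MemLp K 2 volume ∧ ∀ f : L2 ι d, ∀ᵐ x : Conf ι d, A f x = ∫ x' : Conf ι d, K (glue x x') * f x'

open Classical in
/-- The operator with kernel `K`. (It exists and is unique for every square integrable `K`; the
default value is `0`.) -/
def opOfKernel {ι : Type} [Fintype ι] {d : ℕ} (K : Conf (ι ⊕ ι) d → ℂ) : Op ι d :=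
  if h : ∃ A : Op ι d, HasKernel A K then h.choose else 0

/-- The kernel `∫ ψ(x_k, y) \bar ψ(x'_k, y) dy` of the `k`-particle marginal of `|ψ⟩⟨ψ|`, for
`k ≤ N`. -/
def marginalKernel {N d : ℕ} (k : ℕ) (ψ : L2 (Fin N) d) (z : Conf (Fin k ⊕ Fin k) d) : ℂ :=
  ∫ y : Conf (Fin (N - k)) d,
    ψ (join N (by omega) (Conf.mk fun i => z.pos (Sum.inl i)) y) *
      starRingEnd ℂ (ψ (join N (by omega) (Conf.mk fun i => z.pos (Sum.inr i)) y))

/-- The `k`-particle marginal density of the pure state `ψ`, with the convention that it vanishes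
for `k > N`. -/
def marginal {N d : ℕ} (k : ℕ) (ψ : L2 (Fin N) d) : Op (Fin k) d :=
  if k ≤ N then opOfKernel (marginalKernel k ψ) else 0

/-- The marginals `γ̃_{N,t}^{(k)}` of `ψ̃_{N,t} = e^{-itH_N} ψ̃_N`, where `ψ̃_N` is the normalized
vector `χ((κ/N) H_N) ψ_N`. -/
def regularizedMarginal (d p₀ : ℕ) (V : ∀ p : ℕ, Conf (Fin p) d → ℝ) (β : ℝ) (χ : ℝ → ℝ) (κ : ℝ)
    (N : ℕ) (ψ : L2 (Fin N) d) (k : ℕ) (t : ℝ) : Op (Fin k) d :=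
  marginal k (evolution (hamiltonianGraph d p₀ V β N) t
    (regularize (hamiltonianGraph d p₀ V β N) χ κ N ψ))

/-! ### Trace class operators and limit points -/

section Trace

variable {E : Type} [NormedAddCommGroup E] [InnerProductSpace ℂ E] [CompleteSpace E]

/-- Trace class operators: `A = ∑ₙ |vₙ⟩⟨uₙ|` with `∑ₙ ‖uₙ‖ ‖vₙ‖ < ∞`. -/
def IsTraceClass (A : E →L[ℂ] E) : Prop :=
  ∃ u v : ℕ → E, Summable (fun n => ‖u n‖ * ‖v n‖) ∧
    ∀ x, HasSum (fun n => ⟪u n, x⟫_ℂ • v n) (A x)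

/-- The trace `∑ᵢ ⟨eᵢ, A eᵢ⟩` over an orthonormal basis (for trace class `A` the sum converges
absolutely and does not depend on the basis). -/
def opTrace (A : E →L[ℂ] E) : ℂ :=
  ∑' i, ⟪(exists_hilbertBasis ℂ E).choose_spec.choose i,
    A ((exists_hilbertBasis ℂ E).choose_spec.choose i)⟫_ℂ

/-- `J` is a sequence of compact operators of norm at most one that is dense in the unit ball of the
space of compact operators. -/
def IsDenseInCompactBall (J : ℕ → E →L[ℂ] E) : Prop :=
  (∀ i, IsCompactOperator (J i) ∧ ‖J i‖ ≤ 1) ∧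
    ∀ K : E →L[ℂ] E, IsCompactOperator K → ‖K‖ ≤ 1 → ∀ ε > 0, ∃ i, ‖K - J i‖ < ε

/-- The metric `η(A, B) = ∑_{i ≥ 1} 2^{-i} |Tr J_i (A - B)|` of the weak* topology on bounded sets
of trace class operators. -/
def weakStarDist (J : ℕ → E →L[ℂ] E) (A B : E →L[ℂ] E) : ℝ :=
  ∑' i : ℕ, (1 / 2 : ℝ) ^ (i + 1) * ‖opTrace (J i ∘L (A - B))‖

/-- `γ ∈ C([0,T], 𝓛¹)`: a path of trace class operators, continuous for the weak* metric. -/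
def IsWeakStarPath (J : ℕ → E →L[ℂ] E) (T : ℝ) (γ : ℝ → E →L[ℂ] E) : Prop :=
  (∀ t ∈ Icc 0 T, IsTraceClass (γ t)) ∧
    ∀ t ∈ Icc 0 T, Tendsto (fun s => weakStarDist J (γ s) (γ t)) (𝓝[Icc 0 T] t) (𝓝 0)

/-- The metric `sup_{t ∈ [0,T]} η(A_t, B_t)`. -/
def pathDist (J : ℕ → E →L[ℂ] E) (T : ℝ) (A B : ℝ → E →L[ℂ] E) : ℝ≥0∞ :=
  ⨆ t ∈ Icc 0 T, ENNReal.ofReal (weakStarDist J (A t) (B t))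

end Trace

/-- `Γ = (γ^{(k)})_{k ≥ 1}` is a limit point of the sequence `G_N = (G_N^{(k)})_{k ≥ 1}` in the
product topology of `⨁_k C([0,T], 𝓛¹_k)`: some subsequence converges to it in each component. -/
def IsLimitPoint {d : ℕ} (J : ∀ k : ℕ, ℕ → Op (Fin k) d) (T : ℝ)
    (G : ℕ → ∀ k : ℕ, ℝ → Op (Fin k) d) (Γ : ∀ k : ℕ, ℝ → Op (Fin k) d) : Prop :=
  (∀ k ≥ 1, IsWeakStarPath (J k) T (Γ k)) ∧
    ∃ n : ℕ → ℕ, StrictMono n ∧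
      ∀ k ≥ 1, Tendsto (fun m => pathDist (J k) T (G (n m) k) (Γ k)) atTop (𝓝 0)

/-! ### The contraction operator and the Sobolev weight -/

/-- A standard mollifier on `ℝ^d`. -/
structure IsMollifier {d : ℕ} (h : EuclideanSpace ℝ (Fin d) → ℝ) : Prop where
  smooth : ContDiff ℝ ∞ h
  compact : HasCompactSupport h
  nonneg : ∀ x, 0 ≤ h x
  integral_eq_one : ∫ x, h x = 1

/-- `h_ε(x) = ε^{-d} h(x/ε)`, an approximation of the delta function. -/
def scaled {d : ℕ} (h : EuclideanSpace ℝ (Fin d) → ℝ) (ε : ℝ) (x : EuclideanSpace ℝ (Fin d)) : ℝ :=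
  (ε ^ d)⁻¹ * h (ε⁻¹ • x)

/-- The integral
`∫ ∏_l h_ε(a - x_{k+l}) h_ε(a - x'_{k+l}) g(x_{k+p}; x'_{k+p}) dx_{k+1} dx'_{k+1} ⋯ dx_{k+p} dx'_{k+p}`
in which the delta functions at the point `a` are replaced by `h_ε`; here `z = (x_k; x'_k)`. -/
def mollifiedPart {k p d : ℕ} (h : EuclideanSpace ℝ (Fin d) → ℝ) (ε : ℝ)
    (g : Conf (Fin (k + p) ⊕ Fin (k + p)) d → ℂ) (a : EuclideanSpace ℝ (Fin d))
    (z : Conf (Fin k ⊕ Fin k) d) : ℂ :=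
  ∫ y : Conf (Fin p ⊕ Fin p) d,
    ((∏ l : Fin p ⊕ Fin p, scaled h ε (a - y.pos l) : ℝ) : ℂ) *
      g (glue
        (join (k + p) le_rfl (Conf.mk fun i => z.pos (Sum.inl i)) (Conf.mk fun i => y.pos (Sum.inl i)))
        (join (k + p) le_rfl (Conf.mk fun i => z.pos (Sum.inr i)) (Conf.mk fun i => y.pos (Sum.inr i))))

/-- The mollified contraction `B⁺ - B⁻`: the delta functions sit at `x_j` in `B⁺` and at `x'_j` in
`B⁻`. -/
def mollifiedContraction {k p d : ℕ} (j : Fin k) (h : EuclideanSpace ℝ (Fin d) → ℝ) (ε : ℝ)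
    (g : Conf (Fin (k + p) ⊕ Fin (k + p)) d → ℂ) (z : Conf (Fin k ⊕ Fin k) d) : ℂ :=
  mollifiedPart h ε g (z.pos (Sum.inl j)) z - mollifiedPart h ε g (z.pos (Sum.inr j)) z

/-- `G = B_{j;k+1,…,k+p} γ`: for every mollifier the mollified contractions of the kernel of `γ`
converge to `G` as distributions when `ε → 0⁺`. This determines `G`. -/
def IsContraction {k p d : ℕ} (j : Fin k) (γ : Op (Fin (k + p)) d)
    (G : L2 (Fin k ⊕ Fin k) d) : Prop :=
  ∃ g : Conf (Fin (k + p) ⊕ Fin (k + p)) d → ℂ, HasKernel γ g ∧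
    ∀ h : EuclideanSpace ℝ (Fin d) → ℝ, IsMollifier h →
    ∀ φ : Conf (Fin k ⊕ Fin k) d → ℂ, ContDiff ℝ ∞ φ → HasCompactSupport φ →
      Tendsto (fun ε : ℝ => ∫ z, mollifiedContraction j h ε g z * φ z) (𝓝[>] 0)
        (𝓝 (∫ z, G z * φ z))

/-- `F = S^{(k,α)} G`, where `S^{(k,α)} = ∏_j (1-Δ_{x_j})^{α/2} (1-Δ_{x'_j})^{α/2}` is the Fourier
multiplier with symbol `∏_l (1 + |2πξ_l|²)^{α/2}` (the Fourier transform has the phase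
`e^{-2πi x·ξ}`). -/
def IsSobolevImage {k d : ℕ} (α : ℝ) (G F : L2 (Fin k ⊕ Fin k) d) : Prop :=
  ∀ᵐ ξ : Conf (Fin k ⊕ Fin k) d,
    (𝓕 F : L2 (Fin k ⊕ Fin k) d) ξ =
      ((∏ l : Fin k ⊕ Fin k, (1 + (2 * Real.pi * ‖ξ.pos l‖) ^ 2) ^ (α / 2) : ℝ) : ℂ) *
        (𝓕 G : L2 (Fin k ⊕ Fin k) d) ξ

end GPHierarchy

end

/-!
# A priori energy bound on limit points of the many-body dynamics

Energy at finite `N`. Let `φ` be the evolved regularized state. It is the image of a bosonic state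
under a function of the Hamiltonian `H` supported in `{H ≤ 2N/κ}`, so every power of `h = (H + N)/N`
has expectation at most the same power of `2/κ + 1` in it. Let `B` be the average over the particles
of bounded lattice approximations of `1 - Δ_{x_i}`. Then `B ≤ h`, because the interaction is
nonnegative, and `B` almost commutes with `h⁻¹`: translating a single particle changes the
interaction by `O(N^{p₀dβ})` only (`interaction_shift_le`), so that
`[B, h⁻¹] = O(N^{p₀dβ - 1}) → 0` at a fixed lattice spacing (`norm_commutator_rescaled_le`). For
operators that almost commute, `B ≤ h` passes to powers (`exists_inner_pow_le`), which bounds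
`⟨φ, B^m φ⟩` by `(2/κ + 1)^m` up to an error that vanishes as `N → ∞`. By bosonic symmetry,
`⟨φ, B^m φ⟩` controls the expectation of the product of the one-particle operators over `m` distinct
particles (`eventually_inner_prodSym_le`).

Energy of the limit. The marginals are sums of rank one operators `|w⟩⟨w|`. Testing the weak* limit
against suitable compact operators bounds the lattice energy of the limiting kernel
(`inner_prodSym_limit_le`), and Fatou's lemma removes the lattice: the Fourier transform of the
kernel `g` of `γ^{(n)}_{∞,t}` satisfies `∫ ∏_l (1 + |2πξ_l|²) |ĝ|² ≤ (2/κ + 1)^{2n}`, the product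
running over all `2n` variables (`exists_kernel_limitPoint`).

Contraction. Setting positions equal means integrating `ĝ` over the relative momenta
(`contractFourier`). By the Cauchy–Schwarz inequality the energy bounds the weighted `L²` norm of
the result, provided that
`(1 + |q|²)^α ∫ ((1 + |q - ∑ η_l|²) ∏ (1 + |η_l|²))⁻¹ dη` is bounded in `q`, up to the factors of
`2π`. This is `exists_weight_bound`, the only place where the conditions on `α` and `d` enter. The
mollified contractions converge to the same object by dominated convergence in Fourier space
(`tendsto_integral_contractionTest`), and `exists_contraction_of_energy` adds the two terms
`B⁺` and `B⁻`.
-/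

set_option linter.unusedSectionVars false

noncomputable section

namespace GPHierarchy

/-! ### Multiplication operators and Fourier multipliers on `L²` -/

section MulOp

variable {X : Type} [MeasurableSpace X] {μ : Measure X}

open Classical in
/-- The operator of multiplication by an essentially bounded function `m` on `L²(μ)`; it is `0` when
`m` is not essentially bounded. -/
def mulOp (μ : Measure X) (m : X → ℂ) : Lp ℂ 2 μ →L[ℂ] Lp ℂ 2 μ :=
  if h : MemLp m ∞ μ then (ContinuousLinearMap.mul ℂ ℂ).holderL μ ∞ 2 2 (h.toLp m) else 0

theorem coeFn_mulOp {m : X → ℂ} (hm : MemLp m ∞ μ) (f : Lp ℂ 2 μ) :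
    mulOp μ m f =ᵐ[μ] fun x => m x * f x := by
  rw [mulOp, dif_pos hm]
  filter_upwards [(ContinuousLinearMap.mul ℂ ℂ).coeFn_holder (r := 2) (hm.toLp m) f,
    hm.coeFn_toLp] with x h1 h2
  simp only [ContinuousLinearMap.holderL_apply_apply]
  rw [h1, h2]
  simp

theorem mulOp_add {m m' : X → ℂ} (hm : MemLp m ∞ μ) (hm' : MemLp m' ∞ μ) :
    mulOp μ (m + m') = mulOp μ m + mulOp μ m' := by
  ext1 f
  apply Lp.ext
  filter_upwards [coeFn_mulOp hm f, coeFn_mulOp hm' f, coeFn_mulOp (hm.add hm') f,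
    Lp.coeFn_add (mulOp μ m f) (mulOp μ m' f)] with x h1 h2 h3 h4
  simp only [add_apply]
  rw [h3, h4, Pi.add_apply, Pi.add_apply, h1, h2, add_mul]

theorem mulOp_mul {m m' : X → ℂ} (hm : MemLp m ∞ μ) (hm' : MemLp m' ∞ μ) :
    mulOp μ (m * m') = mulOp μ m * mulOp μ m' := by
  ext1 f
  apply Lp.ext
  filter_upwards [coeFn_mulOp hm (mulOp μ m' f), coeFn_mulOp hm' f,
    coeFn_mulOp (hm'.mul (r := ∞) hm) f] with x h1 h2 h3
  simp only [mul_apply_eq_comp]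
  rw [h3, h1, h2, Pi.mul_apply, mul_assoc]

theorem mulOp_const (c : ℂ) : mulOp μ (fun _ => c) = c • (1 : Lp ℂ 2 μ →L[ℂ] Lp ℂ 2 μ) := by
  ext1 f
  apply Lp.ext
  filter_upwards [coeFn_mulOp (memLp_top_const (μ := μ) c) f, Lp.coeFn_smul c f] with x h1 h2
  simp only [smul_apply, one_apply_eq_self]
  rw [h1, h2]; simp

theorem inner_mulOp {m : X → ℂ} (hm : MemLp m ∞ μ) (f g : Lp ℂ 2 μ) :
    ⟪f, mulOp μ m g⟫_ℂ = ∫ x, m x * (starRingEnd ℂ (f x) * g x) ∂μ := by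
  rw [L2.inner_def]
  apply integral_congr_ae
  filter_upwards [coeFn_mulOp hm g] with x h1
  rw [h1, RCLike.inner_apply]; ring

theorem inner_mulOp_real_left {m : X → ℝ} (hm : MemLp (fun x => (m x : ℂ)) ∞ μ) (f g : Lp ℂ 2 μ) :
    ⟪mulOp μ (fun x => (m x : ℂ)) f, g⟫_ℂ = ⟪f, mulOp μ (fun x => (m x : ℂ)) g⟫_ℂ := by
  rw [L2.inner_def, L2.inner_def]
  apply integral_congr_ae
  filter_upwards [coeFn_mulOp hm g, coeFn_mulOp hm f] with x h1 h2
  rw [h1, h2, RCLike.inner_apply, RCLike.inner_apply]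
  simp; ring

theorem norm_mulOp_le {m : X → ℂ} {C : ℝ} (hC : 0 ≤ C) (h : ∀ᵐ x ∂μ, ‖m x‖ ≤ C) :
    ‖mulOp μ m‖ ≤ C := by
  by_cases hm : MemLp m ∞ μ
  · refine ContinuousLinearMap.opNorm_le_bound _ hC fun f => ?_
    apply Lp.norm_le_mul_norm_of_ae_le_mul
    filter_upwards [coeFn_mulOp hm f, h] with x h1 h2
    rw [h1, norm_mul]
    gcongr
  · rw [mulOp, dif_neg hm]; simpa

theorem integrable_mul_norm_sq {m : X → ℝ} (hm : MemLp m ∞ μ) (f : Lp ℂ 2 μ) :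
    Integrable (fun x => m x * ‖f x‖ ^ 2) μ := by
  have h2 : Integrable (fun x => ‖f x‖ ^ 2) μ := (Lp.memLp f).integrable_norm_pow (by norm_num)
  have := (memLp_one_iff_integrable.2 h2).mul (r := 1) hm
  exact memLp_one_iff_integrable.1 this

theorem inner_mulOp_self {m : X → ℝ} (hm : MemLp (fun x => (m x : ℂ)) ∞ μ) (f : Lp ℂ 2 μ) :
    ⟪f, mulOp μ (fun x => (m x : ℂ)) f⟫_ℂ = ((∫ x, m x * ‖f x‖ ^ 2 ∂μ : ℝ) : ℂ) := by
  rw [inner_mulOp hm, ← integral_complex_ofReal]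
  congr 1; ext x
  rw [← Complex.normSq_eq_conj_mul_self, Complex.normSq_eq_norm_sq]
  push_cast; rfl

/-- Form monotonicity of multiplication operators; integrability of both sides is what keeps the
Bochner integrals from being junk. -/
theorem inner_mulOp_self_mono {m m' : X → ℝ} (hm : MemLp (fun x => (m x : ℂ)) ∞ μ)
    (hm' : MemLp (fun x => (m' x : ℂ)) ∞ μ) (h : ∀ᵐ x ∂μ, m x ≤ m' x) (f : Lp ℂ 2 μ) :
    (⟪f, mulOp μ (fun x => (m x : ℂ)) f⟫_ℂ).re ≤ (⟪f, mulOp μ (fun x => (m' x : ℂ)) f⟫_ℂ).re := by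
  rw [inner_mulOp_self hm, inner_mulOp_self hm', Complex.ofReal_re, Complex.ofReal_re]
  have e1 : MemLp m ∞ μ := by simpa using hm.re
  have e2 : MemLp m' ∞ μ := by simpa using hm'.re
  apply integral_mono_ae (integrable_mul_norm_sq e1 f) (integrable_mul_norm_sq e2 f)
  filter_upwards [h] with x hx
  exact mul_le_mul_of_nonneg_right hx (by positivity)

end MulOp

section Mult

variable {E : Type} [NormedAddCommGroup E] [InnerProductSpace ℝ E] [FiniteDimensional ℝ E]
  [MeasurableSpace E] [BorelSpace E]

/-- A symbol of a bounded Fourier multiplier: a bounded continuous function. -/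
structure IsSymbol (m : E → ℂ) : Prop where
  continuous : Continuous m
  bounded : ∃ C : ℝ, ∀ x, ‖m x‖ ≤ C

namespace IsSymbol

variable {m m' : E → ℂ}

theorem memLp (h : IsSymbol m) : MemLp m ∞ (volume : Measure E) := by
  obtain ⟨C, hC⟩ := h.bounded
  exact memLp_top_of_bound h.continuous.aestronglyMeasurable C (ae_of_all _ hC)

theorem add (h : IsSymbol m) (h' : IsSymbol m') : IsSymbol (m + m') := by
  obtain ⟨C, hC⟩ := h.bounded
  obtain ⟨C', hC'⟩ := h'.bounded
  exact ⟨h.continuous.add h'.continuous, C + C',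
    fun x => (norm_add_le _ _).trans (add_le_add (hC x) (hC' x))⟩

theorem mul (h : IsSymbol m) (h' : IsSymbol m') : IsSymbol (m * m') := by
  obtain ⟨C, hC⟩ := h.bounded
  obtain ⟨C', hC'⟩ := h'.bounded
  refine ⟨h.continuous.mul h'.continuous, C * C', fun x => ?_⟩
  rw [Pi.mul_apply, norm_mul]
  exact mul_le_mul (hC x) (hC' x) (norm_nonneg _) ((norm_nonneg _).trans (hC x))

theorem const (c : ℂ) : IsSymbol (fun _ : E => c) := ⟨continuous_const, ‖c‖, fun _ => le_rfl⟩

theorem prod {I : Type*} (s : Finset I) {m : I → E → ℂ} (h : ∀ i ∈ s, IsSymbol (m i)) :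
    IsSymbol (∏ i ∈ s, m i) := by
  classical
  induction s using Finset.induction_on with
  | empty => exact const 1
  | insert a s ha ih =>
    rw [Finset.prod_insert ha]
    exact (h a (by simp)).mul (ih fun i hi => h i (by simp [hi]))

theorem sum {I : Type*} (s : Finset I) {m : I → E → ℂ} (h : ∀ i ∈ s, IsSymbol (m i)) :
    IsSymbol (∑ i ∈ s, m i) := by
  classical
  induction s using Finset.induction_on with
  | empty => exact const 0
  | insert a s ha ih =>
    rw [Finset.sum_insert ha]
    exact (h a (by simp)).add (ih fun i hi => h i (by simp [hi]))

theorem comp {E' : Type} [NormedAddCommGroup E'] [InnerProductSpace ℝ E'] [FiniteDimensional ℝ E']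
    [MeasurableSpace E'] [BorelSpace E'] (h : IsSymbol m) {L : E' → E} (hL : Continuous L) :
    IsSymbol (fun x => m (L x)) := by
  obtain ⟨C, hC⟩ := h.bounded
  exact ⟨h.continuous.comp hL, C, fun x => hC _⟩

end IsSymbol

/-- The Fourier multiplier `m(ξ)`, `𝓕 (mult m f) = m 𝓕 f`. -/
def mult (m : E → ℂ) : Lp ℂ 2 (volume : Measure E) →L[ℂ] Lp ℂ 2 (volume : Measure E) :=
  ((Lp.fourierTransformₗᵢ E ℂ).symm : Lp ℂ 2 (volume : Measure E) →L[ℂ] _) ∘L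
    mulOp volume m ∘L (Lp.fourierTransformₗᵢ E ℂ : Lp ℂ 2 (volume : Measure E) →L[ℂ] _)

theorem fourier_mult (m : E → ℂ) (f : Lp ℂ 2 (volume : Measure E)) :
    𝓕 (mult m f) = mulOp volume m (𝓕 f) :=
  (Lp.fourierTransformₗᵢ E ℂ).apply_symm_apply _

theorem fourier_L2_injective : Function.Injective
    (fun f : Lp ℂ 2 (volume : Measure E) => (𝓕 f : Lp ℂ 2 (volume : Measure E))) :=
  (Lp.fourierTransformₗᵢ E ℂ).injective

theorem mult_eq_iff (m : E → ℂ) (f g : Lp ℂ 2 (volume : Measure E)) :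
    mult m f = g ↔ mulOp volume m (𝓕 f) = 𝓕 g := by
  rw [← fourier_mult]; exact fourier_L2_injective.eq_iff.symm

theorem mult_add {m m' : E → ℂ} (hm : IsSymbol m) (hm' : IsSymbol m') :
    mult (m + m') = mult m + mult m' := by
  ext1 f
  apply fourier_L2_injective
  simp only [add_apply, FourierTransform.fourier_add, fourier_mult,
    mulOp_add hm.memLp hm'.memLp]

theorem mult_mul {m m' : E → ℂ} (hm : IsSymbol m) (hm' : IsSymbol m') :
    mult (m * m') = mult m * mult m' := by
  ext1 f
  apply fourier_L2_injective
  simp only [mul_apply_eq_comp, fourier_mult, mulOp_mul hm.memLp hm'.memLp]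

theorem mult_const (c : ℂ) :
    mult (fun _ : E => c) = c • (1 : Lp ℂ 2 (volume : Measure E) →L[ℂ] _) := by
  ext1 f
  apply fourier_L2_injective
  simp only [fourier_mult, mulOp_const, smul_apply,
    one_apply_eq_self, FourierTransform.fourier_smul]

theorem mult_smul (c : ℂ) {m : E → ℂ} (hm : IsSymbol m) : mult (c • m) = c • mult m := by
  have : c • m = (fun _ => c) * m := by ext; simp
  rw [this, mult_mul (IsSymbol.const c) hm, mult_const]; simp

theorem mult_sum {I : Type*} (s : Finset I) {m : I → E → ℂ} (h : ∀ i ∈ s, IsSymbol (m i)) :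
    mult (∑ i ∈ s, m i) = ∑ i ∈ s, mult (m i) := by
  classical
  induction s using Finset.induction_on with
  | empty =>
    have : (0 : E → ℂ) = fun _ => (0 : ℂ) := rfl
    simp [this, mult_const]
  | insert a s ha ih =>
    rw [Finset.sum_insert ha, Finset.sum_insert ha,
      mult_add (h a (by simp)) (IsSymbol.sum s fun i hi => h i (by simp [hi])),
      ih fun i hi => h i (by simp [hi])]

theorem mult_pow {m : E → ℂ} (hm : IsSymbol m) (n : ℕ) :
    IsSymbol (m ^ n) ∧ mult (m ^ n) = mult m ^ n := by
  induction n with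
  | zero =>
    have : (m ^ 0 : E → ℂ) = fun _ => (1 : ℂ) := by ext; simp
    rw [this, mult_const]
    exact ⟨IsSymbol.const 1, by simp⟩
  | succ n ih =>
    rw [pow_succ, pow_succ]
    exact ⟨ih.1.mul hm, by rw [mult_mul ih.1 hm, ih.2]⟩

theorem mult_commute {m m' : E → ℂ} (hm : IsSymbol m) (hm' : IsSymbol m') :
    mult m * mult m' = mult m' * mult m := by
  rw [← mult_mul hm hm', ← mult_mul hm' hm, mul_comm]

theorem inner_mult (m : E → ℂ) (f g : Lp ℂ 2 (volume : Measure E)) :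
    ⟪f, mult m g⟫_ℂ = ⟪(𝓕 f : Lp ℂ 2 (volume : Measure E)), mulOp volume m (𝓕 g)⟫_ℂ := by
  rw [← Lp.inner_fourier_eq, fourier_mult]

theorem inner_mult_real_left {m : E → ℝ} (hm : IsSymbol (fun x => (m x : ℂ)))
    (f g : Lp ℂ 2 (volume : Measure E)) :
    ⟪mult (fun x => (m x : ℂ)) f, g⟫_ℂ = ⟪f, mult (fun x => (m x : ℂ)) g⟫_ℂ := by
  rw [inner_mult, ← Lp.inner_fourier_eq, fourier_mult, inner_mulOp_real_left hm.memLp]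

theorem inner_mult_self {m : E → ℝ} (hm : IsSymbol (fun x => (m x : ℂ)))
    (f : Lp ℂ 2 (volume : Measure E)) :
    ⟪f, mult (fun x => (m x : ℂ)) f⟫_ℂ =
      ((∫ x, m x * ‖(𝓕 f : Lp ℂ 2 (volume : Measure E)) x‖ ^ 2 : ℝ) : ℂ) := by
  rw [inner_mult, inner_mulOp_self hm.memLp]

theorem inner_mult_self_mono {m m' : E → ℝ} (hm : IsSymbol (fun x => (m x : ℂ)))
    (hm' : IsSymbol (fun x => (m' x : ℂ))) (h : ∀ x, m x ≤ m' x)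
    (f : Lp ℂ 2 (volume : Measure E)) :
    (⟪f, mult (fun x => (m x : ℂ)) f⟫_ℂ).re ≤ (⟪f, mult (fun x => (m' x : ℂ)) f⟫_ℂ).re := by
  rw [inner_mult, inner_mult]
  exact inner_mulOp_self_mono hm.memLp hm'.memLp (ae_of_all _ h) _

/-- Translation of the argument, `(transl v f)(x) = f(x + v)`. -/
def transl (v : E) : Lp ℂ 2 (volume : Measure E) →L[ℂ] Lp ℂ 2 (volume : Measure E) :=
  (Lp.compMeasurePreservingₗᵢ ℂ (fun x : E => x + v)
    (measurePreserving_add_right volume v)).toContinuousLinearMap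

theorem coeFn_transl (v : E) (f : Lp ℂ 2 (volume : Measure E)) :
    transl v f =ᵐ[volume] fun x => f (x + v) :=
  Lp.coeFn_compMeasurePreserving f (measurePreserving_add_right volume v)

theorem norm_transl_apply (v : E) (f : Lp ℂ 2 (volume : Measure E)) : ‖transl v f‖ = ‖f‖ :=
  LinearIsometry.norm_map _ _

/-- The character `ξ ↦ e^{2πi v·ξ}`, the symbol of the translation by `v`. -/
def expChar (v : E) (ξ : E) : ℂ := Complex.exp (2 * Real.pi * Complex.I * (inner ℝ v ξ : ℝ))

theorem norm_expChar (v ξ : E) : ‖expChar v ξ‖ = 1 := by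
  rw [expChar, Complex.norm_exp]; simp

theorem isSymbol_expChar (v : E) : IsSymbol (expChar v) := by
  refine ⟨?_, 1, fun x => (norm_expChar v x).le⟩
  unfold expChar; fun_prop

/-- Bounded operators on `L²` that agree on Schwartz functions are equal. -/
theorem clm_ext_schwartz {E' : Type} [NormedAddCommGroup E'] [InnerProductSpace ℝ E']
    [FiniteDimensional ℝ E'] [MeasurableSpace E'] [BorelSpace E']
    {A B : Lp ℂ 2 (volume : Measure E) →L[ℂ] Lp ℂ 2 (volume : Measure E')}
    (h : ∀ f : 𝓢(E, ℂ), A (f.toLp 2) = B (f.toLp 2)) : A = B := by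
  have hd := SchwartzMap.denseRange_toLpCLM (F := ℂ) (E := E) (μ := volume) (p := 2)
    ENNReal.ofNat_ne_top
  apply ContinuousLinearMap.coeFn_injective
  exact hd.equalizer A.continuous B.continuous (funext h)

theorem mult_expChar (v : E) : mult (expChar v) = transl v := by
  apply clm_ext_schwartz
  intro f
  rw [mult_eq_iff]
  have h1 : transl v (f.toLp 2) = (f.compSubConstCLM ℂ (-v)).toLp 2 := by
    apply Lp.ext
    filter_upwards [coeFn_transl v (f.toLp 2), SchwartzMap.coeFn_toLp (f.compSubConstCLM ℂ (-v)) 2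
      volume, (measurePreserving_add_right volume v).quasiMeasurePreserving.ae
        (SchwartzMap.coeFn_toLp f 2 volume)] with x h1 h2 h3
    rw [h1, h2, h3]; simp
  rw [h1, SchwartzMap.toLp_fourier_eq, SchwartzMap.toLp_fourier_eq]
  apply Lp.ext
  filter_upwards [coeFn_mulOp (isSymbol_expChar v).memLp ((𝓕 f).toLp 2),
    SchwartzMap.coeFn_toLp (𝓕 f) 2 volume,
    SchwartzMap.coeFn_toLp (𝓕 (f.compSubConstCLM ℂ (-v))) 2 volume] with ξ h1 h2 h3
  rw [h1, h2, h3, SchwartzMap.fourier_coe, SchwartzMap.fourier_coe]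
  have h4 : ((f.compSubConstCLM ℂ (-v) : 𝓢(E, ℂ)) : E → ℂ) = fun x => f (x + v) := by
    ext x; simp
  rw [h4]
  have := congrFun (VectorFourier.fourierIntegral_comp_add_right Real.fourierChar
    (volume : Measure E) (innerₗ E) f v) ξ
  change _ = VectorFourier.fourierIntegral Real.fourierChar volume (innerₗ E)
    (fun x => f (x + v)) ξ
  refine Eq.trans ?_ this.symm
  rw [Circle.smul_def, Real.fourierChar_apply]
  simp only [expChar, innerₗ_apply_apply, smul_eq_mul]
  congr 2
  push_cast; ring

/-- Composition with a linear isometry of the underlying spaces. -/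
def isomComp {E' : Type} [NormedAddCommGroup E'] [InnerProductSpace ℝ E']
    [FiniteDimensional ℝ E'] [MeasurableSpace E'] [BorelSpace E'] (e : E' ≃ₗᵢ[ℝ] E) :
    Lp ℂ 2 (volume : Measure E) →L[ℂ] Lp ℂ 2 (volume : Measure E') :=
  (Lp.compMeasurePreservingₗᵢ ℂ e e.measurePreserving).toContinuousLinearMap

section Isom

variable {E' : Type} [NormedAddCommGroup E'] [InnerProductSpace ℝ E']
    [FiniteDimensional ℝ E'] [MeasurableSpace E'] [BorelSpace E']

theorem coeFn_isomComp (e : E' ≃ₗᵢ[ℝ] E) (f : Lp ℂ 2 (volume : Measure E)) :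
    isomComp e f =ᵐ[volume] fun x => f (e x) :=
  Lp.coeFn_compMeasurePreserving f e.measurePreserving

theorem inner_isomComp (e : E' ≃ₗᵢ[ℝ] E) (f g : Lp ℂ 2 (volume : Measure E)) :
    ⟪isomComp e f, isomComp e g⟫_ℂ = ⟪f, g⟫_ℂ :=
  LinearIsometry.inner_map_map _ _ _

theorem norm_isomComp (e : E' ≃ₗᵢ[ℝ] E) (f : Lp ℂ 2 (volume : Measure E)) :
    ‖isomComp e f‖ = ‖f‖ :=
  LinearIsometry.norm_map _ _

theorem fourier_isomComp (e : E' ≃ₗᵢ[ℝ] E) (f : Lp ℂ 2 (volume : Measure E)) :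
    𝓕 (isomComp e f) = isomComp e (𝓕 f) := by
  have : ((Lp.fourierTransformₗᵢ E' ℂ : Lp ℂ 2 (volume : Measure E') →L[ℂ] _) ∘L isomComp e) =
      isomComp e ∘L (Lp.fourierTransformₗᵢ E ℂ : Lp ℂ 2 (volume : Measure E) →L[ℂ] _) := by
    apply clm_ext_schwartz
    intro f
    change 𝓕 (isomComp e (f.toLp 2)) = isomComp e (𝓕 (f.toLp 2))
    have h1 : ∀ g : 𝓢(E, ℂ), isomComp e (g.toLp 2) =
        (SchwartzMap.compCLMOfContinuousLinearEquiv ℂ e.toContinuousLinearEquiv g).toLp 2 := by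
      intro g
      apply Lp.ext
      filter_upwards [coeFn_isomComp e (g.toLp 2), SchwartzMap.coeFn_toLp
        (SchwartzMap.compCLMOfContinuousLinearEquiv ℂ e.toContinuousLinearEquiv g) 2 volume,
        e.measurePreserving.quasiMeasurePreserving.ae
          (SchwartzMap.coeFn_toLp g 2 volume)] with x h1 h2 h3
      rw [h1, h2, h3]; rfl
    rw [h1, SchwartzMap.toLp_fourier_eq, SchwartzMap.toLp_fourier_eq, h1]
    congr 1
    ext ξ
    rw [SchwartzMap.fourier_coe]
    exact Real.fourier_comp_linearIsometry e f ξ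
  exact DFunLike.congr_fun this f

theorem isomComp_mult (e : E' ≃ₗᵢ[ℝ] E) {m : E → ℂ} (hm : IsSymbol m)
    (f : Lp ℂ 2 (volume : Measure E)) :
    isomComp e (mult m f) = mult (fun x => m (e x)) (isomComp e f) := by
  apply fourier_L2_injective
  simp only [fourier_mult, fourier_isomComp]
  apply Lp.ext
  filter_upwards [coeFn_isomComp e (mulOp volume m (𝓕 f)), coeFn_isomComp e (𝓕 f),
    coeFn_mulOp (hm.comp e.continuous).memLp (isomComp e (𝓕 f)),
    e.measurePreserving.quasiMeasurePreserving.ae (coeFn_mulOp hm.memLp (𝓕 f))] with x h1 h2 h3 h4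
  rw [h1, h3, h4, h2]

end Isom

/-- On `L²` the distributional identity `f = -Δ u` is the pointwise identity `𝓕 f = |2πξ|² 𝓕 u`. -/
theorem fourier_laplacian_iff (u f : Lp ℂ 2 (volume : Measure E)) :
    (f : 𝓢'(E, ℂ)) = -Δ (u : 𝓢'(E, ℂ)) ↔
      ∀ᵐ ξ, (𝓕 f : Lp ℂ 2 (volume : Measure E)) ξ =
        (((2 * Real.pi * ‖ξ‖) ^ 2 : ℝ) : ℂ) * (𝓕 u : Lp ℂ 2 (volume : Measure E)) ξ := by
  have htg : (fun x : E => Complex.ofReal (‖x‖ ^ 2)).HasTemperateGrowth := by fun_prop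
  have h1 : (f : 𝓢'(E, ℂ)) = -Δ (u : 𝓢'(E, ℂ)) ↔
      (((𝓕 f : Lp ℂ 2 (volume : Measure E))) : 𝓢'(E, ℂ)) =
        (((2 * Real.pi) ^ 2 : ℝ) : ℂ) • TemperedDistribution.smulLeftCLM ℂ
          (fun x : E => Complex.ofReal (‖x‖ ^ 2))
            ((𝓕 u : Lp ℂ 2 (volume : Measure E)) : 𝓢'(E, ℂ)) := by
    rw [← Lp.fourier_toTemperedDistribution_eq, ← Lp.fourier_toTemperedDistribution_eq]
    rw [TemperedDistribution.laplacian_eq_fourierMultiplierCLM, neg_smul, neg_neg,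
      TemperedDistribution.fourierMultiplierCLM_apply, ← Complex.coe_smul]
    constructor
    · intro h
      rw [h, FourierTransform.fourier_smul, FourierTransform.fourier_fourierInv_eq]
    · intro h
      have := congrArg (fun T : 𝓢'(E, ℂ) => 𝓕⁻ T) h
      simpa [FourierTransform.fourierInv_smul] using this
  rw [h1]
  have h2 : ∀ φ : 𝓢(E, ℂ), ((((2 * Real.pi) ^ 2 : ℝ) : ℂ) • TemperedDistribution.smulLeftCLM ℂ
      (fun x : E => Complex.ofReal (‖x‖ ^ 2)) ((𝓕 u : Lp ℂ 2 (volume : Measure E)) : 𝓢'(E, ℂ))) φ =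
      ∫ ξ, φ ξ • ((((2 * Real.pi * ‖ξ‖) ^ 2 : ℝ) : ℂ) * (𝓕 u : Lp ℂ 2 (volume : Measure E)) ξ) := by
    intro φ
    change (((2 * Real.pi) ^ 2 : ℝ) : ℂ) • (TemperedDistribution.smulLeftCLM ℂ
      (fun x : E => Complex.ofReal (‖x‖ ^ 2)) ((𝓕 u : Lp ℂ 2 (volume : Measure E)) : 𝓢'(E, ℂ))) φ = _
    rw [TemperedDistribution.smulLeftCLM_apply_apply, Lp.toTemperedDistribution_apply,
      ← integral_smul]
    congr 1; ext ξ
    rw [SchwartzMap.smulLeftCLM_apply_apply htg]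
    simp only [smul_eq_mul]; push_cast; ring
  constructor
  · intro h
    apply ae_eq_of_integral_contDiff_smul_eq
    · exact (Lp.memLp _).locallyIntegrable (by norm_num)
    · have hu : LocallyIntegrable (𝓕 u : Lp ℂ 2 (volume : Measure E)) volume :=
        (Lp.memLp _).locallyIntegrable (by norm_num)
      have hc : Continuous fun ξ : E => (((2 * Real.pi * ‖ξ‖) ^ 2 : ℝ) : ℂ) := by fun_prop
      rw [← locallyIntegrableOn_univ] at hu ⊢
      exact hu.continuousOn_mul hc.continuousOn isOpen_univ.isLocallyClosed
    · intro g hg hgc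
      have hg₁ : HasCompactSupport (Complex.ofRealCLM ∘ g) := hgc.comp_left rfl
      have hg₂ : ContDiff ℝ ∞ (Complex.ofRealCLM ∘ g) := by fun_prop
      have h3 := DFunLike.congr_fun h (hg₁.toSchwartzMap hg₂)
      rw [h2, Lp.toTemperedDistribution_apply] at h3
      simpa using h3
  · intro h
    ext φ
    rw [h2, Lp.toTemperedDistribution_apply]
    apply integral_congr_ae
    filter_upwards [h] with ξ hξ
    rw [hξ]

end Mult

/-! ### Powers of an operator that almost commutes with an energy -/

section Abstract

/-- The Leibniz rule for `[R ^ k, B]`. The exponent `k - 1` is harmless at `k = 0`, where the factor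
`k` vanishes. -/
theorem norm_commutator_pow_le {A : Type} [NormedRing A] (R B : A) {K : ℝ}
    (hK : 0 ≤ K) (hR : ‖R‖ ≤ K) (k : ℕ) :
    ‖R ^ k * B - B * R ^ k‖ ≤ k * K ^ (k - 1) * ‖R * B - B * R‖ := by
  rcases subsingleton_or_nontrivial A with h | h
  · rw [Subsingleton.elim (R ^ k * B - B * R ^ k) 0, norm_zero]; positivity
  induction k with
  | zero => simp
  | succ k ih =>
    have h1 : R ^ (k + 1) * B - B * R ^ (k + 1) =
        (R ^ k * B - B * R ^ k) * R + R ^ k * (R * B - B * R) := by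
      rw [pow_succ]; noncomm_ring
    have h2 : ‖R ^ k * (R * B - B * R)‖ ≤ K ^ k * ‖R * B - B * R‖ := by
      rcases k.eq_zero_or_pos with rfl | hk
      · simp
      · refine (norm_mul_le _ _).trans ?_
        gcongr
        exact (norm_pow_le' R hk).trans (by gcongr)
    have h3 : ‖(R ^ k * B - B * R ^ k) * R‖ ≤ k * K ^ k * ‖R * B - B * R‖ := by
      rcases k.eq_zero_or_pos with rfl | hk
      · simp
      · refine (norm_mul_le _ _).trans ?_
        calc _ ≤ (k * K ^ (k - 1) * ‖R * B - B * R‖) * K := by gcongr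
          _ = k * (K ^ (k - 1) * K) * ‖R * B - B * R‖ := by ring
          _ = _ := by rw [← pow_succ, Nat.sub_add_cancel hk]
    rw [h1]
    refine (norm_add_le _ _).trans ((add_le_add h3 h2).trans (le_of_eq ?_))
    rw [Nat.add_sub_cancel]; push_cast; ring

/-- The constant depends on the polynomial only, not on the algebra or its elements. -/
theorem exists_norm_commutator_aeval_le (p : Polynomial ℝ) :
    ∃ C : ℝ, 0 ≤ C ∧ ∀ (A : Type) [NormedRing A] [NormedAlgebra ℝ A] (R B : A), ‖R‖ ≤ 1 →
      ‖Polynomial.aeval R p * B - B * Polynomial.aeval R p‖ ≤ C * ‖R * B - B * R‖ := by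
  induction p using Polynomial.induction_on' with
  | add p q hp hq =>
    obtain ⟨C, hC, h⟩ := hp
    obtain ⟨C', hC', h'⟩ := hq
    refine ⟨C + C', by positivity, fun A _ _ R B hR => ?_⟩
    have : Polynomial.aeval R (p + q) * B - B * Polynomial.aeval R (p + q) =
      (Polynomial.aeval R p * B - B * Polynomial.aeval R p) +
        (Polynomial.aeval R q * B - B * Polynomial.aeval R q) := by
      rw [map_add]; noncomm_ring
    rw [this, add_mul]
    exact (norm_add_le _ _).trans (add_le_add (h A R B hR) (h' A R B hR))
  | monomial n a =>
    refine ⟨|a| * n, by positivity, fun A _ _ R B hR => ?_⟩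
    rw [Polynomial.aeval_monomial, Algebra.algebraMap_eq_smul_one, smul_mul_assoc, one_mul,
      smul_mul_assoc, mul_smul_comm, ← smul_sub, norm_smul, Real.norm_eq_abs, mul_assoc]
    gcongr
    simpa using norm_commutator_pow_le R B zero_le_one hR n

variable {H : Type} [NormedAddCommGroup H] [InnerProductSpace ℂ H] [CompleteSpace H]

theorem spectrum_subset_unitInterval {R : H →L[ℂ] H} (h0 : 0 ≤ R) (h1 : R ≤ 1) :
    spectrum ℝ R ⊆ Icc 0 1 := by
  intro x hx
  refine ⟨spectrum_nonneg_of_nonneg h0 hx, ?_⟩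
  have := (le_algebraMap_iff_spectrum_le (a := R) (r := (1 : ℝ))).1 (by simpa using h1) x hx
  exact this

/-- A continuous function of `R` almost commutes with `B` when `R` does, uniformly in the operators:
this is clear for polynomials, hence by the Weierstrass theorem for continuous functions. -/
theorem exists_commutator_cfc_small {f : ℝ → ℝ} (hf : ContinuousOn f (Icc 0 1)) (K : ℝ) {ε : ℝ}
    (hε : 0 < ε) : ∃ δ > 0, ∀ (H : Type) [NormedAddCommGroup H] [InnerProductSpace ℂ H]
      [CompleteSpace H] (R B : H →L[ℂ] H), 0 ≤ R → R ≤ 1 → ‖B‖ ≤ K → ‖R * B - B * R‖ ≤ δ →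
      ‖cfc f R * B - B * cfc f R‖ ≤ ε := by
  obtain ⟨p, hp⟩ := exists_polynomial_near_of_continuousOn 0 1 f hf (ε / (4 * (|K| + 1)))
    (by positivity)
  obtain ⟨C, hC, hpC⟩ := exists_norm_commutator_aeval_le p
  refine ⟨ε / (2 * (C + 1)), by positivity, fun H _ _ _ R B h0 h1 hB hδ => ?_⟩
  have hsa : IsSelfAdjoint R := IsSelfAdjoint.of_nonneg h0
  have hspec := spectrum_subset_unitInterval h0 h1
  have hR : ‖R‖ ≤ 1 := (CStarAlgebra.norm_le_one_iff_of_nonneg R h0).2 h1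
  have hd : ‖cfc f R - Polynomial.aeval R p‖ ≤ ε / (4 * (|K| + 1)) := by
    rw [← cfc_polynomial p R hsa, ← cfc_sub f p.eval R (hf.mono hspec)]
    refine norm_cfc_le (by positivity) fun x hx => ?_
    rw [Real.norm_eq_abs, abs_sub_comm]
    exact (hp x (hspec hx)).le
  set D := cfc f R - Polynomial.aeval R p
  have e : cfc f R * B - B * cfc f R =
      (Polynomial.aeval R p * B - B * Polynomial.aeval R p) + (D * B - B * D) := by
    simp only [D]; noncomm_ring
  have hB' : ‖B‖ ≤ |K| + 1 := hB.trans ((le_abs_self K).trans (by linarith))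
  have e1 : ‖D * B‖ ≤ ε / 4 := by
    refine (norm_mul_le _ _).trans ?_
    calc _ ≤ ε / (4 * (|K| + 1)) * (|K| + 1) := by gcongr
      _ = ε / 4 := by field_simp
  have e2 : ‖B * D‖ ≤ ε / 4 := by
    refine (norm_mul_le _ _).trans ?_
    calc _ ≤ (|K| + 1) * (ε / (4 * (|K| + 1))) := by gcongr
      _ = ε / 4 := by field_simp
  have e3 : ‖Polynomial.aeval R p * B - B * Polynomial.aeval R p‖ ≤ ε / 2 := by
    refine (hpC _ R B hR).trans ?_
    calc _ ≤ C * (ε / (2 * (C + 1))) := by gcongr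
      _ ≤ (C + 1) * (ε / (2 * (C + 1))) := by gcongr; linarith
      _ = ε / 2 := by field_simp
  rw [e]
  have := norm_add_le (Polynomial.aeval R p * B - B * Polynomial.aeval R p) (D * B - B * D)
  have := norm_sub_le (D * B) (B * D)
  linarith

/-- The cutoff `r ↦ min (C r) 1` applied to `R = h⁻¹`; it is the identity on the spectral subspace
`h ≤ C`. -/
def cutoff (C : ℝ) (r : ℝ) : ℝ := r * (max r C⁻¹)⁻¹

theorem continuous_cutoff {C : ℝ} (hC : 0 < C) : Continuous (cutoff C) := by
  unfold cutoff
  have h : ∀ r : ℝ, max r C⁻¹ ≠ 0 := fun r => (lt_max_of_lt_right (by positivity)).ne'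
  exact continuous_id.mul ((continuous_id.max continuous_const).inv₀ h)

/-- With `F` the cutoff of `R`, the hypothesis `R B R ≤ R` says that `B ≤ R⁻¹`, and `F R⁻¹ F ≤ C`
because `F` is at most `C R`. As `R` need not be invertible, `R⁻¹` is avoided by writing
`F = k R` with a function `k` of `R`. -/
theorem cutoff_mul_mul_cutoff_le {C : ℝ} (hC : 0 < C) {R B : H →L[ℂ] H} (h0 : 0 ≤ R) (h1 : R ≤ 1)
    (hB : 0 ≤ B) (hRB : R * B * R ≤ R) :
    ‖cfc (cutoff C) R * B * cfc (cutoff C) R‖ ≤ C := by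
  have hsa : IsSelfAdjoint R := IsSelfAdjoint.of_nonneg h0
  have hspec := spectrum_subset_unitInterval h0 h1
  have hk : Continuous fun r : ℝ => (max r C⁻¹)⁻¹ :=
    (continuous_id.max continuous_const).inv₀
      fun r => (lt_max_of_lt_right (by positivity)).ne'
  set k := cfc (fun r : ℝ => (max r C⁻¹)⁻¹) R with hkdef
  have hksa : IsSelfAdjoint k := cfc_predicate _ _
  have e1 : cfc (cutoff C) R = R * k := by
    unfold cutoff
    rw [cfc_mul (fun r => r) (fun r : ℝ => (max r C⁻¹)⁻¹) R continuousOn_id hk.continuousOn,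
      cfc_id' ℝ R]
  have e2 : cfc (cutoff C) R = k * R := by
    have : cutoff C = fun r => (max r C⁻¹)⁻¹ * r := by ext r; rw [cutoff, mul_comm]
    rw [this, cfc_mul (fun r : ℝ => (max r C⁻¹)⁻¹) (fun r => r) R hk.continuousOn continuousOn_id,
      cfc_id' ℝ R]
  have hF : IsSelfAdjoint (cfc (cutoff C) R) := cfc_predicate _ _
  have hpos : 0 ≤ cfc (cutoff C) R * B * cfc (cutoff C) R := hF.conjugate_nonneg hB
  rw [CStarAlgebra.norm_le_iff_le_algebraMap _ hC.le hpos]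
  have e3 : cfc (cutoff C) R * B * cfc (cutoff C) R = k * (R * B * R) * k := by
    nth_rw 1 [e2]; rw [e1]; noncomm_ring
  rw [e3]
  refine (hksa.conjugate_le_conjugate hRB).trans ?_
  have e4 : k * R * k = cfc (fun r : ℝ => (max r C⁻¹)⁻¹ * r * (max r C⁻¹)⁻¹) R := by
    rw [cfc_mul (fun r : ℝ => (max r C⁻¹)⁻¹ * r) (fun r => (max r C⁻¹)⁻¹) R
        (hk.mul continuous_id).continuousOn hk.continuousOn,
      cfc_mul (fun r : ℝ => (max r C⁻¹)⁻¹) (fun r => r) R hk.continuousOn continuousOn_id,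
      cfc_id' ℝ R]
  rw [e4]
  refine cfc_le_algebraMap _ _ _ (fun r hr => ?_) ((hk.mul continuous_id).mul hk).continuousOn
  have hr0 := (hspec hr).1
  have hm : C⁻¹ ≤ max r C⁻¹ := le_max_right _ _
  have hmp : 0 < max r C⁻¹ := lt_of_lt_of_le (by positivity) hm
  have h5 : (max r C⁻¹)⁻¹ ≤ C := by
    have := inv_anti₀ (by positivity) hm
    rwa [inv_inv] at this
  have h6 : (max r C⁻¹)⁻¹ * r ≤ 1 := by
    rw [inv_mul_le_iff₀ hmp]; simp
  calc _ ≤ 1 * C := by gcongr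
    _ = C := one_mul C

/-- If `B` is dominated by the energy `h = R⁻¹` (that is `R B R ≤ R`) and almost commutes with it,
then `⟨ψ, B^m ψ⟩ ≤ C^m + ε` for every `ψ` in the spectral subspace `h ≤ C`. The closeness `δ` is
uniform over all Hilbert spaces and all operators `B` of norm at most `K`. -/
theorem exists_inner_pow_le (m : ℕ) (K : ℝ) {C : ℝ} (hC : 0 < C) {ε : ℝ} (hε : 0 < ε) :
    ∃ δ > 0, ∀ (H : Type) [NormedAddCommGroup H] [InnerProductSpace ℂ H]
      [CompleteSpace H] (R B : H →L[ℂ] H), 0 ≤ R → R ≤ 1 → 0 ≤ B → ‖B‖ ≤ K → R * B * R ≤ R →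
      ‖R * B - B * R‖ ≤ δ → ∀ ψ : H, ‖ψ‖ ≤ 1 → cfc (cutoff C) R ψ = ψ →
      (⟪ψ, (B ^ m) ψ⟫_ℂ).re ≤ C ^ m + ε := by
  -- it suffices to compare `B ^ m ψ` with `(F B F) ^ m ψ`, where `F` is the cutoff of `R`
  suffices hs : ∀ (m : ℕ) (ε : ℝ), 0 < ε → ∃ δ > 0, ∀ (H : Type) [NormedAddCommGroup H]
      [InnerProductSpace ℂ H] [CompleteSpace H] (R B : H →L[ℂ] H), 0 ≤ R → R ≤ 1 → 0 ≤ B →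
      ‖B‖ ≤ K → R * B * R ≤ R → ‖R * B - B * R‖ ≤ δ → ∀ ψ : H, ‖ψ‖ ≤ 1 →
      cfc (cutoff C) R ψ = ψ →
      ‖((cfc (cutoff C) R * B * cfc (cutoff C) R) ^ m) ψ - (B ^ m) ψ‖ ≤ ε by
    obtain ⟨δ, hδ, h⟩ := hs m ε hε
    refine ⟨δ, hδ, fun H _ _ _ R B h0 h1 hB hBK hRB hc ψ hψ hF => ?_⟩
    set G := cfc (cutoff C) R * B * cfc (cutoff C) R
    have h2 := h H R B h0 h1 hB hBK hRB hc ψ hψ hF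
    have hG : ‖G‖ ≤ C := cutoff_mul_mul_cutoff_le hC h0 h1 hB hRB
    have h3 : ‖(G ^ m) ψ‖ ≤ C ^ m := by
      have : ∀ n : ℕ, ‖(G ^ n) ψ‖ ≤ C ^ n := by
        intro n
        induction n with
        | zero => simpa using hψ
        | succ n ih =>
          rw [pow_succ', pow_succ', mul_apply_eq_comp]
          exact (G.le_opNorm _).trans (mul_le_mul hG ih (norm_nonneg _) hC.le)
      exact this m
    have h4 : ‖(B ^ m) ψ‖ ≤ C ^ m + ε := by
      have := norm_sub_norm_le ((B ^ m) ψ) ((G ^ m) ψ)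
      rw [norm_sub_rev] at this
      linarith
    calc (⟪ψ, (B ^ m) ψ⟫_ℂ).re ≤ ‖⟪ψ, (B ^ m) ψ⟫_ℂ‖ := Complex.re_le_norm _
      _ ≤ ‖ψ‖ * ‖(B ^ m) ψ‖ := norm_inner_le_norm _ _
      _ ≤ 1 * (C ^ m + ε) := by gcongr
      _ = _ := one_mul _
  intro m
  induction m with
  | zero => intro ε hε; exact ⟨1, one_pos, fun H _ _ _ R B _ _ _ _ _ _ ψ _ _ => by simp [hε.le]⟩
  | succ m ih =>
    intro ε hε
    obtain ⟨δ₁, hδ₁, h₁⟩ := ih (ε / (2 * C)) (by positivity)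
    set K' := max K 1 with hK'
    have hK1 : 1 ≤ K' := le_max_right _ _
    set M : ℝ := K' * (m * K' ^ (m - 1)) + (m + 1) * K' ^ m with hM
    have hM0 : 0 < M := by positivity
    obtain ⟨δ₂, hδ₂, h₂⟩ := exists_commutator_cfc_small (f := cutoff C)
      (continuous_cutoff hC).continuousOn K (ε := ε / (2 * M)) (by positivity)
    refine ⟨min δ₁ δ₂, lt_min hδ₁ hδ₂, fun H _ _ _ R B h0 h1 hB hBK hRB hc ψ hψ hFψ => ?_⟩
    have h3 := h₁ H R B h0 h1 hB hBK hRB (hc.trans (min_le_left _ _)) ψ hψ hFψ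
    have h4 := h₂ H R B h0 h1 hBK (hc.trans (min_le_right _ _))
    have hGC := cutoff_mul_mul_cutoff_le hC h0 h1 hB hRB
    set F := cfc (cutoff C) R
    have hBK' : ‖B‖ ≤ K' := hBK.trans (le_max_left _ _)
    have hFn : ‖F‖ ≤ 1 := by
      refine norm_cfc_le zero_le_one fun r hr => ?_
      have hr0 := (spectrum_subset_unitInterval h0 h1 hr).1
      have hmp : 0 < max r C⁻¹ := lt_of_lt_of_le (by positivity) (le_max_right _ _)
      rw [cutoff, Real.norm_eq_abs, abs_of_nonneg (by positivity), mul_inv_le_iff₀ hmp, one_mul]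
      exact le_max_left _ _
    have c0 : ∀ n : ℕ, ‖F * B ^ n - B ^ n * F‖ ≤ n * K' ^ (n - 1) * (ε / (2 * M)) := by
      intro n
      have := norm_commutator_pow_le B F (by positivity) hBK' n
      rw [norm_sub_rev, norm_sub_rev (B * F)] at this
      exact this.trans (by gcongr)
    -- use `F ψ = ψ` and move the two `F`s through the powers of `B`
    have e1 : ((F * B * F) ^ (m + 1)) ψ - (B ^ (m + 1)) ψ =
        (F * B * F) (((F * B * F) ^ m) ψ - (B ^ m) ψ) +
          (F * B * (F * B ^ m - B ^ m * F) + (F * B ^ (m + 1) - B ^ (m + 1) * F)) ψ := by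
      simp only [pow_succ', mul_apply_eq_comp, map_sub, add_apply, sub_apply, hFψ]
      abel
    have n1 : ‖(F * B * F) (((F * B * F) ^ m) ψ - (B ^ m) ψ)‖ ≤ ε / 2 := by
      refine (ContinuousLinearMap.le_opNorm _ _).trans ?_
      calc _ ≤ C * (ε / (2 * C)) := by gcongr
        _ = ε / 2 := by field_simp
    have n2 : ‖F * B * (F * B ^ m - B ^ m * F) + (F * B ^ (m + 1) - B ^ (m + 1) * F)‖ ≤ ε / 2 := by
      have hFB : ‖F * B‖ ≤ K' := by
        refine (norm_mul_le _ _).trans ?_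
        calc _ ≤ 1 * K' := by gcongr
          _ = K' := one_mul _
      have c1 := c0 m
      have c2 := c0 (m + 1)
      calc _ ≤ ‖F * B * (F * B ^ m - B ^ m * F)‖ + ‖F * B ^ (m + 1) - B ^ (m + 1) * F‖ :=
            norm_add_le _ _
        _ ≤ K' * (m * K' ^ (m - 1) * (ε / (2 * M))) +
            ((m + 1 : ℕ) * K' ^ (m + 1 - 1) * (ε / (2 * M))) := by
            refine add_le_add ((norm_mul_le _ _).trans ?_) c2
            gcongr
        _ = M * (ε / (2 * M)) := by rw [hM, Nat.add_sub_cancel]; push_cast; ring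
        _ = ε / 2 := by field_simp
    rw [e1]
    refine (norm_add_le _ _).trans ?_
    have n3 := (ContinuousLinearMap.le_opNorm (F * B * (F * B ^ m - B ^ m * F) +
      (F * B ^ (m + 1) - B ^ (m + 1) * F)) ψ).trans (mul_le_mul n2 hψ (norm_nonneg _) (by positivity))
    linarith

end Abstract

/-! ### Functional calculus through the resolvent -/

section FunctionalCalculus

variable {H : Type} [NormedAddCommGroup H] [InnerProductSpace ℂ H] [CompleteSpace H]

/-- The function `g` of the resolvent `r = (s + 1)⁻¹` that represents the function `f` of `s`. -/
def resFun (f : ℝ → ℂ) (r : ℂ) : ℂ := if r = 0 then 0 else f (r.re⁻¹ - 1)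

theorem resFun_mul (f g : ℝ → ℂ) (r : ℂ) :
    resFun f r * resFun g r = resFun (fun s => f s * g s) r := by
  unfold resFun; split_ifs <;> simp

/-- The complex spectrum of `0 ≤ R ≤ 1` consists of real numbers in `[0, 1]`. -/
theorem mem_spectrum_complex {R : H →L[ℂ] H} (h0 : 0 ≤ R) (h1 : R ≤ 1) {z : ℂ}
    (hz : z ∈ spectrum ℂ R) : z = (z.re : ℂ) ∧ z.re ∈ Icc (0 : ℝ) 1 := by
  have hsa : IsSelfAdjoint R := IsSelfAdjoint.of_nonneg h0
  have h := hsa.mem_spectrum_eq_re hz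
  refine ⟨h, spectrum_subset_unitInterval h0 h1 ?_⟩
  rw [← spectrum.algebraMap_mem_iff ℂ]
  rw [h] at hz
  exact hz

/-- `resFun f` is continuous on the spectrum also at `0`, because `f` vanishes at infinity. -/
theorem continuousOn_resFun {R : H →L[ℂ] H} (h0 : 0 ≤ R) (h1 : R ≤ 1) {f : ℝ → ℂ}
    (hf : ContinuousOn f (Ici 0)) (hf0 : Tendsto f atTop (𝓝 0)) :
    ContinuousOn (resFun f) (spectrum ℂ R) := by
  have hmaps : ∀ z ∈ spectrum ℂ R, z ≠ 0 → 0 < z.re ∧ 0 ≤ z.re⁻¹ - 1 := by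
    intro z hz hne
    obtain ⟨e, h2, h3⟩ := mem_spectrum_complex h0 h1 hz
    have hpos : 0 < z.re := lt_of_le_of_ne h2 fun h => hne (by rw [e, ← h]; simp)
    exact ⟨hpos, by have := (one_le_inv₀ hpos).2 h3; linarith⟩
  intro z hz
  by_cases hne : z = 0
  · subst hne
    -- near `0` the argument `r⁻¹ - 1` tends to infinity, where `f` vanishes
    rw [ContinuousWithinAt]
    have e0 : resFun f 0 = 0 := by simp [resFun]
    rw [e0, Metric.tendsto_nhds]
    intro ε hε
    obtain ⟨S, hS⟩ := (Filter.eventually_atTop.1 ((Metric.tendsto_nhds.1 hf0) ε hε))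
    have hb : Metric.ball (0 : ℂ) (|S| + 1)⁻¹ ∈ 𝓝 (0 : ℂ) := Metric.ball_mem_nhds _ (by positivity)
    filter_upwards [mem_nhdsWithin_of_mem_nhds hb, self_mem_nhdsWithin] with r hr hrs
    by_cases hr0 : r = 0
    · rw [hr0, e0]; simpa using hε
    · rw [resFun, if_neg hr0]
      apply hS
      have hpos := (hmaps r hrs hr0).1
      have h2 : r.re < (|S| + 1)⁻¹ := by
        have := (Complex.abs_re_le_norm r).trans_lt (by simpa using hr)
        rwa [abs_of_pos hpos] at this
      have h3 : |S| + 1 < r.re⁻¹ := by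
        rw [lt_inv_comm₀ (by positivity) hpos]; exact h2
      have := le_abs_self S
      linarith
  · have hpos := (hmaps z hz hne).1
    have hc : ContinuousWithinAt (fun r : ℂ => f (r.re⁻¹ - 1)) (spectrum ℂ R ∩ {0}ᶜ) z := by
      have hin : ContinuousWithinAt (fun r : ℂ => r.re⁻¹ - 1) (spectrum ℂ R ∩ {0}ᶜ) z :=
        ((Complex.continuous_re.continuousAt.inv₀ hpos.ne').sub continuousAt_const)
          |>.continuousWithinAt
      exact ContinuousWithinAt.comp (t := Ici 0) (hf _ (hmaps z hz hne).2) hin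
        fun r hr => (hmaps r hr.1 hr.2).2
    have hnhds : ({0}ᶜ : Set ℂ) ∈ 𝓝 z := isOpen_compl_singleton.mem_nhds hne
    rw [← continuousWithinAt_inter hnhds]
    refine hc.congr (fun r hr => ?_) ?_
    · rw [resFun, if_neg (show r ≠ 0 from hr.2)]
    · rw [resFun, if_neg hne]

/-- The functions `f(s) / (1 + s/(n+1))` used to define `f(A)` for functions `f` that do not
vanish at infinity. -/
def dampened (f : ℝ → ℂ) (n : ℕ) (s : ℝ) : ℂ := f s / (1 + s / (n + 1))

theorem one_le_norm_damping (s : ℝ) (n : ℕ) :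
    1 + s / (n + 1) ≤ ‖(1 + s / (n + 1) : ℂ)‖ := by
  have : (1 + s / (n + 1) : ℂ) = ((1 + s / (n + 1) : ℝ) : ℂ) := by push_cast; rfl
  rw [this, Complex.norm_real]
  exact le_abs_self _

theorem damping_ne_zero {s : ℝ} (hs : 0 ≤ s) (n : ℕ) : (1 + s / (n + 1) : ℂ) ≠ 0 := by
  have h1 := one_le_norm_damping s n
  have h2 : 0 ≤ s / (n + 1) := by positivity
  intro h
  rw [h, norm_zero] at h1
  linarith

theorem continuousOn_dampened {f : ℝ → ℂ} (hf : Continuous f) (n : ℕ) :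
    ContinuousOn (dampened f n) (Ici 0) := by
  unfold dampened
  refine ContinuousOn.div hf.continuousOn ?_ fun s hs => damping_ne_zero hs n
  fun_prop

theorem tendsto_dampened {f : ℝ → ℂ} (hf : ∀ s, ‖f s‖ ≤ 1) (n : ℕ) :
    Tendsto (dampened f n) atTop (𝓝 0) := by
  rw [tendsto_zero_iff_norm_tendsto_zero]
  have h1 : Tendsto (fun s : ℝ => (1 + s / (n + 1))⁻¹) atTop (𝓝 0) := by
    apply tendsto_inv_atTop_zero.comp
    apply tendsto_atTop_add_const_left
    exact tendsto_id.atTop_div_const (by positivity)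
  refine squeeze_zero' (Eventually.of_forall fun _ => norm_nonneg _) ?_ h1
  filter_upwards [eventually_ge_atTop 0] with s hs
  have hp : 0 < 1 + s / (n + 1) := by positivity
  rw [dampened, norm_div, div_eq_mul_inv, ← one_mul (1 + s / (n + 1))⁻¹]
  exact mul_le_mul (hf s) (inv_anti₀ hp (one_le_norm_damping s n)) (by positivity) zero_le_one

/-- If `f` vanishes from some point on, the dampened functions converge to `f` uniformly. -/
theorem tendsto_cfc_dampened {R : H →L[ℂ] H} (h0 : 0 ≤ R) (h1 : R ≤ 1) {f : ℝ → ℂ}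
    (hf : Continuous f) (hf1 : ∀ s, ‖f s‖ ≤ 1) {S : ℝ} (hS : ∀ s, S ≤ s → f s = 0) :
    Tendsto (fun n : ℕ => cfc (resFun (dampened f n)) R) atTop (𝓝 (cfc (resFun f) R)) := by
  apply tendsto_cfc_fun
  · rw [Metric.tendstoUniformlyOn_iff]
    intro ε hε
    obtain ⟨N, hN⟩ := exists_nat_gt (|S| / ε)
    filter_upwards [eventually_ge_atTop N] with n hn z hz
    by_cases hne : z = 0
    · simp [resFun, hne, hε]
    obtain ⟨e, h2, h3⟩ := mem_spectrum_complex h0 h1 hz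
    have hpos : 0 < z.re := lt_of_le_of_ne h2 fun h => hne (by rw [e, ← h]; simp)
    have hs : 0 ≤ z.re⁻¹ - 1 := by have := (one_le_inv₀ hpos).2 h3; linarith
    rw [resFun, if_neg hne, resFun, if_neg hne]
    set s := z.re⁻¹ - 1
    by_cases hsS : S ≤ s
    · simp [dampened, hS s hsS, hε]
    · have hd := damping_ne_zero hs n
      have e1 : f s - dampened f n s = f s * (s / (n + 1)) / (1 + s / (n + 1)) := by
        rw [dampened, eq_div_iff hd, sub_mul, div_mul_cancel₀ _ hd]; ring
      have e2 : ‖((s : ℂ) / (n + 1))‖ = s / (n + 1) := by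
        have : ((s : ℂ) / (n + 1)) = ((s / (n + 1) : ℝ) : ℂ) := by push_cast; rfl
        rw [this, Complex.norm_real, Real.norm_eq_abs, abs_of_nonneg (by positivity)]
      have h5 := one_le_norm_damping s n
      have h6 : 0 ≤ s / (n + 1) := by positivity
      rw [dist_eq_norm, e1, norm_div, norm_mul, e2]
      have hn1 : |S| / ε < n + 1 := by
        have : (N : ℝ) ≤ n := by exact_mod_cast hn
        linarith
      calc _ ≤ 1 * (s / (n + 1)) / 1 := by
            gcongr
            · exact hf1 s
            · linarith
        _ = s / (n + 1) := by ring
        _ ≤ |S| / (n + 1) := by gcongr; exact (not_le.1 hsS).le.trans (le_abs_self S)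
        _ < ε := by rw [div_lt_iff₀ (by positivity)]; rw [div_lt_iff₀ hε] at hn1; linarith
  · exact Eventually.of_forall fun n =>
      continuousOn_resFun h0 h1 (continuousOn_dampened hf n) (tendsto_dampened hf1 n)

/-- For functions that vanish from some point on, the limit in the definition of `funcCalc` exists
and is the continuous functional calculus of the resolvent. -/
theorem funcCalc_eq_of_eventually_zero {A : Set (H × H)} (h0 : 0 ≤ invAddOne A)
    (h1 : invAddOne A ≤ 1) {f : ℝ → ℂ} (hf : Continuous f) (hf1 : ∀ s, ‖f s‖ ≤ 1) {S : ℝ}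
    (hS : ∀ s, S ≤ s → f s = 0) (ψ : H) :
    funcCalc A f ψ = cfc (resFun f) (invAddOne A) ψ := by
  apply Tendsto.limUnder_eq
  have := tendsto_cfc_dampened h0 h1 hf hf1 hS
  exact ((ContinuousLinearMap.apply ℂ H ψ).continuous.tendsto _).comp this

theorem tendsto_zero_of_eventually_zero {f : ℝ → ℂ} {S : ℝ} (hS : ∀ s, S ≤ s → f s = 0) :
    Tendsto f atTop (𝓝 0) :=
  tendsto_const_nhds.congr' (by
    filter_upwards [eventually_ge_atTop S] with s hs; rw [hS s hs])

/-- The limit that defines `e^{-itA}` exists on the vectors `f(A) ψ` with `f` vanishing from some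
point on, and it is `(e^{-its} f(s))(A) ψ`. -/
theorem evolution_cfc {A : Set (H × H)} (h0 : 0 ≤ invAddOne A) (h1 : invAddOne A ≤ 1) (t : ℝ)
    {f : ℝ → ℂ} (hf : Continuous f) (hf1 : ∀ s, ‖f s‖ ≤ 1) {S : ℝ} (hS : ∀ s, S ≤ s → f s = 0)
    (ψ : H) :
    evolution A t (cfc (resFun f) (invAddOne A) ψ) =
      cfc (resFun fun s => Complex.exp (-(Complex.I * t * s)) * f s) (invAddOne A) ψ := by
  apply Tendsto.limUnder_eq
  set R := invAddOne A
  have hexp : ∀ s : ℝ, ‖Complex.exp (-(Complex.I * t * s))‖ = 1 := by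
    intro s; rw [Complex.norm_exp]; simp
  have he : Continuous fun s : ℝ => Complex.exp (-(Complex.I * t * s)) := by fun_prop
  have hb : ∀ s : ℝ, ‖Complex.exp (-(Complex.I * t * s)) * f s‖ ≤ 1 := by
    intro s; rw [norm_mul, hexp, one_mul]; exact hf1 s
  have := tendsto_cfc_dampened h0 h1 (f := fun s => Complex.exp (-(Complex.I * t * s)) * f s)
    (he.mul hf) hb (S := S) fun s hs => by rw [hS s hs, mul_zero]
  have h2 := ((ContinuousLinearMap.apply ℂ H ψ).continuous.tendsto _).comp this
  refine h2.congr fun n => ?_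
  simp only [Function.comp_apply, ContinuousLinearMap.apply_apply]
  have c1 := continuousOn_resFun h0 h1 (continuousOn_dampened he n)
    (tendsto_dampened (fun s => (hexp s).le) n)
  have c2 := continuousOn_resFun h0 h1 hf.continuousOn (tendsto_zero_of_eventually_zero hS)
  have e1 : funcCalcZero A (fun s => Complex.exp (-(Complex.I * t * s)) / (1 + s / (n + 1))) =
      cfc (resFun (dampened (fun s : ℝ => Complex.exp (-(Complex.I * t * s))) n)) R := rfl
  rw [e1, ← mul_apply_eq_comp, ← cfc_mul _ _ _ c1 c2]
  congr 2; ext r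
  rw [resFun_mul]
  congr 1; ext s
  rw [dampened, dampened, mul_div_right_comm]

/-- The inverse `h⁻¹` of `h = (A + N) / N` as a function of `r = (A + 1)⁻¹`. -/
def rescaled (N : ℝ) (r : ℝ) : ℝ := N * r / (1 + (N - 1) * r)

/-- The regularized and evolved state is `W ψ` with a function `W` of `A` that is supported in the
spectral subspace `A ≤ 2N/κ`. -/
theorem exists_evolution_regularize {A : Set (H × H)} (h0 : 0 ≤ invAddOne A)
    (h1 : invAddOne A ≤ 1) {χ : ℝ → ℝ} (hχ : Continuous χ) (hχ1 : ∀ s, 0 ≤ χ s ∧ χ s ≤ 1)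
    (hχ2 : ∀ s, 2 ≤ s → χ s = 0) {κ : ℝ} (hκ : 0 < κ) {N : ℕ} (hN : 1 ≤ N) (t : ℝ) (ψ : H) :
    ∃ W : H →L[ℂ] H, (∀ X : H →L[ℂ] H, Commute (invAddOne A) X → Commute W X) ∧
      evolution A t (regularize A χ κ N ψ) = W ψ ∧ ‖W ψ‖ ≤ 1 ∧
      cfc (fun r => cutoff (2 / κ + 1) (rescaled N r)) (invAddOne A) * W = W := by
  set R := invAddOne A with hR
  have hsa : IsSelfAdjoint R := IsSelfAdjoint.of_nonneg h0
  have hN0 : (0 : ℝ) < N := by exact_mod_cast hN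
  set f : ℝ → ℂ := fun s => (χ (κ / N * s) : ℂ) with hf
  have hfc : Continuous f := by simp only [hf]; fun_prop
  have hf1 : ∀ s, ‖f s‖ ≤ 1 := fun s => by
    simp only [hf, Complex.norm_real, Real.norm_eq_abs]
    rw [abs_of_nonneg (hχ1 _).1]; exact (hχ1 _).2
  have hfS : ∀ s, 2 * N / κ ≤ s → f s = 0 := fun s hs => by
    simp only [hf]
    rw [hχ2, Complex.ofReal_zero]
    rw [div_le_iff₀ hκ] at hs
    rw [div_mul_eq_mul_div, le_div_iff₀ hN0]; linarith
  set g : ℝ → ℂ := fun s => Complex.exp (-(Complex.I * t * s)) * f s with hg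
  have hexp : ∀ s : ℝ, ‖Complex.exp (-(Complex.I * t * s))‖ = 1 := by
    intro s; rw [Complex.norm_exp]; simp
  have hgc : Continuous g := by simp only [hg]; fun_prop
  have hgS : ∀ s, 2 * N / κ ≤ s → g s = 0 := fun s hs => by simp only [hg, hfS s hs, mul_zero]
  have cf := continuousOn_resFun h0 h1 hfc.continuousOn (tendsto_zero_of_eventually_zero hfS)
  have cg := continuousOn_resFun h0 h1 hgc.continuousOn (tendsto_zero_of_eventually_zero hgS)
  set c : ℝ := ‖cfc (resFun f) R ψ‖⁻¹ with hc
  refine ⟨(c : ℂ) • cfc (resFun g) R, ?_, ?_, ?_, ?_⟩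
  · intro X hX
    exact (Commute.cfc hX (by rwa [hsa.star_eq]) _).smul_left _
  · have e1 : regularize A χ κ N ψ = (c : ℂ) • cfc (resFun f) R ψ := by
      rw [regularize, funcCalc_eq_of_eventually_zero h0 h1 hfc hf1 hfS, Complex.coe_smul]
    have e2 : (c : ℂ) • cfc (resFun f) R ψ = cfc (resFun f) R ((c : ℂ) • ψ) := by
      rw [map_smul]
    rw [e1, e2, evolution_cfc h0 h1 t hfc hf1 hfS, map_smul]
    rfl
  · -- the phase does not change the norm, so `c` is also the normalization of the evolved state
    have hnorm : ‖cfc (resFun g) R ψ‖ = ‖cfc (resFun f) R ψ‖ := by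
      have key : ∀ u : ℝ → ℂ, ContinuousOn (resFun u) (spectrum ℂ R) →
          ((‖cfc (resFun u) R ψ‖ ^ 2 : ℝ) : ℂ) =
            ⟪cfc (fun z => star (resFun u z) * resFun u z) R ψ, ψ⟫_ℂ := by
        intro u hu
        rw [cfc_mul _ _ R (by fun_prop) hu, cfc_star]
        rw [mul_apply_eq_comp, ContinuousLinearMap.star_eq_adjoint,
          ContinuousLinearMap.adjoint_inner_left, inner_self_eq_norm_sq_to_K]
        push_cast; rfl
      have h2 : (fun z => star (resFun g z) * resFun g z) =
          fun z => star (resFun f z) * resFun f z := by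
        ext z
        simp only [resFun, hg]
        split_ifs
        · simp
        · have := hexp (z.re⁻¹ - 1)
          simp only [Complex.star_def]
          rw [← Complex.normSq_eq_conj_mul_self,
            ← Complex.normSq_eq_conj_mul_self, Complex.normSq_eq_norm_sq,
            Complex.normSq_eq_norm_sq, norm_mul, this, one_mul]
      have h3 : ((‖cfc (resFun g) R ψ‖ ^ 2 : ℝ) : ℂ) = ((‖cfc (resFun f) R ψ‖ ^ 2 : ℝ) : ℂ) := by
        rw [key g cg, key f cf, h2]
      have h4 : ‖cfc (resFun g) R ψ‖ ^ 2 = ‖cfc (resFun f) R ψ‖ ^ 2 := by exact_mod_cast h3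
      exact (pow_left_inj₀ (norm_nonneg _) (norm_nonneg _) two_ne_zero).1 h4
    rw [smul_apply, norm_smul, hnorm, Complex.norm_real, hc, norm_inv, norm_norm]
    exact inv_mul_le_one
  · rw [mul_smul_comm]
    congr 1
    rw [cfc_real_eq_complex _ hsa, ← cfc_mul _ _ R ?_ cg]
    · refine cfc_congr fun z hz => ?_
      obtain ⟨e, h2, h3⟩ := mem_spectrum_complex h0 h1 hz
      simp only [resFun]
      split_ifs with hz0
      · simp
      · have hpos : 0 < z.re := lt_of_le_of_ne h2 fun h => hz0 (by rw [e, ← h]; simp)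
        -- where `g` does not vanish, `A < 2N/κ`, so `(A + N)/N < 2/κ + 1` and the cutoff is `1`
        by_cases hs : 2 * N / κ ≤ z.re⁻¹ - 1
        · rw [hgS _ hs, mul_zero]
        · have hN1 : (1 : ℝ) ≤ N := by exact_mod_cast hN
          have hden : 0 < 1 + ((N : ℝ) - 1) * z.re := by
            have := mul_nonneg (sub_nonneg.2 hN1) h2; linarith
          have h4 : (2 / κ + 1)⁻¹ ≤ rescaled N z.re := by
            rw [rescaled, inv_le_comm₀ (by positivity) (by positivity), inv_div,
              div_le_iff₀ (by positivity)]
            have h5 : z.re⁻¹ < 2 * N / κ + 1 := by linarith [not_le.1 hs]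
            rw [inv_lt_iff_one_lt_mul₀ hpos] at h5
            have : (2 / κ + 1) * (N * z.re) = (2 * N / κ + 1) * z.re + (N - 1) * z.re := by
              field_simp; ring
            linarith
          have h6 : cutoff (2 / κ + 1) (rescaled N z.re) = 1 := by
            rw [cutoff, max_eq_left h4, mul_inv_cancel₀]
            exact (lt_of_lt_of_le (by positivity) h4).ne'
          rw [h6]; simp
    · have hN1 : (1 : ℝ) ≤ N := by exact_mod_cast hN
      have hcont : ContinuousOn (fun r : ℝ => cutoff (2 / κ + 1) (rescaled N r)) (Icc 0 1) := by
        refine (continuous_cutoff (by positivity)).comp_continuousOn ?_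
        unfold rescaled
        refine ContinuousOn.div (by fun_prop) (by fun_prop) fun r hr => ?_
        have := mul_nonneg (sub_nonneg.2 hN1) hr.1
        linarith
      refine Complex.continuous_ofReal.comp_continuousOn (hcont.comp
        Complex.continuous_re.continuousOn fun z hz => (mem_spectrum_complex h0 h1 hz).2)

end FunctionalCalculus

/-! ### Perturbation of a resolvent by a bounded nonnegative potential -/

section Resolvent

variable {H : Type} [NormedAddCommGroup H] [InnerProductSpace ℂ H] [CompleteSpace H]

theorem opNonneg_iff {T : H →L[ℂ] H} :
    0 ≤ T ↔ ∀ x, ((⟪T x, x⟫_ℂ).re : ℂ) = ⟪T x, x⟫_ℂ ∧ 0 ≤ (⟪T x, x⟫_ℂ).re := by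
  rw [ContinuousLinearMap.nonneg_iff_isPositive]
  exact ContinuousLinearMap.isPositive_iff_complex T

theorem inner_self_re_of_nonneg {T : H →L[ℂ] H} (hT : 0 ≤ T) (x : H) :
    ((⟪T x, x⟫_ℂ).re : ℂ) = ⟪T x, x⟫_ℂ := (opNonneg_iff.1 hT x).1

theorem re_inner_nonneg {T : H →L[ℂ] H} (hT : 0 ≤ T) (x : H) : 0 ≤ (⟪T x, x⟫_ℂ).re :=
  (opNonneg_iff.1 hT x).2

theorem re_inner_mono {S T : H →L[ℂ] H} (h : S ≤ T) (x : H) :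
    (⟪S x, x⟫_ℂ).re ≤ (⟪T x, x⟫_ℂ).re := by
  have := re_inner_nonneg (sub_nonneg.2 h) x
  rw [sub_apply, inner_sub_left, Complex.sub_re] at this
  linarith

theorem inner_symm_of_nonneg {T : H →L[ℂ] H} (hT : 0 ≤ T) (x y : H) : ⟪T x, y⟫_ℂ = ⟪x, T y⟫_ℂ := by
  rw [← ContinuousLinearMap.adjoint_inner_right, ← ContinuousLinearMap.star_eq_adjoint,
    (IsSelfAdjoint.of_nonneg hT).star_eq]

theorem le_of_re_inner_le {S T : H →L[ℂ] H} (hS : IsSelfAdjoint S) (hT : IsSelfAdjoint T)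
    (h : ∀ x, (⟪S x, x⟫_ℂ).re ≤ (⟪T x, x⟫_ℂ).re) : S ≤ T := by
  rw [← sub_nonneg, ContinuousLinearMap.nonneg_iff_isPositive,
    ContinuousLinearMap.isPositive_def]
  refine ⟨ContinuousLinearMap.isSelfAdjoint_iff_isSymmetric.1 (hT.sub hS), fun x => ?_⟩
  have := h x
  change 0 ≤ (⟪(T - S) x, x⟫_ℂ).re
  rw [sub_apply, inner_sub_left, Complex.sub_re]
  linarith

variable {Z V R : H →L[ℂ] H}

/-- With `Z = Q²` and `V ≥ 0`, the equation `u = Z (f - V u)` is solved by the symmetric operator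
`R = Q (1 + Q V Q)⁻¹ Q`. -/
theorem exists_resolvent {Q : H →L[ℂ] H} (hQ : IsSelfAdjoint Q) (hV : 0 ≤ V) :
    ∃ R : H →L[ℂ] H, ∀ f u, R f = u ↔ u = (Q * Q) (f - V u) := by
  have h1 : (1 : H →L[ℂ] H) ≤ 1 + Q * V * Q := le_add_of_nonneg_right (hQ.conjugate_nonneg hV)
  have hu : IsUnit (1 + Q * V * Q) := CStarAlgebra.isUnit_of_le 1 h1
    isStrictlyPositive_one
  obtain ⟨M, hM⟩ := hu
  have hMM : ∀ v, M.val (M.inv v) = v := fun v => by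
    rw [← mul_apply_eq_comp, M.val_inv]; rfl
  have hMM' : ∀ v, M.inv (M.val v) = v := fun v => by
    rw [← mul_apply_eq_comp, M.inv_val]; rfl
  have hMv : ∀ v, M.val v = v + Q (V (Q v)) := fun v => by rw [hM]; rfl
  refine ⟨Q * M.inv * Q, fun f u => ⟨?_, ?_⟩⟩
  · rintro rfl
    have h2 := hMM (Q f)
    rw [hMv] at h2
    have h3 : M.inv (Q f) = Q (f - V (Q (M.inv (Q f)))) := by
      rw [map_sub]; exact eq_sub_of_add_eq h2
    exact congrArg Q h3
  · intro h
    have h2 : M.val (Q (f - V u)) = Q f := by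
      rw [hMv, ← mul_apply_eq_comp Q Q, ← h, map_sub, sub_add_cancel]
    rw [mul_apply_eq_comp, mul_apply_eq_comp, ← h2, hMM', ← mul_apply_eq_comp, ← h]

theorem resolvent_nonneg (hZ : 0 ≤ Z) (hV : 0 ≤ V) (hR : R = Z - Z * V * R) : 0 ≤ R := by
  rw [opNonneg_iff]
  intro f
  have hu : R f = Z (f - V (R f)) := by
    conv_lhs => rw [hR]
    simp
  have e : ⟪R f, f⟫_ℂ = ⟪Z (f - V (R f)), f - V (R f)⟫_ℂ + ⟪V (R f), R f⟫_ℂ := by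
    rw [inner_symm_of_nonneg hV, ← hu, inner_sub_right]; ring
  rw [e, Complex.add_re, Complex.ofReal_add, inner_self_re_of_nonneg hZ,
    inner_self_re_of_nonneg hV]
  exact ⟨rfl, add_nonneg (re_inner_nonneg hZ _) (re_inner_nonneg hV _)⟩

theorem resolvent_eq' (hZ : 0 ≤ Z) (hV : 0 ≤ V) (hR : R = Z - Z * V * R) : R = Z - R * V * Z := by
  have h0 := IsSelfAdjoint.of_nonneg (resolvent_nonneg hZ hV hR)
  have := congrArg star hR
  rw [star_sub, star_mul, star_mul, h0.star_eq, (IsSelfAdjoint.of_nonneg hV).star_eq,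
    (IsSelfAdjoint.of_nonneg hZ).star_eq, ← mul_assoc] at this
  exact this

/-- The form inequality `S ≤ Z⁻¹` is inherited by `R⁻¹ = Z⁻¹ + V`. -/
theorem conj_resolvent_le {S : H →L[ℂ] H} (hS : IsSelfAdjoint S) (hZ : 0 ≤ Z) (hV : 0 ≤ V)
    (hR : R = Z - Z * V * R) (hSZ : Z * S * Z ≤ Z) : R * S * R ≤ R := by
  have hR0 := resolvent_nonneg hZ hV hR
  have hRsa := IsSelfAdjoint.of_nonneg hR0
  refine le_of_re_inner_le (hS.conjugate_self hRsa) hRsa fun f => ?_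
  have hu : R f = Z (f - V (R f)) := by
    conv_lhs => rw [hR]
    simp
  set g := f - V (R f) with hg
  have h1 := re_inner_mono hSZ g
  have e1 : ⟪(R * S * R) f, f⟫_ℂ = ⟪(Z * S * Z) g, g⟫_ℂ := by
    simp only [mul_apply_eq_comp]
    rw [inner_symm_of_nonneg hR0, inner_symm_of_nonneg hZ, ← hu]
  have e2 : ⟪R f, f⟫_ℂ = ⟪Z g, g⟫_ℂ + ⟪V (R f), R f⟫_ℂ := by
    rw [inner_symm_of_nonneg hV, ← hu, hg, inner_sub_right]; ring
  rw [e1, e2, Complex.add_re]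
  have := re_inner_nonneg hV (R f)
  linarith

theorem resolvent_le_one (hZ : 0 ≤ Z) (hZ1 : Z ≤ 1) (hV : 0 ≤ V) (hR : R = Z - Z * V * R) :
    R ≤ 1 := by
  have hR0 := resolvent_nonneg hZ hV hR
  have h2 : Z * 1 * Z ≤ Z := by
    have hZsa := IsSelfAdjoint.of_nonneg hZ
    have hsp := spectrum_subset_unitInterval hZ hZ1
    have e : Z * 1 * Z = cfc (fun r : ℝ => r * r) Z := by
      rw [mul_one, cfc_mul (fun r : ℝ => r) (fun r => r) Z, cfc_id' ℝ Z]
    rw [e]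
    conv_rhs => rw [← cfc_id' ℝ Z]
    exact cfc_mono fun x hx => mul_le_of_le_one_left (hsp hx).1 (hsp hx).2
  have h3 := conj_resolvent_le (IsSelfAdjoint.one _) hZ hV hR h2
  rw [← CStarAlgebra.norm_le_one_iff_of_nonneg R hR0]
  refine ContinuousLinearMap.opNorm_le_bound _ zero_le_one fun f => ?_
  have h4 := re_inner_mono h3 f
  rw [mul_one, mul_apply_eq_comp, inner_symm_of_nonneg hR0] at h4
  have h5 : (⟪R f, R f⟫_ℂ).re = ‖R f‖ ^ 2 := by
    rw [← inner_self_eq_norm_sq (𝕜 := ℂ)]; rfl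
  have h6 : (⟪R f, f⟫_ℂ).re ≤ ‖R f‖ * ‖f‖ := (Complex.re_le_norm _).trans (norm_inner_le_norm _ _)
  rw [h5] at h4
  rw [one_mul]
  by_contra hlt
  push Not at hlt
  have : 0 < ‖R f‖ := (norm_nonneg f).trans_lt hlt
  nlinarith

/-- If `X` commutes with `Z`, the commutator `[R, X]` comes from the potential only. -/
theorem commutator_resolvent {X : H →L[ℂ] H} (hZ : 0 ≤ Z) (hV : 0 ≤ V) (hR : R = Z - Z * V * R)
    (hX : X * Z = Z * X) : R * X - X * R = R * (X * V - V * X) * R := by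
  have hR' := resolvent_eq' hZ hV hR
  have e1 : R * X - R * X * V * R = (Z - R * V * Z) * X * (1 - V * R) := by
    rw [← hR']; noncomm_ring
  have e2 : X * R - R * V * X * R = (1 - R * V) * X * (Z - Z * V * R) := by
    rw [← hR]; noncomm_ring
  have e3 : (Z - R * V * Z) * X * (1 - V * R) = (1 - R * V) * X * (Z - Z * V * R) := by
    have a1 : (Z - R * V * Z) * X * (1 - V * R) = (1 - R * V) * (Z * X) * (1 - V * R) := by
      noncomm_ring
    have a2 : (1 - R * V) * X * (Z - Z * V * R) = (1 - R * V) * (X * Z) * (1 - V * R) := by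
      noncomm_ring
    rw [a1, a2, hX]
  have e4 := e1.trans (e3.trans e2.symm)
  have e5 : R * (X * V - V * X) * R = R * X * V * R - R * V * X * R := by noncomm_ring
  rw [e5, sub_eq_sub_iff_add_eq_add]
  rw [sub_eq_sub_iff_add_eq_add] at e4
  rw [e4]; abel

/-- The rescaled resolvent `R_N = ((H + N) / N)⁻¹` is `N R Y` with `Y = (1 + (N - 1) R)⁻¹`. -/
theorem exists_rescaled_factor (hR0 : 0 ≤ R) (hR1 : R ≤ 1) {N : ℝ} (hN : 1 ≤ N) :
    0 ≤ cfc (rescaled N) R ∧ cfc (rescaled N) R ≤ 1 ∧ ∃ Y : H →L[ℂ] H, IsSelfAdjoint Y ∧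
      Y * (1 + (N - 1) • R) = 1 ∧ (1 + (N - 1) • R) * Y = 1 ∧
      cfc (rescaled N) R = N • (R * Y) ∧ cfc (rescaled N) R = N • (Y * R) := by
  have hRsa := IsSelfAdjoint.of_nonneg hR0
  have hsp := spectrum_subset_unitInterval hR0 hR1
  have hden : ∀ r ∈ spectrum ℝ R, 0 < 1 + (N - 1) * r := fun r hr => by
    have := mul_nonneg (sub_nonneg.2 hN) (hsp hr).1; linarith
  have hcY : ContinuousOn (fun r : ℝ => (1 + (N - 1) * r)⁻¹) (spectrum ℝ R) :=
    ContinuousOn.inv₀ (by fun_prop) fun r hr => (hden r hr).ne'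
  have hcR : ContinuousOn (fun r : ℝ => N * r) (spectrum ℝ R) := by fun_prop
  have hcres : ContinuousOn (rescaled N) (spectrum ℝ R) := by
    unfold rescaled
    exact ContinuousOn.div (by fun_prop) (by fun_prop) fun r hr => (hden r hr).ne'
  have hPc : 1 + (N - 1) • R = cfc (fun r : ℝ => 1 + (N - 1) * r) R := by
    rw [cfc_add R (fun _ => (1 : ℝ)) (fun r => (N - 1) * r), cfc_const_one ℝ R,
      cfc_const_mul (N - 1) (fun r => r) R, cfc_id' ℝ R]
  have hNR : cfc (fun r : ℝ => N * r) R = N • R := by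
    rw [cfc_const_mul N (fun r => r) R, cfc_id' ℝ R]
  refine ⟨cfc_nonneg fun r hr => ?_, ?_, cfc (fun r : ℝ => (1 + (N - 1) * r)⁻¹) R,
    cfc_predicate _ _, ?_, ?_, ?_, ?_⟩
  · have h1 := hden r hr
    have h2 := (hsp hr).1
    rw [rescaled]; positivity
  · refine cfc_le_one _ _ (fun r hr => ?_)
    rw [rescaled, div_le_one (hden r hr)]
    have := (hsp hr).2
    linarith
  · rw [hPc, ← cfc_mul _ _ R hcY (by fun_prop), ← cfc_const_one ℝ R]
    exact cfc_congr fun r hr => inv_mul_cancel₀ (hden r hr).ne'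
  · rw [hPc, ← cfc_mul _ _ R (by fun_prop) hcY, ← cfc_const_one ℝ R]
    exact cfc_congr fun r hr => mul_inv_cancel₀ (hden r hr).ne'
  · have : rescaled N = fun r => (N * r) * (1 + (N - 1) * r)⁻¹ := by
      ext r; rw [rescaled, div_eq_mul_inv]
    rw [this, cfc_mul _ _ R hcR hcY, hNR, smul_mul_assoc]
  · have : rescaled N = fun r => (1 + (N - 1) * r)⁻¹ * (N * r) := by
      ext r; rw [rescaled, div_eq_mul_inv, mul_comm]
    rw [this, cfc_mul _ _ R hcY hcR, hNR, mul_smul_comm]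

/-- The form inequality `B ≤ (H + N) / N` reads `R_N B R_N ≤ R_N`. -/
theorem conj_rescaled_resolvent_le (hZ : 0 ≤ Z) (hZ1 : Z ≤ 1) (hV : 0 ≤ V)
    (hR : R = Z - Z * V * R) {N : ℝ} (hN : 1 ≤ N) {B S : H →L[ℂ] H} (hS : IsSelfAdjoint S)
    (hSB : S = N • B - (N - 1) • 1) (hSZ : Z * S * Z ≤ Z) :
    cfc (rescaled N) R * B * cfc (rescaled N) R ≤ cfc (rescaled N) R := by
  obtain ⟨h0, h1, Y, hYsa, hYP, hPY, e1, e2⟩ := exists_rescaled_factor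
    (resolvent_nonneg hZ hV hR) (resolvent_le_one hZ hZ1 hV hR) hN
  set RN := cfc (rescaled N) R
  have h2 := conj_resolvent_le hS hZ hV hR hSZ
  have h3 : R * (N • B) * R ≤ R * (1 + (N - 1) • R) := by
    have : R * S * R = R * (N • B) * R - (N - 1) • (R * R) := by
      rw [hSB]
      simp only [mul_sub, sub_mul, mul_smul_comm, smul_mul_assoc, mul_one]
    rw [this, sub_le_iff_le_add] at h2
    have h3 : R * (1 + (N - 1) • R) = R + (N - 1) • (R * R) := by
      rw [mul_add, mul_one, mul_smul_comm]
    rw [h3]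
    exact h2
  have h4 := hYsa.conjugate_le_conjugate h3
  have h5 : Y * (R * (1 + (N - 1) • R)) * Y = Y * R := by
    rw [mul_assoc Y, mul_assoc R, hPY, mul_one]
  rw [h5] at h4
  have h6 : N • (Y * (R * (N • B) * R) * Y) ≤ N • (Y * R) :=
    smul_le_smul_of_nonneg_left h4 (zero_le_one.trans hN)
  have h7 : RN * B * RN = N • (Y * (R * (N • B) * R) * Y) := by
    nth_rw 1 [e2]; rw [e1]
    simp only [mul_smul_comm, smul_mul_assoc, mul_assoc]
  rw [h7, e2]
  exact h6

/-- Commutators with the rescaled resolvent gain a factor `1 / N`. -/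
theorem norm_commutator_rescaled_le (hZ : 0 ≤ Z) (hZ1 : Z ≤ 1) (hV : 0 ≤ V)
    (hR : R = Z - Z * V * R) {N : ℝ} (hN : 1 ≤ N) {B : H →L[ℂ] H} (hBZ : B * Z = Z * B) :
    ‖cfc (rescaled N) R * B - B * cfc (rescaled N) R‖ ≤ N⁻¹ * ‖B * V - V * B‖ := by
  obtain ⟨h0, h1, Y, hYsa, hYP, hPY, e1, e2⟩ := exists_rescaled_factor
    (resolvent_nonneg hZ hV hR) (resolvent_le_one hZ hZ1 hV hR) hN
  set RN := cfc (rescaled N) R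
  have c := commutator_resolvent hZ hV hR hBZ
  have a1 : RN * B - B * RN =
      N • (Y * (R * B * (1 + (N - 1) • R) - (1 + (N - 1) • R) * B * R) * Y) := by
    nth_rw 1 [e2]; rw [e1]
    have b1 : ∀ P : H →L[ℂ] H, Y * (R * B * P - P * B * R) * Y =
        Y * R * B * (P * Y) - (Y * P) * B * (R * Y) := fun P => by noncomm_ring
    rw [b1, hPY, hYP, mul_one, one_mul, smul_sub, smul_mul_assoc, mul_smul_comm]
  have a2 : R * B * (1 + (N - 1) • R) - (1 + (N - 1) • R) * B * R = R * B - B * R := by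
    simp only [mul_add, add_mul, mul_one, one_mul, mul_smul_comm, smul_mul_assoc, mul_assoc]
    abel
  have a3 : RN * (B * V - V * B) * RN = N • N • (Y * (R * (B * V - V * B) * R) * Y) := by
    nth_rw 1 [e2]; rw [e1]
    simp only [mul_smul_comm, smul_mul_assoc, mul_assoc]
  have hN0 : 0 < N := by linarith
  have h2 : RN * B - B * RN = N⁻¹ • (RN * (B * V - V * B) * RN) := by
    rw [a1, a2, c, a3, inv_smul_smul₀ hN0.ne']
  have hRNn : ‖RN‖ ≤ 1 := (CStarAlgebra.norm_le_one_iff_of_nonneg RN h0).2 h1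
  rw [h2, norm_smul, Real.norm_eq_abs, abs_of_pos (by positivity)]
  gcongr
  calc ‖RN * (B * V - V * B) * RN‖ ≤ ‖RN‖ * ‖B * V - V * B‖ * ‖RN‖ :=
        (norm_mul_le _ _).trans (by gcongr; exact norm_mul_le _ _)
    _ ≤ 1 * ‖B * V - V * B‖ * 1 := by gcongr
    _ = _ := by ring

end Resolvent

/-! ### The interaction energy -/

section Geometry

variable {ι κ : Type} {d : ℕ}

@[simp] theorem Conf.pos_apply (x : Conf ι d) (i : ι) (a : Fin d) : x.pos i a = x (i, a) := rfl

@[simp] theorem Conf.mk_apply (q : ι → EuclideanSpace ℝ (Fin d)) (i : ι) (a : Fin d) :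
    Conf.mk q (i, a) = q i a := rfl

@[simp] theorem Conf.pos_mk (q : ι → EuclideanSpace ℝ (Fin d)) (i : ι) : (Conf.mk q).pos i = q i :=
  rfl

/-- Renaming the particles along a bijection: `(reindex e x) i = x (e i)`. -/
def reindex (d : ℕ) [Fintype ι] [Fintype κ] (e : κ ≃ ι) : Conf ι d ≃ₗᵢ[ℝ] Conf κ d :=
  LinearIsometryEquiv.piLpCongrLeft 2 ℝ ℝ (e.symm.prodCongr (Equiv.refl (Fin d)))

theorem reindex_apply [Fintype ι] [Fintype κ] (e : κ ≃ ι) (x : Conf ι d) :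
    reindex d e x = Conf.mk fun i => x.pos (e i) := by
  ext ⟨i, a⟩; rfl

/-- The rescaled positions `c x_{i(0)}, …, c x_{i(n-1)}` of selected particles. -/
def select (d : ℕ) (c : ℝ) (i : κ → ι) : Conf ι d →ₗ[ℝ] Conf κ d where
  toFun x := Conf.mk fun l => c • x.pos (i l)
  map_add' x y := by ext ⟨l, a⟩; simp [mul_add]
  map_smul' r x := by ext ⟨l, a⟩; simp; ring

theorem select_apply (c : ℝ) (i : κ → ι) (x : Conf ι d) :
    select d c i x = Conf.mk fun l => c • x.pos (i l) := rfl

theorem select_surjective {c : ℝ} (hc : c ≠ 0) {i : κ → ι} (hi : Function.Injective i) :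
    Function.Surjective (select d c i) := by
  classical
  intro y
  refine ⟨Conf.mk fun j => if h : ∃ l, i l = j then c⁻¹ • y.pos h.choose else 0, ?_⟩
  ext ⟨l, a⟩
  have h : ∃ l', i l' = i l := ⟨l, rfl⟩
  have e : h.choose = l := hi h.choose_spec
  simp [select_apply, e, mul_inv_cancel_left₀ hc]

/-- The relative positions `(x₀ - x₁, …, x₀ - x_p)`. -/
def relative (p d : ℕ) : Conf (Fin (p + 1)) d →ₗ[ℝ] Conf (Fin p) d where
  toFun x := Conf.mk fun l => x.pos 0 - x.pos l.succ
  map_add' x y := by ext ⟨l, a⟩; simp; ring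
  map_smul' r x := by ext ⟨l, a⟩; simp; ring

theorem relative_surjective (p d : ℕ) : Function.Surjective (relative p d) := by
  intro y
  refine ⟨Conf.mk (Fin.cons 0 fun l => -y.pos l), ?_⟩
  ext ⟨l, a⟩
  simp [relative]

/-- Null sets pull back to null sets along surjective linear maps, so that statements that hold
almost everywhere in the relative positions hold almost everywhere in the configuration. -/
theorem quasiMeasurePreserving_of_surjective {E F : Type} [NormedAddCommGroup E]
    [InnerProductSpace ℝ E] [FiniteDimensional ℝ E] [MeasurableSpace E] [BorelSpace E]
    [NormedAddCommGroup F] [InnerProductSpace ℝ F] [FiniteDimensional ℝ F] [MeasurableSpace F]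
    [BorelSpace F] {L : E →ₗ[ℝ] F} (h : Function.Surjective L) :
    Measure.QuasiMeasurePreserving L (volume : Measure E) (volume : Measure F) := by
  refine ⟨L.continuous_of_finiteDimensional.measurable, ?_⟩
  obtain ⟨c, -, hc⟩ := L.exists_map_addHaar_eq_smul_addHaar (volume : Measure E)
    (volume : Measure F) h
  rw [hc]
  exact Measure.smul_absolutelyContinuous

end Geometry

section Interaction

variable {d : ℕ}

/-- An essential bound for a bounded potential. -/
def essBound {p : ℕ} (V : Conf (Fin p) d → ℝ) : ℝ := (eLpNormEssSup V volume).toReal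

theorem essBound_nonneg {p : ℕ} (V : Conf (Fin p) d → ℝ) : 0 ≤ essBound V := ENNReal.toReal_nonneg

theorem ae_abs_le_essBound {p : ℕ} {V : Conf (Fin p) d → ℝ} (hV : MemLp V ∞ volume) :
    ∀ᵐ y, |V y| ≤ essBound V := by
  have h := hV.2
  rw [eLpNorm_exponent_top] at h
  filter_upwards [ae_le_eLpNormEssSup (f := V) (μ := volume)] with y hy
  rw [← Real.norm_eq_abs, ← toReal_enorm]
  exact ENNReal.toReal_mono h.ne hy

/-- The contribution of the particles `i₀, …, i_p` to the `(p+1)`-body interaction. -/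
def tupleInteraction {p N : ℕ} (V : Conf (Fin p) d → ℝ) (c : ℝ) (i : Fin (p + 1) → Fin N)
    (x : Conf (Fin N) d) : ℝ := bodyInteraction V (select d c i x)

theorem tupleInteraction_eq {p N : ℕ} (V : Conf (Fin p) d → ℝ) (c : ℝ) (i : Fin (p + 1) → Fin N)
    (x : Conf (Fin N) d) :
    tupleInteraction V c i x = V (Conf.mk fun l : Fin p => c • (x.pos (i 0) - x.pos (i l.succ))) := by
  unfold tupleInteraction bodyInteraction
  congr 1
  ext ⟨l, a⟩
  simp [select_apply, mul_sub]

theorem quasiMeasurePreserving_tuple {p N : ℕ} {c : ℝ} (hc : c ≠ 0) {i : Fin (p + 1) → Fin N}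
    (hi : Function.Injective i) :
    Measure.QuasiMeasurePreserving (fun x : Conf (Fin N) d => relative p d (select d c i x))
      volume volume :=
  (quasiMeasurePreserving_of_surjective (relative_surjective p d)).comp
    (quasiMeasurePreserving_of_surjective (select_surjective hc hi))

section Tuple

variable {p N : ℕ} {V : Conf (Fin p) d → ℝ} (hV : IsAdmissiblePotential V) {c : ℝ} (hc : c ≠ 0)
  {i : Fin (p + 1) → Fin N} (hi : Function.Injective i)
include hV hc hi

theorem tupleInteraction_bound : ∀ᵐ x, |tupleInteraction V c i x| ≤ essBound V :=
  (quasiMeasurePreserving_tuple hc hi).ae (ae_abs_le_essBound hV.sobolev.1)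

theorem tupleInteraction_nonneg : ∀ᵐ x, 0 ≤ tupleInteraction V c i x :=
  (quasiMeasurePreserving_tuple hc hi).ae hV.nonneg

theorem tupleInteraction_aestronglyMeasurable :
    AEStronglyMeasurable (tupleInteraction V c i) volume :=
  hV.sobolev.1.1.comp_quasiMeasurePreserving (quasiMeasurePreserving_tuple hc hi)

/-- The interaction of a tuple does not depend on the order of its particles. -/
theorem tupleInteraction_perm (τ : Equiv.Perm (Fin (p + 1))) :
    ∀ᵐ x, tupleInteraction V c (i ∘ τ) x = tupleInteraction V c i x :=
  (quasiMeasurePreserving_of_surjective (select_surjective hc hi)).ae (hV.symmetric τ)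

end Tuple

/-- Strictly increasing tuples of particle labels. -/
def tuples (p N : ℕ) : Finset (Fin (p + 1) → Fin N) := by
  classical exact Finset.univ.filter StrictMono

theorem mem_tuples {p N : ℕ} {i : Fin (p + 1) → Fin N} : i ∈ tuples p N ↔ StrictMono i := by
  simp [tuples]

theorem interaction_eq (p₀ : ℕ) (V : ∀ p : ℕ, Conf (Fin p) d → ℝ) (β : ℝ) (N : ℕ)
    (x : Conf (Fin N) d) :
    interaction d p₀ V β N x = ∑ p ∈ Finset.Icc 1 p₀, ((N : ℝ) ^ p)⁻¹ * ∑ i ∈ tuples p N,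
      (N : ℝ) ^ ((p : ℝ) * d * β) * tupleInteraction (V p) ((N : ℝ) ^ β) i x := by
  unfold interaction tuples
  simp only [tupleInteraction_eq]

/-- Sorting the tuples after a permutation of the particles is a bijection of the increasing
tuples. -/
theorem sum_tuples_perm {p N : ℕ} (σ : Equiv.Perm (Fin N)) (F : (Fin (p + 1) → Fin N) → ℝ)
    (hF : ∀ i ∈ tuples p N, ∀ τ : Equiv.Perm (Fin (p + 1)), F (i ∘ τ) = F i) :
    ∑ i ∈ tuples p N, F (σ ∘ i) = ∑ i ∈ tuples p N, F i := by
  have hmono : ∀ (σ : Equiv.Perm (Fin N)) (i : Fin (p + 1) → Fin N), i ∈ tuples p N →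
      (σ ∘ i) ∘ Tuple.sort (σ ∘ i) ∈ tuples p N := by
    intro σ i hi
    rw [mem_tuples] at hi ⊢
    exact (Tuple.monotone_sort _).strictMono_of_injective
      ((σ.injective.comp hi.injective).comp (Equiv.injective _))
  have hinv : ∀ (σ : Equiv.Perm (Fin N)) (i : Fin (p + 1) → Fin N), i ∈ tuples p N →
      (σ.symm ∘ ((σ ∘ i) ∘ Tuple.sort (σ ∘ i))) ∘
        Tuple.sort (σ.symm ∘ ((σ ∘ i) ∘ Tuple.sort (σ ∘ i))) = i := by
    intro σ i hi
    have e : σ.symm ∘ ((σ ∘ i) ∘ Tuple.sort (σ ∘ i)) = i ∘ Tuple.sort (σ ∘ i) := by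
      ext l; simp
    rw [e, Tuple.comp_perm_comp_sort_eq_comp_sort,
      (Tuple.sort_eq_refl_iff_monotone (f := i)).2 (mem_tuples.1 hi).monotone]
    rfl
  refine Finset.sum_nbij' (fun i => (σ ∘ i) ∘ Tuple.sort (σ ∘ i))
    (fun i => (σ.symm ∘ i) ∘ Tuple.sort (σ.symm ∘ i)) (hmono σ) (hmono σ.symm)
    (hinv σ) (fun i hi => by simpa using hinv σ.symm i hi) fun i hi => ?_
  rw [← hF _ (hmono σ i hi) (Tuple.sort (σ ∘ i))⁻¹]
  congr 1
  ext l; simp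

section Sum

variable {p₀ : ℕ} {V : ∀ p : ℕ, Conf (Fin p) d → ℝ}
  (hV : ∀ p, 1 ≤ p → p ≤ p₀ → IsAdmissiblePotential (V p)) {β : ℝ} {N : ℕ} (hN : 1 ≤ N)
include hV hN

theorem interaction_nonneg : ∀ᵐ x, 0 ≤ interaction d p₀ V β N x := by
  have hN0 : (0 : ℝ) < N := by exact_mod_cast hN
  have h : ∀ p ∈ Finset.Icc 1 p₀, ∀ i ∈ tuples p N, ∀ᵐ x : Conf (Fin N) d,
      0 ≤ tupleInteraction (V p) ((N : ℝ) ^ β) i x := fun p hp i hi =>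
    tupleInteraction_nonneg (hV p (Finset.mem_Icc.1 hp).1 (Finset.mem_Icc.1 hp).2)
      (by positivity) (mem_tuples.1 hi).injective
  have h' : ∀ᵐ x : Conf (Fin N) d, ∀ p ∈ Finset.Icc 1 p₀, ∀ i ∈ tuples p N,
      0 ≤ tupleInteraction (V p) ((N : ℝ) ^ β) i x := by
    rw [Filter.eventually_all_finset]
    intro p hp
    rw [Filter.eventually_all_finset]
    exact h p hp
  filter_upwards [h'] with x hx
  rw [interaction_eq]
  refine Finset.sum_nonneg fun p hp => mul_nonneg (by positivity) (Finset.sum_nonneg fun i hi => ?_)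
  exact mul_nonneg (by positivity) (hx p hp i hi)

theorem interaction_memLp : MemLp (fun x => (interaction d p₀ V β N x : ℂ)) ∞ volume := by
  have hN0 : (0 : ℝ) < N := by exact_mod_cast hN
  have hmem : MemLp (interaction d p₀ V β N) ∞ volume := by
    have : interaction d p₀ V β N = fun x => ∑ p ∈ Finset.Icc 1 p₀, ((N : ℝ) ^ p)⁻¹ *
        ∑ i ∈ tuples p N, (N : ℝ) ^ ((p : ℝ) * d * β) *
          tupleInteraction (V p) ((N : ℝ) ^ β) i x := by
      ext x; rw [interaction_eq]
    have h1 : ∀ p ∈ Finset.Icc 1 p₀, ∀ i ∈ tuples p N, MemLp (fun x : Conf (Fin N) d =>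
        (N : ℝ) ^ ((p : ℝ) * d * β) * tupleInteraction (V p) ((N : ℝ) ^ β) i x) ∞ volume := by
      intro p hp i hi
      have hVp := hV p (Finset.mem_Icc.1 hp).1 (Finset.mem_Icc.1 hp).2
      have hc : (N : ℝ) ^ β ≠ 0 := by positivity
      have h2 : MemLp (tupleInteraction (V p) ((N : ℝ) ^ β) i) ∞ volume :=
        memLp_top_of_bound (tupleInteraction_aestronglyMeasurable hVp hc
          (mem_tuples.1 hi).injective) (essBound (V p)) (tupleInteraction_bound hVp hc
          (mem_tuples.1 hi).injective)
      exact h2.const_mul _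
    have h2 : ∀ p ∈ Finset.Icc 1 p₀, MemLp (fun x : Conf (Fin N) d => ((N : ℝ) ^ p)⁻¹ *
        ∑ i ∈ tuples p N, (N : ℝ) ^ ((p : ℝ) * d * β) *
          tupleInteraction (V p) ((N : ℝ) ^ β) i x) ∞ volume := fun p hp =>
      (memLp_finsetSum _ (h1 p hp)).const_mul _
    rw [this]
    exact memLp_finsetSum _ h2
  exact hmem.ofReal

/-- The interaction energy is invariant under permutations of the particles. -/
theorem interaction_perm (σ : Equiv.Perm (Fin N)) : ∀ᵐ x : Conf (Fin N) d,
    interaction d p₀ V β N (Conf.mk fun l => x.pos (σ l)) = interaction d p₀ V β N x := by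
  have hN0 : (0 : ℝ) < N := by exact_mod_cast hN
  have h' : ∀ᵐ x : Conf (Fin N) d, ∀ p ∈ Finset.Icc 1 p₀, ∀ i ∈ tuples p N,
      ∀ τ : Equiv.Perm (Fin (p + 1)), tupleInteraction (V p) ((N : ℝ) ^ β) (i ∘ τ) x =
        tupleInteraction (V p) ((N : ℝ) ^ β) i x := by
    rw [Filter.eventually_all_finset]
    intro p hp
    rw [Filter.eventually_all_finset]
    intro i hi
    rw [Filter.eventually_all]
    exact fun τ => tupleInteraction_perm (hV p (Finset.mem_Icc.1 hp).1 (Finset.mem_Icc.1 hp).2)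
      (by positivity) (mem_tuples.1 hi).injective τ
  filter_upwards [h'] with x hx
  rw [interaction_eq, interaction_eq]
  refine Finset.sum_congr rfl fun p hp => ?_
  congr 1
  have := sum_tuples_perm σ (fun i => (N : ℝ) ^ ((p : ℝ) * d * β) *
    tupleInteraction (V p) ((N : ℝ) ^ β) i x) fun i hi τ => by
      rw [hx p hp i hi τ]
  rw [← this]
  rfl

end Sum

/-- A tuple through `l` is determined by the position of `l` in it and its other entries. -/
theorem card_tuples_through_le {p N : ℕ} (l : Fin N) :
    ((tuples p N).filter fun i => ∃ a, i a = l).card ≤ (p + 1) * N ^ p := by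
  classical
  have h1 : ((tuples p N).filter fun i => ∃ a, i a = l) ⊆ Finset.univ.biUnion fun a : Fin (p + 1) =>
      Fintype.piFinset fun b => if b = a then {l} else (Finset.univ : Finset (Fin N)) := by
    intro i hi
    obtain ⟨a, ha⟩ := (Finset.mem_filter.1 hi).2
    simp only [Finset.mem_biUnion, Finset.mem_univ, true_and, Fintype.mem_piFinset]
    refine ⟨a, fun b => ?_⟩
    split_ifs with hb
    · simp [hb, ha]
    · simp
  refine (Finset.card_le_card h1).trans (Finset.card_biUnion_le.trans ?_)
  have h2 : ∀ a : Fin (p + 1), (Fintype.piFinset fun b => if b = a then {l} else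
      (Finset.univ : Finset (Fin N))).card = N ^ p := by
    intro a
    rw [Fintype.card_piFinset, Fin.prod_univ_succAbove _ a]
    simp [Fin.succAbove_ne]
  simp [h2]

/-- Moving one particle changes the interaction energy by `O(N^{p₀dβ})` only, since at most
`(p+1) N^p` tuples contain that particle. -/
theorem interaction_shift_le {p₀ : ℕ} {V : ∀ p : ℕ, Conf (Fin p) d → ℝ}
    (hV : ∀ p, 1 ≤ p → p ≤ p₀ → IsAdmissiblePotential (V p)) {β : ℝ} (hβ : 0 ≤ β) {N : ℕ}
    (hN : 1 ≤ N) (l : Fin N) (v : Conf (Fin N) d) (hv : ∀ j, j ≠ l → v.pos j = 0) :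
    ∀ᵐ x, |interaction d p₀ V β N (x + v) - interaction d p₀ V β N x| ≤
      (∑ p ∈ Finset.Icc 1 p₀, 2 * (p + 1) * essBound (V p)) * (N : ℝ) ^ ((p₀ : ℝ) * d * β) := by
  have hN1 : (1 : ℝ) ≤ N := by exact_mod_cast hN
  have hN0 : (0 : ℝ) < N := by linarith
  have h' : ∀ᵐ x : Conf (Fin N) d, ∀ p ∈ Finset.Icc 1 p₀, ∀ i ∈ tuples p N,
      |tupleInteraction (V p) ((N : ℝ) ^ β) i x| ≤ essBound (V p) := by
    rw [Filter.eventually_all_finset]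
    intro p hp
    rw [Filter.eventually_all_finset]
    exact fun i hi => tupleInteraction_bound (hV p (Finset.mem_Icc.1 hp).1 (Finset.mem_Icc.1 hp).2)
      (by positivity) (mem_tuples.1 hi).injective
  filter_upwards [h', (measurePreserving_add_right volume v).quasiMeasurePreserving.ae h']
    with x hx hxv
  rw [interaction_eq, interaction_eq, ← Finset.sum_sub_distrib, Finset.sum_mul]
  refine (Finset.abs_sum_le_sum_abs _ _).trans (Finset.sum_le_sum fun p hp => ?_)
  rw [← mul_sub, ← Finset.sum_sub_distrib, abs_mul, abs_of_pos (by positivity)]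
  have hM := essBound_nonneg (V p)
  -- only the tuples through `l` contribute
  have hfilter : ∑ i ∈ tuples p N, ((N : ℝ) ^ ((p : ℝ) * d * β) *
        tupleInteraction (V p) ((N : ℝ) ^ β) i (x + v) - (N : ℝ) ^ ((p : ℝ) * d * β) *
        tupleInteraction (V p) ((N : ℝ) ^ β) i x) =
      ∑ i ∈ (tuples p N).filter (fun i => ∃ a, i a = l), ((N : ℝ) ^ ((p : ℝ) * d * β) *
        tupleInteraction (V p) ((N : ℝ) ^ β) i (x + v) - (N : ℝ) ^ ((p : ℝ) * d * β) *
        tupleInteraction (V p) ((N : ℝ) ^ β) i x) := by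
    symm
    apply Finset.sum_filter_of_ne
    intro i hi hne
    by_contra hno
    push Not at hno
    apply hne
    have : select d ((N : ℝ) ^ β) i (x + v) = select d ((N : ℝ) ^ β) i x := by
      rw [map_add, add_eq_left]
      ext ⟨a, b⟩
      have := congrArg (fun w : EuclideanSpace ℝ (Fin d) => w b) (hv (i a) (hno a))
      simp only [Conf.pos_apply] at this
      simp [select_apply, this]
    rw [tupleInteraction, tupleInteraction, this, sub_self]
  rw [hfilter]
  have hterm : ∀ i ∈ (tuples p N).filter (fun i => ∃ a, i a = l), |(N : ℝ) ^ ((p : ℝ) * d * β) *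
        tupleInteraction (V p) ((N : ℝ) ^ β) i (x + v) - (N : ℝ) ^ ((p : ℝ) * d * β) *
        tupleInteraction (V p) ((N : ℝ) ^ β) i x| ≤
        (N : ℝ) ^ ((p₀ : ℝ) * d * β) * (2 * essBound (V p)) := by
    intro i hi
    have hi' := (Finset.mem_filter.1 hi).1
    rw [← mul_sub, abs_mul, abs_of_pos (by positivity)]
    have hexp : (p : ℝ) * d * β ≤ (p₀ : ℝ) * d * β := by
      have : (p : ℝ) ≤ p₀ := by exact_mod_cast (Finset.mem_Icc.1 hp).2
      gcongr
    have := abs_sub (tupleInteraction (V p) ((N : ℝ) ^ β) i (x + v))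
      (tupleInteraction (V p) ((N : ℝ) ^ β) i x)
    have := hx p hp i hi'
    have := hxv p hp i hi'
    gcongr
    linarith
  have hcard : (((tuples p N).filter fun i => ∃ a, i a = l).card : ℝ) ≤ (p + 1) * N ^ p := by
    exact_mod_cast card_tuples_through_le l
  calc _ ≤ ((N : ℝ) ^ p)⁻¹ * (((tuples p N).filter fun i => ∃ a, i a = l).card *
          ((N : ℝ) ^ ((p₀ : ℝ) * d * β) * (2 * essBound (V p)))) := by
        gcongr
        refine (Finset.abs_sum_le_sum_abs _ _).trans ((Finset.sum_le_sum hterm).trans ?_)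
        rw [Finset.sum_const, nsmul_eq_mul]
    _ ≤ ((N : ℝ) ^ p)⁻¹ * (((p + 1) * N ^ p) *
          ((N : ℝ) ^ ((p₀ : ℝ) * d * β) * (2 * essBound (V p)))) := by gcongr
    _ = _ := by field_simp

end Interaction

/-! ### The resolvent of the Hamiltonian -/

section Symbols

variable {E : Type} [NormedAddCommGroup E] [InnerProductSpace ℝ E] [FiniteDimensional ℝ E]
  [MeasurableSpace E] [BorelSpace E]

theorem mult_isSelfAdjoint {m : E → ℝ} (hm : IsSymbol (fun x => (m x : ℂ))) :
    IsSelfAdjoint (mult (fun x => (m x : ℂ))) := by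
  rw [ContinuousLinearMap.isSelfAdjoint_iff_isSymmetric]
  exact fun x y => inner_mult_real_left hm x y

theorem mult_mono {m m' : E → ℝ} (hm : IsSymbol (fun x => (m x : ℂ)))
    (hm' : IsSymbol (fun x => (m' x : ℂ))) (h : ∀ x, m x ≤ m' x) :
    mult (fun x => (m x : ℂ)) ≤ mult (fun x => (m' x : ℂ)) := by
  refine le_of_re_inner_le (mult_isSelfAdjoint hm) (mult_isSelfAdjoint hm') fun f => ?_
  rw [inner_mult_real_left hm, inner_mult_real_left hm']
  exact inner_mult_self_mono hm hm' h f

theorem mult_nonneg {m : E → ℝ} (hm : IsSymbol (fun x => (m x : ℂ))) (h : ∀ x, 0 ≤ m x) :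
    0 ≤ mult (fun x => (m x : ℂ)) := by
  have := mult_mono (m := fun _ => 0) (by simpa using IsSymbol.const (E := E) 0) hm h
  simpa [mult_const] using this

theorem norm_mult_le {m : E → ℂ} {C : ℝ} (hC : 0 ≤ C) (h : ∀ x, ‖m x‖ ≤ C) : ‖mult m‖ ≤ C := by
  refine ContinuousLinearMap.opNorm_le_bound _ hC fun f => ?_
  rw [← Lp.norm_fourier_eq, fourier_mult, ← Lp.norm_fourier_eq f]
  exact (ContinuousLinearMap.le_opNorm _ _).trans
    (mul_le_mul_of_nonneg_right (norm_mulOp_le hC (ae_of_all _ h)) (norm_nonneg _))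

theorem mulOp_nonneg {X : Type} [MeasurableSpace X] {μ : Measure X} {m : X → ℝ}
    (hm : MemLp (fun x => (m x : ℂ)) ∞ μ) (h : ∀ᵐ x ∂μ, 0 ≤ m x) :
    0 ≤ mulOp μ (fun x => (m x : ℂ)) := by
  rw [opNonneg_iff]
  intro f
  rw [inner_mulOp_real_left hm, inner_mulOp_self hm]
  refine ⟨by simp, ?_⟩
  rw [Complex.ofReal_re]
  exact integral_nonneg_of_ae (by filter_upwards [h] with x hx using mul_nonneg hx (by positivity))

/-- The symbol `1 / (1 + |2πξ|²)` of `(1 - Δ)⁻¹`. -/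
def zSym (ξ : E) : ℝ := (1 + (2 * Real.pi * ‖ξ‖) ^ 2)⁻¹

theorem zSym_pos (ξ : E) : 0 < zSym ξ := by unfold zSym; positivity

theorem zSym_le_one (ξ : E) : zSym ξ ≤ 1 := by
  unfold zSym
  exact inv_le_one_of_one_le₀ (by nlinarith [sq_nonneg (2 * Real.pi * ‖ξ‖)])

theorem continuous_zSym : Continuous (zSym : E → ℝ) := by
  unfold zSym
  exact Continuous.inv₀ (by fun_prop) fun ξ => by positivity

theorem isSymbol_ofReal {m : E → ℝ} (hm : Continuous m) {C : ℝ} (h : ∀ x, |m x| ≤ C) :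
    IsSymbol (fun x => (m x : ℂ)) :=
  ⟨Complex.continuous_ofReal.comp hm, C, fun x => by
    rw [Complex.norm_real, Real.norm_eq_abs]; exact h x⟩

theorem isSymbol_zSym : IsSymbol (fun ξ : E => (zSym ξ : ℂ)) :=
  isSymbol_ofReal continuous_zSym fun x => by rw [abs_of_pos (zSym_pos x)]; exact zSym_le_one x

/-- The operator `(1 - Δ)^{-1/2}`. -/
theorem exists_sqrt_zSym : ∃ Q : Lp ℂ 2 (volume : Measure E) →L[ℂ] _, IsSelfAdjoint Q ∧
    Q * Q = mult (fun ξ : E => (zSym ξ : ℂ)) := by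
  have h : IsSymbol (fun ξ : E => ((√(zSym ξ) : ℝ) : ℂ)) :=
    isSymbol_ofReal (continuous_zSym.sqrt) (C := 1) fun x => by
      rw [abs_of_nonneg (Real.sqrt_nonneg _)]
      exact Real.sqrt_le_one.2 (zSym_le_one x)
  refine ⟨_, mult_isSelfAdjoint h, ?_⟩
  rw [← mult_mul h h]
  congr 1
  ext ξ
  rw [Pi.mul_apply, ← Complex.ofReal_mul, Real.mul_self_sqrt (zSym_pos ξ).le]

end Symbols

section Hamiltonian

variable {d p₀ : ℕ} {V : ∀ p : ℕ, Conf (Fin p) d → ℝ} {β : ℝ} {N : ℕ}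

/-- The interaction as a multiplication operator. -/
def potentialOp (d p₀ : ℕ) (V : ∀ p : ℕ, Conf (Fin p) d → ℝ) (β : ℝ) (N : ℕ) : Op (Fin N) d :=
  mulOp volume fun x => (interaction d p₀ V β N x : ℂ)

/-- The equation `(H_N + 1) u = f` in the sense of distributions, solved for the free part:
`u = (1 - Δ)⁻¹ (f - V u)`. -/
theorem mem_hamiltonianGraph_iff
    (hm : MemLp (fun x => (interaction d p₀ V β N x : ℂ)) ∞ volume) (u f : L2 (Fin N) d) :
    (u, f - u) ∈ hamiltonianGraph d p₀ V β N ↔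
      u = mult (fun ξ => (zSym ξ : ℂ)) (f - potentialOp d p₀ V β N u) := by
  have h1 : (u, f - u) ∈ hamiltonianGraph d p₀ V β N ↔
      ((f - u - potentialOp d p₀ V β N u : L2 (Fin N) d) : 𝓢'(Conf (Fin N) d, ℂ)) =
        -Δ (u : 𝓢'(Conf (Fin N) d, ℂ)) := by
    have e : ∀ a b : L2 (Fin N) d, ((a - b : L2 (Fin N) d) : 𝓢'(Conf (Fin N) d, ℂ)) =
        (a : 𝓢'(Conf (Fin N) d, ℂ)) - (b : 𝓢'(Conf (Fin N) d, ℂ)) := fun a b =>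
      map_sub (Lp.toTemperedDistributionCLM (E := Conf (Fin N) d) ℂ volume 2) a b
    constructor
    · rintro ⟨w, hw, h⟩
      have hw' : w = potentialOp d p₀ V β N u := by
        apply Lp.ext
        filter_upwards [hw, coeFn_mulOp hm u] with x h1 h2
        rw [h1, potentialOp, h2]
      rw [← hw', e (f - u) w]
      exact sub_eq_of_eq_add h
    · intro h
      refine ⟨potentialOp d p₀ V β N u, coeFn_mulOp hm u, ?_⟩
      rw [e (f - u)] at h
      exact eq_add_of_sub_eq h
  rw [h1, fourier_laplacian_iff, eq_comm, mult_eq_iff]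
  have e2 : (𝓕 (f - u - potentialOp d p₀ V β N u) : L2 (Fin N) d) =
      𝓕 (f - potentialOp d p₀ V β N u) - 𝓕 u := by
    have := map_sub (Lp.fourierTransformₗᵢ (Conf (Fin N) d) ℂ)
      (f - potentialOp d p₀ V β N u) u
    refine Eq.trans ?_ this
    rw [sub_right_comm]
    rfl
  rw [e2]
  set g := (𝓕 (f - potentialOp d p₀ V β N u) : L2 (Fin N) d)
  set v := (𝓕 u : L2 (Fin N) d)
  have key : ∀ (ξ : Conf (Fin N) d) (a b : ℂ), a - b = (((2 * Real.pi * ‖ξ‖) ^ 2 : ℝ) : ℂ) * b ↔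
      (zSym ξ : ℂ) * a = b := by
    intro ξ a b
    have hne : ((1 + (2 * Real.pi * ‖ξ‖) ^ 2 : ℝ) : ℂ) ≠ 0 := by
      rw [Complex.ofReal_ne_zero]; positivity
    rw [zSym, Complex.ofReal_inv, inv_mul_eq_iff_eq_mul₀ hne, sub_eq_iff_eq_add]
    push_cast
    constructor <;> intro h <;> rw [h] <;> ring
  constructor
  · intro h
    apply Lp.ext
    filter_upwards [h, coeFn_mulOp isSymbol_zSym.memLp g, Lp.coeFn_sub g v] with ξ h1 h2 h3
    rw [h2, ← key, ← h1, h3]; rfl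
  · intro h
    have h2 := coeFn_mulOp isSymbol_zSym.memLp g
    rw [h] at h2
    filter_upwards [h2, Lp.coeFn_sub g v] with ξ h2 h3
    rw [h3, Pi.sub_apply, key, h2]

variable (hV : ∀ p, 1 ≤ p → p ≤ p₀ → IsAdmissiblePotential (V p)) (hN : 1 ≤ N)
include hV hN

theorem potentialOp_nonneg : 0 ≤ potentialOp d p₀ V β N :=
  mulOp_nonneg (interaction_memLp hV hN) (interaction_nonneg hV hN)

/-- The resolvent `R = (H_N + 1)⁻¹` exists and satisfies `R = Z - Z V R` with `Z = (1 - Δ)⁻¹`. This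
is the only property of `H_N` that the energy bound uses. -/
theorem resolvent_hamiltonian : invAddOne (hamiltonianGraph d p₀ V β N) =
    mult (fun ξ => (zSym ξ : ℂ)) - mult (fun ξ => (zSym ξ : ℂ)) * potentialOp d p₀ V β N *
      invAddOne (hamiltonianGraph d p₀ V β N) := by
  obtain ⟨Q, hQ, hQQ⟩ := exists_sqrt_zSym (E := Conf (Fin N) d)
  have hex : ∃ R : Op (Fin N) d, ∀ f u, R f = u ↔ (u, f - u) ∈ hamiltonianGraph d p₀ V β N := by
    obtain ⟨R, hR⟩ := exists_resolvent hQ (potentialOp_nonneg (β := β) hV hN)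
    refine ⟨R, fun f u => ?_⟩
    rw [hR, mem_hamiltonianGraph_iff (interaction_memLp hV hN), hQQ]
  rw [invAddOne, dif_pos hex]
  ext1 f
  have := (hex.choose_spec f _).1 rfl
  rw [mem_hamiltonianGraph_iff (interaction_memLp hV hN), map_sub] at this
  exact this

/-- The permutation `σ` of the particles, acting on wave functions, commutes with the resolvent. -/
theorem permutation_commute_resolvent (σ : Equiv.Perm (Fin N)) :
    Commute (invAddOne (hamiltonianGraph d p₀ V β N)) (isomComp (reindex d σ)) := by
  have hZ : 0 ≤ mult (fun ξ : Conf (Fin N) d => (zSym ξ : ℂ)) :=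
    mult_nonneg isSymbol_zSym fun ξ => (zSym_pos ξ).le
  have hXZ : isomComp (reindex d σ) * mult (fun ξ : Conf (Fin N) d => (zSym ξ : ℂ)) =
      mult (fun ξ : Conf (Fin N) d => (zSym ξ : ℂ)) * isomComp (reindex d σ) := by
    ext1 f
    rw [mul_apply_eq_comp, isomComp_mult _ isSymbol_zSym]
    simp [zSym]
  have hXV : isomComp (reindex d σ) * potentialOp d p₀ V β N =
      potentialOp d p₀ V β N * isomComp (reindex d σ) := by
    ext1 f
    apply Lp.ext
    have hm := interaction_memLp (β := β) hV hN
    filter_upwards [coeFn_isomComp (reindex d σ) (potentialOp d p₀ V β N f),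
      coeFn_mulOp hm (isomComp (reindex d σ) f), coeFn_isomComp (reindex d σ) f,
      (reindex d σ).measurePreserving.quasiMeasurePreserving.ae (coeFn_mulOp hm f),
      interaction_perm (β := β) hV hN σ] with x h1 h2 h3 h4 h5
    simp only [mul_apply_eq_comp]
    rw [h1, potentialOp, h2, h3, h4, reindex_apply, h5]
  have h := commutator_resolvent hZ (potentialOp_nonneg (β := β) hV hN)
    (resolvent_hamiltonian (β := β) hV hN) hXZ
  rw [hXV, sub_self, mul_zero, zero_mul, sub_eq_zero] at h
  exact h

end Hamiltonian

/-! ### Lattice approximations of `1 - Δ` -/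

section Lattice

variable {ι : Type} [Fintype ι] {d : ℕ}

/-- The symbol `1 + ∑ₐ h⁻² (2 - 2 cos (2πhξ_{i,a}))` of the lattice approximation of `1 - Δ` in the
position of the particle `i`, with lattice constant `h`. -/
def latSym (h : ℝ) (i : ι) (ξ : Conf ι d) : ℝ :=
  1 + ∑ a, (h ^ 2)⁻¹ * (2 - 2 * Real.cos (2 * Real.pi * (h * ξ (i, a))))

theorem continuous_latSym (h : ℝ) (i : ι) : Continuous (latSym h i : Conf ι d → ℝ) := by
  unfold latSym; fun_prop

theorem one_le_latSym (h : ℝ) (i : ι) (ξ : Conf ι d) : 1 ≤ latSym h i ξ := by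
  unfold latSym
  have : 0 ≤ ∑ a : Fin d, (h ^ 2)⁻¹ * (2 - 2 * Real.cos (2 * Real.pi * (h * ξ (i, a)))) :=
    Finset.sum_nonneg fun a _ => mul_nonneg (by positivity)
      (by linarith [Real.cos_le_one (2 * Real.pi * (h * ξ (i, a)))])
  linarith

theorem latSym_le_const (h : ℝ) (i : ι) (ξ : Conf ι d) :
    latSym h i ξ ≤ 1 + d * ((h ^ 2)⁻¹ * 4) := by
  unfold latSym
  gcongr
  refine (Finset.sum_le_card_nsmul _ _ ((h ^ 2)⁻¹ * 4) fun a _ => ?_).trans_eq (by simp)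
  gcongr
  linarith [Real.neg_one_le_cos (2 * Real.pi * (h * ξ (i, a)))]

theorem norm_pos_sq (ξ : Conf ι d) (i : ι) : ‖ξ.pos i‖ ^ 2 = ∑ a, ξ (i, a) ^ 2 := by
  rw [EuclideanSpace.norm_sq_eq]; simp

theorem norm_conf_sq (ξ : Conf ι d) : ‖ξ‖ ^ 2 = ∑ i, ‖ξ.pos i‖ ^ 2 := by
  simp only [EuclideanSpace.norm_sq_eq, Fintype.sum_prod_type]
  simp

/-- The lattice approximation is a lower bound: `2 - 2 cos y ≤ y²`. -/
theorem latSym_le {h : ℝ} (hh : h ≠ 0) (i : ι) (ξ : Conf ι d) :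
    latSym h i ξ ≤ 1 + (2 * Real.pi * ‖ξ.pos i‖) ^ 2 := by
  unfold latSym
  rw [mul_pow, norm_pos_sq, Finset.mul_sum]
  refine add_le_add_right (Finset.sum_le_sum fun a _ => ?_) _
  have := Real.one_sub_sq_div_two_le_cos (x := 2 * Real.pi * (h * ξ (i, a)))
  rw [inv_mul_le_iff₀ (by positivity)]
  nlinarith

theorem tendsto_latSym (i : ι) (ξ : Conf ι d) :
    Tendsto (fun n : ℕ => latSym (1 / ((n : ℝ) + 1)) i ξ) atTop
      (𝓝 (1 + (2 * Real.pi * ‖ξ.pos i‖) ^ 2)) := by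
  unfold latSym
  rw [mul_pow, norm_pos_sq, Finset.mul_sum]
  refine tendsto_const_nhds.add (tendsto_finsetSum _ fun a _ => ?_)
  have hlim : Tendsto (fun h : ℝ => (h ^ 2)⁻¹ * (2 - 2 * Real.cos (2 * Real.pi * (h * ξ (i, a)))))
      (𝓝[≠] 0) (𝓝 ((2 * Real.pi) ^ 2 * ξ (i, a) ^ 2)) := by
    -- `2 - 2 cos y = (2 sin (y / 2))²` and `sin` has derivative `1` at the origin
    have hs : HasDerivAt (fun h : ℝ => 2 * Real.sin (Real.pi * ξ (i, a) * h))
        (2 * Real.pi * ξ (i, a)) 0 := by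
      have h1 : HasDerivAt (fun h : ℝ => Real.pi * ξ (i, a) * h) (Real.pi * ξ (i, a)) 0 := by
        simpa using (hasDerivAt_id (0 : ℝ)).const_mul (Real.pi * ξ (i, a))
      have := (h1.sin).const_mul 2
      simpa [mul_assoc] using this
    have h2 := (hasDerivAt_iff_tendsto_slope_zero.1 hs).pow 2
    refine (h2.congr fun h => ?_).trans_eq (by ring_nf)
    simp only [zero_add, mul_zero, Real.sin_zero, sub_zero, smul_eq_mul]
    have e : 2 * Real.pi * (h * ξ (i, a)) = 2 * (Real.pi * ξ (i, a) * h) := by ring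
    rw [e, Real.cos_two_mul, mul_pow, mul_pow, Real.sin_sq]
    ring
  refine hlim.comp (tendsto_nhdsWithin_iff.2 ⟨tendsto_one_div_add_atTop_nhds_zero_nat, ?_⟩)
  exact Eventually.of_forall fun n => by
    simp only [mem_compl_iff, mem_singleton_iff]; positivity

theorem isSymbol_latSym (h : ℝ) (i : ι) : IsSymbol (fun ξ : Conf ι d => (latSym h i ξ : ℂ)) :=
  isSymbol_ofReal (continuous_latSym h i) (C := 1 + d * ((h ^ 2)⁻¹ * 4)) fun ξ => by
    rw [abs_of_nonneg (zero_le_one.trans (one_le_latSym h i ξ))]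
    exact latSym_le_const h i ξ

/-- The vector moving the particle `i` by `h` in the direction `a`. -/
def shiftVec (i : ι) (a : Fin d) (h : ℝ) : Conf ι d := by
  classical exact EuclideanSpace.single (i, a) h

theorem shiftVec_pos_of_ne {i j : ι} (hij : j ≠ i) (a : Fin d) (h : ℝ) :
    (shiftVec i a h).pos j = 0 := by
  ext b
  simp [shiftVec, hij]

theorem expChar_shiftVec (i : ι) (a : Fin d) (h : ℝ) (ξ : Conf ι d) :
    expChar (shiftVec i a h) ξ + expChar (shiftVec i a (-h)) ξ =
      2 * (Real.cos (2 * Real.pi * (h * ξ (i, a))) : ℂ) := by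
  have e : ∀ h : ℝ, inner ℝ (shiftVec i a h) ξ = h * ξ (i, a) := fun h => by
    classical
    rw [shiftVec, EuclideanSpace.inner_single_left]; simp
  rw [expChar, expChar, e, e, Complex.ofReal_cos, Complex.cos]
  push_cast
  have e1 : 2 * (Real.pi : ℂ) * Complex.I * (h * (ξ (i, a) : ℂ)) =
      2 * Real.pi * (h * (ξ (i, a) : ℂ)) * Complex.I := by ring
  have e2 : 2 * (Real.pi : ℂ) * Complex.I * (-h * (ξ (i, a) : ℂ)) =
      -(2 * Real.pi * (h * (ξ (i, a) : ℂ))) * Complex.I := by ring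
  rw [e1, e2]; ring

theorem latSym_eq_sum (h : ℝ) (i : ι) : (fun ξ : Conf ι d => (latSym h i ξ : ℂ)) =
    (fun _ => ((1 + d * ((h ^ 2)⁻¹ * 2) : ℝ) : ℂ)) + ∑ a : Fin d, ((-(h ^ 2)⁻¹ : ℝ) : ℂ) •
      (expChar (shiftVec i a h) + expChar (shiftVec i a (-h))) := by
  ext ξ
  simp only [Pi.add_apply, Finset.sum_apply, Pi.smul_apply, expChar_shiftVec, latSym, smul_eq_mul]
  push_cast
  simp only [mul_sub, Finset.sum_sub_distrib, Finset.sum_const, Finset.card_univ, Fintype.card_fin,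
    nsmul_eq_mul, neg_mul, Finset.sum_neg_distrib]
  ring

/-- The lattice approximation of `1 - Δ` is a combination of translations of one particle, hence
its commutator with the interaction is controlled by `interaction_shift_le`. -/
theorem mult_latSym (h : ℝ) (i : ι) : mult (fun ξ : Conf ι d => (latSym h i ξ : ℂ)) =
    ((1 + d * ((h ^ 2)⁻¹ * 2) : ℝ) : ℂ) • 1 + ∑ a : Fin d, ((-(h ^ 2)⁻¹ : ℝ) : ℂ) •
      (transl (shiftVec i a h) + transl (shiftVec i a (-h))) := by
  refine (congrArg mult (latSym_eq_sum h i)).trans ?_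
  generalize (((1 + d * ((h ^ 2)⁻¹ * 2) : ℝ)) : ℂ) = c
  generalize ((-(h ^ 2)⁻¹ : ℝ) : ℂ) = c'
  have hs : ∀ a : Fin d, IsSymbol (expChar (shiftVec (ι := ι) i a h) + expChar (shiftVec i a (-h))) :=
    fun a => (isSymbol_expChar _).add (isSymbol_expChar _)
  have hs' : ∀ a ∈ (Finset.univ : Finset (Fin d)), IsSymbol
      (c' • (expChar (shiftVec (ι := ι) i a h) + expChar (shiftVec i a (-h)))) := fun a _ => by
    have := (IsSymbol.const (E := Conf ι d) c').mul (hs a)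
    exact this
  rw [mult_add (IsSymbol.const _) (IsSymbol.sum _ hs'), mult_const]
  refine congrArg _ ?_
  refine (mult_sum _ hs').trans ?_
  refine Finset.sum_congr rfl fun a _ => ?_
  rw [mult_smul _ (hs a), mult_add (isSymbol_expChar _) (isSymbol_expChar _), mult_expChar,
    mult_expChar]

end Lattice

/-! ### The energy bound at finite particle number -/

section Abstract

theorem norm_commutator_smul_sum_le {H I : Type} [NormedAddCommGroup H]
    [InnerProductSpace ℂ H] (s : Finset I) (X : I → H →L[ℂ] H) (V : H →L[ℂ] H) {c r : ℝ} (hr : 0 ≤ r)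
    (h : ∀ i ∈ s, ‖X i * V - V * X i‖ ≤ c) :
    ‖((r : ℂ) • ∑ i ∈ s, X i) * V - V * ((r : ℂ) • ∑ i ∈ s, X i)‖ ≤ r * (s.card * c) := by
  rw [smul_mul_assoc, mul_smul_comm, Finset.sum_mul, Finset.mul_sum, ← smul_sub,
    ← Finset.sum_sub_distrib, norm_smul, Complex.norm_real, Real.norm_eq_abs, abs_of_nonneg hr]
  gcongr
  exact (norm_sum_le_of_le _ h).trans_eq (by rw [Finset.sum_const, nsmul_eq_mul])

theorem norm_commutator_add_sum_le {H I : Type} [NormedAddCommGroup H]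
    [InnerProductSpace ℂ H] (s : Finset I) (X Y : I → H →L[ℂ] H) (V : H →L[ℂ] H) {c r : ℝ} (c' : ℂ)
    (hr : 0 ≤ r) (h : ∀ i ∈ s, ‖X i * V - V * X i‖ ≤ c)
    (h' : ∀ i ∈ s, ‖Y i * V - V * Y i‖ ≤ c) :
    ‖(c' • 1 + ∑ i ∈ s, ((-r : ℝ) : ℂ) • (X i + Y i)) * V -
      V * (c' • 1 + ∑ i ∈ s, ((-r : ℝ) : ℂ) • (X i + Y i))‖ ≤ s.card * (r * (c + c)) := by
  have e : (c' • 1 + ∑ i ∈ s, ((-r : ℝ) : ℂ) • (X i + Y i)) * V -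
      V * (c' • 1 + ∑ i ∈ s, ((-r : ℝ) : ℂ) • (X i + Y i)) =
      ∑ i ∈ s, ((-r : ℝ) : ℂ) • ((X i * V - V * X i) + (Y i * V - V * Y i)) := by
    simp only [add_mul, mul_add, Finset.sum_mul, Finset.mul_sum, smul_mul_assoc, mul_smul_comm,
      one_mul, mul_one, smul_add, smul_sub, Finset.sum_add_distrib, Finset.sum_sub_distrib]
    abel
  rw [e]
  refine (norm_sum_le_of_le _ (fun a ha => ?_)).trans_eq (by rw [Finset.sum_const, nsmul_eq_mul])
  rw [norm_smul, Complex.norm_real, norm_neg, Real.norm_eq_abs, abs_of_nonneg hr]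
  gcongr
  exact (norm_add_le _ _).trans (add_le_add (h a ha) (h' a ha))

/-- The spectral subspace estimate `exists_inner_pow_le` applied to an evolved regularized state,
for an operator with resolvent equation `R = Z - Z V R`. -/
theorem exists_inner_pow_evolution_le (m : ℕ) (K : ℝ) {κ : ℝ} (hκ : 0 < κ) {ε : ℝ} (hε : 0 < ε) :
    ∃ δ > 0, ∀ (H : Type) [NormedAddCommGroup H] [InnerProductSpace ℂ H] [CompleteSpace H]
      (A : Set (H × H)) (Z V B S : H →L[ℂ] H) (N : ℕ), 0 ≤ Z → Z ≤ 1 → 0 ≤ V →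
      invAddOne A = Z - Z * V * invAddOne A → 1 ≤ N → 0 ≤ B → ‖B‖ ≤ K → B * Z = Z * B →
      IsSelfAdjoint S → S = (N : ℂ) • B - ((N : ℂ) - 1) • 1 → Z * S * Z ≤ Z →
      (N : ℝ)⁻¹ * ‖B * V - V * B‖ ≤ δ → ∀ χ : ℝ → ℝ, Continuous χ →
      (∀ s, 0 ≤ χ s ∧ χ s ≤ 1) → (∀ s, 2 ≤ s → χ s = 0) → ∀ (t : ℝ) (ψ φ : H),
      φ = evolution A t (regularize A χ κ N ψ) →
      (⟪φ, (B ^ m) φ⟫_ℂ).re ≤ (2 / κ + 1) ^ m + ε := by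
  obtain ⟨δ, hδ, hmain⟩ := exists_inner_pow_le m K (C := 2 / κ + 1) (by positivity) hε
  refine ⟨δ, hδ, ?_⟩
  intro H _ _ _ A Z V B S N hZ hZ1 hV hR hN hB hBK hBZ hSsa hSB hSZ hc χ hχ hχ1 hχ2 t ψ φ hφ
  have hN1 : (1 : ℝ) ≤ N := by exact_mod_cast hN
  have hR0 := resolvent_nonneg hZ hV hR
  have hR1 := resolvent_le_one hZ hZ1 hV hR
  obtain ⟨W, -, hW, hWn, hWc⟩ := exists_evolution_regularize hR0 hR1 hχ hχ1 hχ2 hκ hN t ψ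
  obtain ⟨h0, h1, -⟩ := exists_rescaled_factor hR0 hR1 hN1
  have hSB' : S = (N : ℝ) • B - ((N : ℝ) - 1) • 1 := by
    rw [hSB, ← Complex.coe_smul, ← Complex.coe_smul]; simp
  rw [hφ, hW]
  refine hmain _ (cfc (rescaled N) (invAddOne A)) _ h0 h1 hB hBK
    (conj_rescaled_resolvent_le hZ hZ1 hV hR hN1 hSsa hSB' hSZ)
    ((norm_commutator_rescaled_le hZ hZ1 hV hR hN1 hBZ).trans hc) (W ψ) hWn ?_
  have hsp := spectrum_subset_unitInterval hR0 hR1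
  have hcont : ContinuousOn (rescaled N) (spectrum ℝ (invAddOne A)) := by
    unfold rescaled
    refine ContinuousOn.div (by fun_prop) (by fun_prop) fun r hr => ?_
    have := mul_nonneg (sub_nonneg.2 hN1) (hsp hr).1
    linarith
  rw [← cfc_comp (cutoff (2 / κ + 1)) (rescaled N) (invAddOne A) (IsSelfAdjoint.of_nonneg hR0)
    (continuous_cutoff (by positivity)).continuousOn hcont]
  exact DFunLike.congr_fun hWc ψ

/-- The evolved regularized state has norm at most one and inherits the symmetries of the initial
datum. Its norm is `0` if the cutoff annihilates the datum, which is why `‖φ‖ = 1` is not claimed. -/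
theorem evolution_regularize_invariant {H : Type} [NormedAddCommGroup H] [InnerProductSpace ℂ H]
    [CompleteSpace H] {A : Set (H × H)} {Z V : H →L[ℂ] H} (hZ : 0 ≤ Z) (hZ1 : Z ≤ 1) (hV : 0 ≤ V)
    (hR : invAddOne A = Z - Z * V * invAddOne A) {κ : ℝ} (hκ : 0 < κ) {N : ℕ} (hN : 1 ≤ N)
    {χ : ℝ → ℝ} (hχ : Continuous χ) (hχ1 : ∀ s, 0 ≤ χ s ∧ χ s ≤ 1) (hχ2 : ∀ s, 2 ≤ s → χ s = 0)
    (t : ℝ) {ψ φ : H} (hφ : φ = evolution A t (regularize A χ κ N ψ)) :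
    ‖φ‖ ≤ 1 ∧ ∀ U : H →L[ℂ] H, Commute (invAddOne A) U → U ψ = ψ → U φ = φ := by
  obtain ⟨W, hWX, hW, hWn, -⟩ := exists_evolution_regularize (resolvent_nonneg hZ hV hR)
    (resolvent_le_one hZ hZ1 hV hR) hχ hχ1 hχ2 hκ hN t ψ
  rw [hφ, hW]
  refine ⟨hWn, fun U hU hUψ => ?_⟩
  have := DFunLike.congr_fun (hWX U hU).eq ψ
  rw [mul_apply_eq_comp, mul_apply_eq_comp, hUψ] at this
  exact this.symm

end Abstract

section Average

variable {d N : ℕ}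

/-- The symbol of the average over all particles of the lattice approximations of `1 - Δ_{x_i}`. -/
def avgSym (h : ℝ) (ξ : Conf (Fin N) d) : ℝ := (N : ℝ)⁻¹ * ∑ i, latSym h i ξ

theorem isSymbol_avgSym (h : ℝ) : IsSymbol (fun ξ : Conf (Fin N) d => (avgSym h ξ : ℂ)) := by
  have h1 := (IsSymbol.const (E := Conf (Fin N) d) (((N : ℝ)⁻¹ : ℝ) : ℂ)).mul
    (IsSymbol.sum Finset.univ fun i _ => isSymbol_latSym (d := d) h (i : Fin N))
  convert h1 using 2 with ξ
  simp [avgSym]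

theorem avgSym_nonneg (h : ℝ) (ξ : Conf (Fin N) d) : 0 ≤ avgSym h ξ :=
  mul_nonneg (by positivity) (Finset.sum_nonneg fun i _ => zero_le_one.trans (one_le_latSym h i ξ))

theorem avgSym_le (hN : 1 ≤ N) (h : ℝ) (ξ : Conf (Fin N) d) :
    avgSym h ξ ≤ 1 + d * ((h ^ 2)⁻¹ * 4) := by
  have hN0 : (0 : ℝ) < N := by exact_mod_cast hN
  rw [avgSym, inv_mul_le_iff₀ hN0]
  exact (Finset.sum_le_card_nsmul _ _ _ fun i _ => latSym_le_const h i ξ).trans_eq (by simp; ring)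

theorem mult_avgSym (h : ℝ) : mult (fun ξ : Conf (Fin N) d => (avgSym h ξ : ℂ)) =
    (((N : ℝ)⁻¹ : ℝ) : ℂ) • ∑ i : Fin N, mult (fun ξ : Conf (Fin N) d => (latSym h i ξ : ℂ)) := by
  have hs : ∀ i ∈ (Finset.univ : Finset (Fin N)),
      IsSymbol (fun ξ : Conf (Fin N) d => (latSym h i ξ : ℂ)) := fun i _ => isSymbol_latSym h i
  have e : (fun ξ : Conf (Fin N) d => (avgSym h ξ : ℂ)) = (((N : ℝ)⁻¹ : ℝ) : ℂ) •
      ∑ i : Fin N, fun ξ : Conf (Fin N) d => (latSym h i ξ : ℂ) := by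
    ext ξ; simp [avgSym]
  refine (congrArg mult e).trans ?_
  rw [mult_smul _ (IsSymbol.sum _ hs)]
  exact congrArg _ (mult_sum _ hs)

/-- The commutator of a translation and a potential is bounded by the increment of the potential. -/
theorem norm_commutator_transl_le {E : Type} [NormedAddCommGroup E] [InnerProductSpace ℝ E]
    [FiniteDimensional ℝ E] [MeasurableSpace E] [BorelSpace E] {w : E → ℝ}
    (hw : MemLp (fun x => (w x : ℂ)) ∞ volume) {c : ℝ} (hc : 0 ≤ c) {v : E}
    (h : ∀ᵐ x, |w (x + v) - w x| ≤ c) :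
    ‖transl v * mulOp volume (fun x => (w x : ℂ)) - mulOp volume (fun x => (w x : ℂ)) * transl v‖
      ≤ c := by
  refine ContinuousLinearMap.opNorm_le_bound _ hc fun f => ?_
  rw [← norm_transl_apply v f]
  apply Lp.norm_le_mul_norm_of_ae_le_mul
  rw [sub_apply, mul_apply_eq_comp, mul_apply_eq_comp]
  filter_upwards [Lp.coeFn_sub (transl v (mulOp volume (fun x => (w x : ℂ)) f))
      (mulOp volume (fun x => (w x : ℂ)) (transl v f)),
    coeFn_transl v (mulOp volume (fun x => (w x : ℂ)) f), coeFn_transl v f,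
    coeFn_mulOp hw (transl v f),
    (measurePreserving_add_right volume v).quasiMeasurePreserving.ae (coeFn_mulOp hw f), h]
    with x h1 h2 h3 h4 h5 h6
  rw [h1, Pi.sub_apply, h2, h4, h5, h3, ← sub_mul, norm_mul]
  gcongr
  rw [← Complex.ofReal_sub, Complex.norm_real]
  exact h6

theorem norm_commutator_avgSym_le {V : Op (Fin N) d} {c : ℝ} (h : ℝ) (hN : 1 ≤ N)
    (hV : ∀ (i : Fin N) (a : Fin d) (h : ℝ),
      ‖transl (shiftVec i a h) * V - V * transl (shiftVec i a h)‖ ≤ c) :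
    ‖mult (fun ξ : Conf (Fin N) d => (avgSym h ξ : ℂ)) * V -
      V * mult (fun ξ : Conf (Fin N) d => (avgSym h ξ : ℂ))‖ ≤ d * ((h ^ 2)⁻¹ * (c + c)) := by
  have hN0 : (0 : ℝ) < N := by exact_mod_cast hN
  have h1 : ∀ i ∈ (Finset.univ : Finset (Fin N)),
      ‖mult (fun ξ : Conf (Fin N) d => (latSym h i ξ : ℂ)) * V -
        V * mult (fun ξ : Conf (Fin N) d => (latSym h i ξ : ℂ))‖ ≤ d * ((h ^ 2)⁻¹ * (c + c)) := by
    intro i _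
    rw [mult_latSym]
    have := norm_commutator_add_sum_le (Finset.univ : Finset (Fin d))
      (fun a => transl (shiftVec i a h)) (fun a => transl (shiftVec i a (-h))) V
      ((1 + d * ((h ^ 2)⁻¹ * 2) : ℝ) : ℂ) (r := (h ^ 2)⁻¹) (c := c) (by positivity)
      (fun a _ => hV i a h) (fun a _ => hV i a (-h))
    exact this.trans_eq (by rw [Finset.card_univ, Fintype.card_fin])
  rw [mult_avgSym]
  have := norm_commutator_smul_sum_le Finset.univ _ V (r := (N : ℝ)⁻¹) (by positivity) h1
  exact this.trans_eq (by rw [Finset.card_univ, Fintype.card_fin, inv_mul_cancel_left₀ hN0.ne'])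

end Average

section Energy

variable {d p₀ : ℕ} {V : ∀ p : ℕ, Conf (Fin p) d → ℝ} {β : ℝ}

theorem zOp_nonneg {N : ℕ} : 0 ≤ mult (fun ξ : Conf (Fin N) d => (zSym ξ : ℂ)) :=
  mult_nonneg isSymbol_zSym fun ξ => (zSym_pos ξ).le

theorem zOp_le_one {N : ℕ} : mult (fun ξ : Conf (Fin N) d => (zSym ξ : ℂ)) ≤ 1 := by
  have := mult_mono (m' := fun _ => 1) isSymbol_zSym (by simpa using IsSymbol.const 1)
    (zSym_le_one (E := Conf (Fin N) d))
  simpa [mult_const] using this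

/-- The form inequality `N B - (N - 1) ≤ 1 - Δ` for the average `B` of the lattice operators, in the
form `Z S Z ≤ Z` with `Z = (1 - Δ)⁻¹`. -/
theorem isSelfAdjoint_mult_sub_le (h : ℝ) (hh : h ≠ 0) {N : ℕ} (hN : 1 ≤ N) :
    ∃ S : Op (Fin N) d, IsSelfAdjoint S ∧
      S = (N : ℂ) • mult (fun ξ : Conf (Fin N) d => (avgSym h ξ : ℂ)) - ((N : ℂ) - 1) • 1 ∧
      mult (fun ξ : Conf (Fin N) d => (zSym ξ : ℂ)) * S * mult (fun ξ => (zSym ξ : ℂ)) ≤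
        mult (fun ξ => (zSym ξ : ℂ)) := by
  have hN0 : (0 : ℝ) < N := by exact_mod_cast hN
  -- the symbol of `S` is `∑ᵢ (latSym h i - 1) + 1 ≤ 1 + |2πξ|²`
  obtain ⟨s, hs⟩ : ∃ s : Conf (Fin N) d → ℝ, ∀ ξ, s ξ = N * avgSym h ξ - (N - 1) := ⟨_, fun _ => rfl⟩
  have e : (fun ξ => (s ξ : ℂ)) = (N : ℂ) • (fun ξ : Conf (Fin N) d => (avgSym h ξ : ℂ)) +
      fun _ => (-((N : ℂ) - 1)) := by
    ext ξ; simp [hs]; ring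
  have hc : IsSymbol ((N : ℂ) • (fun ξ : Conf (Fin N) d => (avgSym h ξ : ℂ))) := by
    have := (IsSymbol.const (E := Conf (Fin N) d) (N : ℂ)).mul (isSymbol_avgSym h)
    exact this
  have hsym : IsSymbol (fun ξ => (s ξ : ℂ)) := by
    exact e ▸ hc.add (IsSymbol.const (-((N : ℂ) - 1)))
  have hzsz : IsSymbol (fun ξ : Conf (Fin N) d => ((zSym ξ * s ξ * zSym ξ : ℝ) : ℂ)) := by
    have := (isSymbol_zSym.mul hsym).mul isSymbol_zSym
    convert this using 2 with ξ
    simp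
  refine ⟨mult (fun ξ => (s ξ : ℂ)), mult_isSelfAdjoint hsym, ?_, ?_⟩
  · refine (congrArg mult e).trans ((mult_add hc (IsSymbol.const _)).trans ?_)
    refine (congrArg₂ (· + ·) (mult_smul _ (isSymbol_avgSym h)) (mult_const _)).trans ?_
    exact (congrArg _ (neg_smul _ _)).trans (sub_eq_add_neg _ _).symm
  · have e2 : mult (fun ξ : Conf (Fin N) d => ((zSym ξ * s ξ * zSym ξ : ℝ) : ℂ)) =
        mult (fun ξ : Conf (Fin N) d => (zSym ξ : ℂ)) * mult (fun ξ => (s ξ : ℂ)) *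
          mult (fun ξ => (zSym ξ : ℂ)) := by
      refine Eq.trans ?_ ((mult_mul (isSymbol_zSym.mul hsym) isSymbol_zSym).trans
        (congrArg (· * _) (mult_mul isSymbol_zSym hsym)))
      congr 1
      ext ξ; simp
    refine e2.symm.trans_le (mult_mono hzsz isSymbol_zSym fun ξ => ?_)
    have h1 : s ξ ≤ 1 + (2 * Real.pi * ‖ξ‖) ^ 2 := by
        have : ∑ i, latSym h i ξ ≤ ∑ i, (1 + (2 * Real.pi * ‖ξ.pos i‖) ^ 2) :=
          Finset.sum_le_sum fun i _ => latSym_le hh i ξ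
        simp only [mul_pow, Finset.sum_add_distrib, ← Finset.mul_sum, ← norm_conf_sq] at this
        simp only [hs, avgSym, mul_inv_cancel_left₀ hN0.ne', mul_pow]
        simp at this
        linarith
    have h2 : s ξ * zSym ξ ≤ 1 := by
        rw [zSym, ← div_eq_mul_inv, div_le_one (by positivity)]; exact h1
    rw [mul_assoc]
    exact mul_le_of_le_one_right (zSym_pos ξ).le h2

/-- For large `N` the regularized evolved state satisfies `⟨φ, Bᵐ φ⟩ ≤ (2/κ + 1)ᵐ + ε`, where `B` is
the average of the lattice approximations of `1 - Δ_{x_i}` and `2/κ + 1` bounds `(H_N + N)/N` on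
the spectral subspace. -/
theorem eventually_inner_pow_le (hV : ∀ p, 1 ≤ p → p ≤ p₀ → IsAdmissiblePotential (V p))
    {κ : ℝ} (hκ : 0 < κ) (hβ : 0 ≤ β) (hβ1 : (p₀ : ℝ) * d * β < 1) (m : ℕ) {h : ℝ} (hh : h ≠ 0)
    {ε : ℝ} (hε : 0 < ε) : ∀ᶠ N : ℕ in atTop, ∀ χ : ℝ → ℝ, Continuous χ →
      (∀ s, 0 ≤ χ s ∧ χ s ≤ 1) → (∀ s, 2 ≤ s → χ s = 0) → ∀ (t : ℝ) (ψ φ : L2 (Fin N) d),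
      φ = evolution (hamiltonianGraph d p₀ V β N) t
        (regularize (hamiltonianGraph d p₀ V β N) χ κ N ψ) →
      (⟪φ, (mult (fun ξ : Conf (Fin N) d => (avgSym h ξ : ℂ)) ^ m) φ⟫_ℂ).re ≤
        (2 / κ + 1) ^ m + ε := by
  obtain ⟨δ, hδ, hmain⟩ := exists_inner_pow_evolution_le m (1 + d * ((h ^ 2)⁻¹ * 4)) hκ hε
  set c := ∑ p ∈ Finset.Icc 1 p₀, 2 * ((p : ℝ) + 1) * essBound (V p) with hc
  -- the commutator of `B` with `V` is `O(N^{p₀dβ})`, and the rescaled resolvent gains `1 / N`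
  have hlim : Tendsto (fun N : ℕ => (N : ℝ)⁻¹ * (d * ((h ^ 2)⁻¹ *
      (c * (N : ℝ) ^ ((p₀ : ℝ) * d * β) + c * (N : ℝ) ^ ((p₀ : ℝ) * d * β))))) atTop (𝓝 0) := by
    have h1 := ((tendsto_rpow_neg_atTop (y := 1 - (p₀ : ℝ) * d * β) (by linarith)).comp
      tendsto_natCast_atTop_atTop).const_mul (d * ((h ^ 2)⁻¹ * (c + c)))
    rw [mul_zero] at h1
    refine h1.congr' ?_
    filter_upwards [eventually_gt_atTop 0] with N hN
    have hN0 : (0 : ℝ) < N := by exact_mod_cast hN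
    simp only [Function.comp]
    rw [neg_sub, Real.rpow_sub hN0, Real.rpow_one]
    field_simp
  filter_upwards [hlim.eventually_le_const hδ, eventually_ge_atTop 1] with N hsmall hN
  obtain ⟨S, hSsa, hSB, hSZ⟩ := isSelfAdjoint_mult_sub_le (d := d) h hh hN
  have hc0 : 0 ≤ c * (N : ℝ) ^ ((p₀ : ℝ) * d * β) := by
    refine mul_nonneg (Finset.sum_nonneg fun p _ => ?_) (by positivity)
    have : 0 ≤ essBound (V p) := by unfold essBound; positivity
    positivity
  have hcomm := norm_commutator_avgSym_le (d := d) h hN (V := potentialOp d p₀ V β N) fun i a h' =>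
    norm_commutator_transl_le (interaction_memLp (β := β) hV hN) hc0
      (interaction_shift_le hV hβ hN i (shiftVec i a h')
        fun j hj => shiftVec_pos_of_ne hj a h')
  exact hmain _ (hamiltonianGraph d p₀ V β N) _ _
    (mult (fun ξ : Conf (Fin N) d => (avgSym h ξ : ℂ))) S N zOp_nonneg zOp_le_one
    (potentialOp_nonneg hV hN) (resolvent_hamiltonian hV hN) hN (mult_nonneg (isSymbol_avgSym h) (avgSym_nonneg h))
    (norm_mult_le (by positivity) fun ξ => by
      rw [Complex.norm_real, Real.norm_eq_abs, abs_of_nonneg (avgSym_nonneg h ξ)]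
      exact avgSym_le hN h ξ)
    (mult_commute (isSymbol_avgSym h) isSymbol_zSym) hSsa hSB hSZ
    ((mul_le_mul_of_nonneg_left hcomm (by positivity)).trans hsmall)

/-- The regularized evolved state is bosonic and of norm at most one. -/
theorem norm_evolution_regularize_le (hV : ∀ p, 1 ≤ p → p ≤ p₀ → IsAdmissiblePotential (V p))
    {κ : ℝ} (hκ : 0 < κ) {N : ℕ} (hN : 1 ≤ N) {χ : ℝ → ℝ} (hχ : Continuous χ)
    (hχ1 : ∀ s, 0 ≤ χ s ∧ χ s ≤ 1) (hχ2 : ∀ s, 2 ≤ s → χ s = 0) (t : ℝ) {ψ : L2 (Fin N) d}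
    (hψ : IsBosonic ψ) {φ : L2 (Fin N) d} (hφ : φ = evolution (hamiltonianGraph d p₀ V β N) t
        (regularize (hamiltonianGraph d p₀ V β N) χ κ N ψ)) :
    ‖φ‖ ≤ 1 ∧ ∀ σ : Equiv.Perm (Fin N), isomComp (reindex d σ) φ = φ := by
  obtain ⟨h1, h2⟩ := evolution_regularize_invariant zOp_nonneg zOp_le_one
    (potentialOp_nonneg (β := β) hV hN) (resolvent_hamiltonian hV hN) hκ hN hχ hχ1 hχ2 t hφ
  refine ⟨h1, fun σ => h2 _ (permutation_commute_resolvent hV hN σ) ?_⟩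
  apply Lp.ext
  filter_upwards [coeFn_isomComp (reindex d σ) ψ, hψ σ] with x h1 h2
  rw [h1, reindex_apply, h2]

end Energy

/-! ### Energy bounds for finitely many particles -/

section Product

variable {ι κ : Type} [Fintype ι] [Fintype κ] {d : ℕ}

/-- The symbol of the product of the lattice approximations of `1 - Δ` in the positions of the
particles `f l`. -/
def prodSym (h : ℝ) (f : κ → ι) (ξ : Conf ι d) : ℝ := ∏ l, latSym h (f l) ξ

theorem isSymbol_prodSym (h : ℝ) (f : κ → ι) :
    IsSymbol (fun ξ : Conf ι d => (prodSym h f ξ : ℂ)) := by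
  have h1 := IsSymbol.prod Finset.univ fun l _ => isSymbol_latSym (d := d) h (f l)
  convert h1 using 2 with ξ
  simp [prodSym]

theorem one_le_prodSym (h : ℝ) (f : κ → ι) (ξ : Conf ι d) : 1 ≤ prodSym h f ξ :=
  Finset.prod_induction _ (1 ≤ ·) (fun _ _ => one_le_mul_of_one_le_of_one_le) le_rfl
    fun l _ => one_le_latSym h (f l) ξ

theorem prodSym_pos (h : ℝ) (f : κ → ι) (ξ : Conf ι d) : 0 < prodSym h f ξ :=
  zero_lt_one.trans_le (one_le_prodSym h f ξ)

theorem prodSym_reindex {ι' : Type} [Fintype ι'] (h : ℝ) (f : κ → ι) (e : ι ≃ ι') (ξ : Conf ι' d) :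
    prodSym h f (reindex d e ξ) = prodSym h (e ∘ f) ξ := by
  simp [prodSym, latSym, reindex_apply]

end Product

section Bosonic

variable {d N : ℕ}

/-- Two injective labellings differ by a permutation. -/
theorem exists_perm_comp_eq {α β : Type} [Finite β] {f g : α → β}
    (hf : Function.Injective f) (hg : Function.Injective g) : ∃ σ : Equiv.Perm β, σ ∘ f = g := by
  classical
  have := Fintype.ofFinite β
  refine ⟨((Equiv.ofInjective f hf).symm.trans (Equiv.ofInjective g hg)).extendSubtype, ?_⟩
  ext a
  have := Equiv.extendSubtype_apply_of_mem
    ((Equiv.ofInjective f hf).symm.trans (Equiv.ofInjective g hg)) (f a) ⟨a, rfl⟩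
  rw [Function.comp_apply, this, Equiv.trans_apply]
  have e : (⟨f a, ⟨a, rfl⟩⟩ : Set.range f) = Equiv.ofInjective f hf a := rfl
  rw [e, Equiv.symm_apply_apply, Equiv.ofInjective_apply]

variable {φ : L2 (Fin N) d} (hφ : ∀ σ : Equiv.Perm (Fin N), isomComp (reindex d σ) φ = φ)
include hφ

/-- For a bosonic wave function the energy of `m` distinct particles does not depend on which ones
are chosen. -/
theorem inner_prodSym_eq {m : ℕ} (h : ℝ) {f g : Fin m → Fin N} (hf : Function.Injective f)
    (hg : Function.Injective g) : ⟪φ, mult (fun ξ => (prodSym h f ξ : ℂ)) φ⟫_ℂ =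
      ⟪φ, mult (fun ξ => (prodSym h g ξ : ℂ)) φ⟫_ℂ := by
  obtain ⟨σ, rfl⟩ := exists_perm_comp_eq hf hg
  rw [← inner_isomComp (reindex d σ), isomComp_mult _ (isSymbol_prodSym h f), hφ σ]
  simp_rw [prodSym_reindex]

/-- For bosonic wave functions, the `m`-th moment of the average `N⁻¹ ∑ᵢ latSym h i` controls the
product of `latSym h i` over `m` distinct particles. -/
theorem descFactorial_mul_inner_prodSym_le {m : ℕ} (h : ℝ) {f : Fin m → Fin N}
    (hf : Function.Injective f) :
    (N.descFactorial m : ℝ) * (⟪φ, mult (fun ξ => (prodSym h f ξ : ℂ)) φ⟫_ℂ).re ≤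
      (N : ℝ) ^ m * (⟪φ, (mult (fun ξ : Conf (Fin N) d => (avgSym h ξ : ℂ)) ^ m) φ⟫_ℂ).re := by
  classical
  obtain ⟨hs, he⟩ := mult_pow (isSymbol_avgSym (d := d) (N := N) h) m
  have e0 : (fun ξ : Conf (Fin N) d => (avgSym h ξ : ℂ)) ^ m = fun ξ => ((avgSym h ξ ^ m : ℝ) : ℂ) := by
    ext ξ; simp
  rw [e0] at hs he
  rw [← he, inner_mult_self hs, Complex.ofReal_re]
  have e1 : (N.descFactorial m : ℝ) * (⟪φ, mult (fun ξ => (prodSym h f ξ : ℂ)) φ⟫_ℂ).re =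
      ∑ g : Fin m ↪ Fin N, ∫ ξ, prodSym h g ξ * ‖(𝓕 φ : L2 (Fin N) d) ξ‖ ^ 2 := by
    rw [Finset.sum_congr rfl fun g _ => ?_, Finset.sum_const, Finset.card_univ,
      Fintype.card_embedding_eq, Fintype.card_fin, Fintype.card_fin, nsmul_eq_mul]
    rw [inner_prodSym_eq hφ h hf g.injective, inner_mult_self (isSymbol_prodSym h g),
      Complex.ofReal_re]
  have hI : ∀ {s : Conf (Fin N) d → ℝ}, IsSymbol (fun ξ => (s ξ : ℂ)) →
      Integrable (fun ξ => s ξ * ‖(𝓕 φ : L2 (Fin N) d) ξ‖ ^ 2) := fun hs =>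
    integrable_mul_norm_sq (by simpa using hs.memLp.re) _
  have hI' : ∀ g ∈ (Finset.univ : Finset (Fin m ↪ Fin N)), Integrable (fun ξ : Conf (Fin N) d =>
      prodSym h g ξ * ‖(𝓕 φ : L2 (Fin N) d) ξ‖ ^ 2) := fun g _ => hI (isSymbol_prodSym h g)
  rw [e1, ← integral_finsetSum _ hI', ← integral_const_mul]
  refine integral_mono (integrable_finsetSum _ hI')
    ((hI hs).const_mul _) fun ξ => ?_
  simp only
  rw [← Finset.sum_mul, ← mul_assoc]
  refine mul_le_mul_of_nonneg_right ?_ (by positivity)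
  rw [← mul_pow]
  rcases Nat.eq_zero_or_pos N with hN | hN
  · subst hN
    rcases m with _ | m
    · simp [prodSym]
    · exact (Fin.elim0 (f 0))
  · have hN0 : (N : ℝ) ≠ 0 := by positivity
    -- expand `(∑ᵢ latSym h i)ᵐ` and drop the tuples with repeated particles
    rw [avgSym, mul_inv_cancel_left₀ hN0, Fintype.sum_pow]
    refine (Finset.sum_map Finset.univ ⟨fun g : Fin m ↪ Fin N => (g : Fin m → Fin N),
      DFunLike.coe_injective⟩ fun g => prodSym h g ξ).symm.trans_le ?_
    exact Finset.sum_le_univ_sum_of_nonneg fun g => (prodSym_pos h g ξ).le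

end Bosonic

/-- The energy of `m` particles in the regularized evolved state is at most `(2/κ + 1)ᵐ`, up to an
error that vanishes as `N → ∞`. -/
theorem eventually_inner_prodSym_le {d p₀ : ℕ} {V : ∀ p : ℕ, Conf (Fin p) d → ℝ} {β : ℝ}
    (hV : ∀ p, 1 ≤ p → p ≤ p₀ → IsAdmissiblePotential (V p))
    {κ : ℝ} (hκ : 0 < κ) (hβ : 0 ≤ β) (hβ1 : (p₀ : ℝ) * d * β < 1) (m : ℕ) {h : ℝ} (hh : h ≠ 0)
    {ε : ℝ} (hε : 0 < ε) : ∀ᶠ N : ℕ in atTop, ∀ χ : ℝ → ℝ, Continuous χ →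
      (∀ s, 0 ≤ χ s ∧ χ s ≤ 1) → (∀ s, 2 ≤ s → χ s = 0) → ∀ (t : ℝ) (ψ φ : L2 (Fin N) d),
      IsBosonic ψ → φ = evolution (hamiltonianGraph d p₀ V β N) t
        (regularize (hamiltonianGraph d p₀ V β N) χ κ N ψ) →
      ∀ f : Fin m → Fin N, Function.Injective f →
        (⟪φ, mult (fun ξ => (prodSym h f ξ : ℂ)) φ⟫_ℂ).re ≤ (2 / κ + 1) ^ m + ε := by
  have hratio : Tendsto (fun N : ℕ => (N : ℝ) ^ m / (N.descFactorial m : ℝ) *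
      ((2 / κ + 1) ^ m + ε / 2)) atTop (𝓝 (1 * ((2 / κ + 1) ^ m + ε / 2))) := by
    refine Tendsto.mul_const _ ?_
    have h1 := (isEquivalent_descFactorial m).symm
    refine (Asymptotics.isEquivalent_iff_tendsto_one ?_).1 h1
    filter_upwards [eventually_ge_atTop m] with N hN
    exact_mod_cast (Nat.descFactorial_pos.2 hN).ne'
  filter_upwards [hratio.eventually_le_const (u := (2 / κ + 1) ^ m + ε) (by linarith),
    eventually_inner_pow_le hV hκ hβ hβ1 m hh (half_pos hε), eventually_ge_atTop m,
    eventually_ge_atTop 1] with N h1 h2 h3 h4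
  intro χ hχ hχ1 hχ2 t ψ φ hψ hφ f hf
  have h5 := h2 χ hχ hχ1 hχ2 t ψ φ hφ
  have h6 := descFactorial_mul_inner_prodSym_le
    (norm_evolution_regularize_le hV hκ h4 hχ hχ1 hχ2 t hψ hφ).2 h hf
  have hD : (0 : ℝ) < N.descFactorial m := by exact_mod_cast Nat.descFactorial_pos.2 h3
  refine le_trans ?_ h1
  rw [div_mul_eq_mul_div, le_div_iff₀ hD, mul_comm]
  exact h6.trans (mul_le_mul_of_nonneg_left h5 (by positivity))

/-! ### Pairs of configurations and rank one kernels -/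

section Glue

variable {ι κ : Type} {d : ℕ}

/-- The unprimed half `x` of a pair `(x; x')`. -/
def leftConf (z : Conf (ι ⊕ κ) d) : Conf ι d := Conf.mk fun i => z.pos (Sum.inl i)

/-- The primed half `x'` of a pair `(x; x')`. -/
def rightConf (z : Conf (ι ⊕ κ) d) : Conf κ d := Conf.mk fun i => z.pos (Sum.inr i)

@[simp] theorem leftConf_glue (x : Conf ι d) (y : Conf κ d) : leftConf (glue x y) = x := by
  ext ⟨i, a⟩; simp [leftConf, glue]

@[simp] theorem rightConf_glue (x : Conf ι d) (y : Conf κ d) : rightConf (glue x y) = y := by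
  ext ⟨i, a⟩; simp [rightConf, glue]

@[simp] theorem glue_leftConf_rightConf (z : Conf (ι ⊕ κ) d) : glue (leftConf z) (rightConf z) = z := by
  ext ⟨i | i, a⟩ <;> simp [leftConf, rightConf, glue]

@[simp] theorem glue_pos_inl (x : Conf ι d) (y : Conf κ d) (i : ι) :
    (glue x y).pos (Sum.inl i) = x.pos i := by ext; simp [glue]

@[simp] theorem glue_pos_inr (x : Conf ι d) (y : Conf κ d) (i : κ) :
    (glue x y).pos (Sum.inr i) = y.pos i := by ext; simp [glue]

variable [Fintype ι] [Fintype κ]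

/-- Gluing of configurations as a linear isometry. -/
def glueIsom (ι κ : Type) [Fintype ι] [Fintype κ] (d : ℕ) :
    WithLp 2 (Conf ι d × Conf κ d) ≃ₗᵢ[ℝ] Conf (ι ⊕ κ) d where
  toFun p := glue p.fst p.snd
  invFun z := WithLp.toLp 2 (leftConf z, rightConf z)
  left_inv p := by simp only [leftConf_glue, rightConf_glue]; rfl
  right_inv z := by simp
  map_add' p q := by ext ⟨i | i, a⟩ <;> simp [glue]
  map_smul' c p := by ext ⟨i | i, a⟩ <;> simp [glue]
  norm_map' p := by
    change ‖glue p.fst p.snd‖ = ‖p‖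
    refine (sq_eq_sq₀ (norm_nonneg _) (norm_nonneg _)).1 ?_
    rw [WithLp.prod_norm_sq_eq_of_L2, norm_conf_sq, norm_conf_sq, norm_conf_sq, Fintype.sum_sum_type]
    simp

/-- Gluing of configurations as a measurable equivalence. -/
def glueEquiv (ι κ : Type) [Fintype ι] [Fintype κ] (d : ℕ) :
    Conf ι d × Conf κ d ≃ᵐ Conf (ι ⊕ κ) d :=
  (MeasurableEquiv.toLp 2 (Conf ι d × Conf κ d)).trans (glueIsom ι κ d).toMeasurableEquiv

theorem glueEquiv_apply (p : Conf ι d × Conf κ d) : glueEquiv ι κ d p = glue p.1 p.2 := rfl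

theorem glueEquiv_symm_apply (z : Conf (ι ⊕ κ) d) :
    (glueEquiv ι κ d).symm z = (leftConf z, rightConf z) := rfl

theorem measurePreserving_glueEquiv : MeasurePreserving (glueEquiv ι κ d) (volume.prod volume) volume :=
  (WithLp.volume_preserving_toLp (Conf ι d) (Conf κ d)).trans (glueIsom ι κ d).measurePreserving

theorem integral_glue {E : Type*} [NormedAddCommGroup E] [NormedSpace ℝ E]
    (F : Conf (ι ⊕ κ) d → E) :
    ∫ z, F z = ∫ p : Conf ι d × Conf κ d, F (glue p.1 p.2) ∂(volume.prod volume) :=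
  (measurePreserving_glueEquiv.integral_comp' F).symm

theorem ae_glue {P : Conf (ι ⊕ κ) d → Prop} (h : ∀ᵐ z, P z) :
    ∀ᵐ p : Conf ι d × Conf κ d ∂(volume.prod volume), P (glue p.1 p.2) :=
  measurePreserving_glueEquiv.quasiMeasurePreserving.ae h

theorem ae_of_ae_glue {P : Conf (ι ⊕ κ) d → Prop}
    (h : ∀ᵐ p : Conf ι d × Conf κ d ∂(volume.prod volume), P (glue p.1 p.2)) : ∀ᵐ z, P z := by
  have := (measurePreserving_glueEquiv.symm (glueEquiv ι κ d)).quasiMeasurePreserving.ae h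
  filter_upwards [this] with z hz
  simpa [glueEquiv_symm_apply] using hz

theorem ae_leftConf {P : Conf ι d → Prop} (h : ∀ᵐ x, P x) :
    ∀ᵐ z : Conf (ι ⊕ κ) d, P (leftConf z) :=
  ae_of_ae_glue (by
    simpa using (Measure.quasiMeasurePreserving_fst (μ := (volume : Measure (Conf ι d)))
      (ν := (volume : Measure (Conf κ d)))).ae h)

theorem ae_rightConf {P : Conf κ d → Prop} (h : ∀ᵐ x, P x) :
    ∀ᵐ z : Conf (ι ⊕ κ) d, P (rightConf z) :=
  ae_of_ae_glue (by
    simpa using (Measure.quasiMeasurePreserving_snd (μ := (volume : Measure (Conf ι d)))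
      (ν := (volume : Measure (Conf κ d)))).ae h)

theorem memLp_glue (K : L2 (ι ⊕ κ) d) : MemLp (fun p : Conf ι d × Conf κ d => K (glue p.1 p.2)) 2
    (volume.prod volume) :=
  (Lp.memLp K).comp_measurePreserving measurePreserving_glueEquiv

end Glue

section Ket

variable {ι κ : Type} [Fintype ι] [Fintype κ] {d : ℕ}

theorem memLp_ket (v : L2 ι d) (u : L2 κ d) :
    MemLp (fun z : Conf (ι ⊕ κ) d => v (leftConf z) * starRingEnd ℂ (u (rightConf z))) 2 volume := by
  have h : MemLp (fun p : Conf ι d × Conf κ d => v p.1 * starRingEnd ℂ (u p.2)) 2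
      (volume.prod volume) := by
    have hm : AEStronglyMeasurable (fun p : Conf ι d × Conf κ d => v p.1 * starRingEnd ℂ (u p.2))
        (volume.prod volume) :=
      (Lp.aestronglyMeasurable v).comp_fst.mul
        (Complex.continuous_conj.comp_aestronglyMeasurable (Lp.aestronglyMeasurable u).comp_snd)
    rw [memLp_two_iff_integrable_sq_norm hm]
    have := Integrable.mul_prod (μ := (volume : Measure (Conf ι d)))
      (ν := (volume : Measure (Conf κ d)))
      ((memLp_two_iff_integrable_sq_norm (Lp.aestronglyMeasurable v)).1 (Lp.memLp v))
      ((memLp_two_iff_integrable_sq_norm (Lp.aestronglyMeasurable u)).1 (Lp.memLp u))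
    refine this.congr (ae_of_all _ fun p => ?_)
    simp [mul_pow]
  have := h.comp_measurePreserving (measurePreserving_glueEquiv.symm (glueEquiv ι κ d))
  exact this

/-- The kernel `v(x) \bar u(x')` of the rank one operator `|v⟩⟨u|`. -/
def ket (v : L2 ι d) (u : L2 κ d) : L2 (ι ⊕ κ) d := (memLp_ket v u).toLp

theorem coeFn_ket (v : L2 ι d) (u : L2 κ d) :
    ket v u =ᵐ[volume] fun z => v (leftConf z) * starRingEnd ℂ (u (rightConf z)) :=
  MemLp.coeFn_toLp _

theorem inner_ket_ket (v v' : L2 ι d) (u u' : L2 κ d) :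
    ⟪ket v u, ket v' u'⟫_ℂ = ⟪v, v'⟫_ℂ * ⟪u', u⟫_ℂ := by
  simp only [L2.inner_def]
  rw [← integral_prod_mul, integral_glue]
  refine integral_congr_ae ?_
  filter_upwards [ae_glue (coeFn_ket v u), ae_glue (coeFn_ket v' u')] with p h1 h2
  rw [h1, h2]
  simp only [leftConf_glue, rightConf_glue, RCLike.inner_apply, map_mul, Complex.conj_conj]
  ring

theorem norm_ket (v : L2 ι d) (u : L2 κ d) : ‖ket v u‖ = ‖v‖ * ‖u‖ := by
  have h := inner_ket_ket v v u u
  rw [inner_self_eq_norm_sq_to_K, inner_self_eq_norm_sq_to_K, inner_self_eq_norm_sq_to_K] at h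
  have h' : ‖ket v u‖ ^ 2 = (‖v‖ * ‖u‖) ^ 2 := by rw [mul_pow]; exact_mod_cast h
  exact (sq_eq_sq₀ (norm_nonneg _) (by positivity)).1 h'

theorem ket_add_left (v v' : L2 ι d) (u : L2 κ d) : ket (v + v') u = ket v u + ket v' u := by
  apply Lp.ext
  filter_upwards [coeFn_ket (v + v') u, coeFn_ket v u, coeFn_ket v' u,
    Lp.coeFn_add (ket v u) (ket v' u), ae_leftConf (κ := κ) (Lp.coeFn_add v v')] with z h1 h2 h3 h4 h5
  rw [h1, h4, Pi.add_apply, h2, h3, h5, Pi.add_apply, add_mul]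

theorem ket_smul_left (c : ℂ) (v : L2 ι d) (u : L2 κ d) : ket (c • v) u = c • ket v u := by
  apply Lp.ext
  filter_upwards [coeFn_ket (c • v) u, coeFn_ket v u, Lp.coeFn_smul c (ket v u),
    ae_leftConf (κ := κ) (Lp.coeFn_smul c v)] with z h1 h2 h3 h4
  rw [h1, h3, Pi.smul_apply, h2, h4, Pi.smul_apply, smul_eq_mul, smul_eq_mul, mul_assoc]

theorem ket_add_right (v : L2 ι d) (u u' : L2 κ d) : ket v (u + u') = ket v u + ket v u' := by
  apply Lp.ext
  filter_upwards [coeFn_ket v (u + u'), coeFn_ket v u, coeFn_ket v u',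
    Lp.coeFn_add (ket v u) (ket v u'), ae_rightConf (ι := ι) (Lp.coeFn_add u u')] with z h1 h2 h3 h4 h5
  rw [h1, h4, Pi.add_apply, h2, h3, h5, Pi.add_apply, map_add, mul_add]

theorem ket_smul_right (c : ℂ) (v : L2 ι d) (u : L2 κ d) :
    ket v (c • u) = starRingEnd ℂ c • ket v u := by
  apply Lp.ext
  filter_upwards [coeFn_ket v (c • u), coeFn_ket v u, Lp.coeFn_smul (starRingEnd ℂ c) (ket v u),
    ae_rightConf (ι := ι) (Lp.coeFn_smul c u)] with z h1 h2 h3 h4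
  rw [h1, h3, Pi.smul_apply, h2, h4, Pi.smul_apply, smul_eq_mul, smul_eq_mul, map_mul]
  ring

/-- The map `v ↦ v(x) \bar u(x')`. -/
def ketL (ι : Type) [Fintype ι] (u : L2 κ d) : L2 ι d →L[ℂ] L2 (ι ⊕ κ) d :=
  LinearMap.mkContinuous
    { toFun := fun v => ket v u
      map_add' := fun v v' => ket_add_left v v' u
      map_smul' := fun c v => ket_smul_left c v u } ‖u‖ fun v => by
    change ‖ket v u‖ ≤ _
    rw [norm_ket, mul_comm]

theorem ketL_apply (v : L2 ι d) (u : L2 κ d) : ketL ι u v = ket v u := rfl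

open Classical in
/-- The function `y ↦ \bar K(x, y)` as an element of `L²` (for almost every `x`). -/
def slice (K : L2 (ι ⊕ κ) d) (x : Conf ι d) : L2 κ d :=
  if h : MemLp (fun y => starRingEnd ℂ (K (glue x y))) 2 volume then h.toLp else 0

/-- Almost every slice of a square integrable kernel is square integrable. -/
theorem ae_memLp_slice (K : L2 (ι ⊕ κ) d) :
    ∀ᵐ x : Conf ι d, MemLp (fun y : Conf κ d => starRingEnd ℂ (K (glue x y))) 2 volume := by
  have h := memLp_glue K
  have h2 := (memLp_two_iff_integrable_sq_norm h.aestronglyMeasurable).1 h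
  filter_upwards [h2.prod_right_ae, h.aestronglyMeasurable.prodMk_left] with x hx hm
  have hm' := Complex.continuous_conj.comp_aestronglyMeasurable hm
  refine (memLp_two_iff_integrable_sq_norm hm').2 ?_
  simpa using hx

theorem ae_coeFn_slice (K : L2 (ι ⊕ κ) d) :
    ∀ᵐ x : Conf ι d, slice K x =ᵐ[volume] fun y => starRingEnd ℂ (K (glue x y)) := by
  filter_upwards [ae_memLp_slice K] with x hx
  rw [slice, dif_pos hx]
  exact MemLp.coeFn_toLp hx

theorem enorm_sq_eq_lintegral {X : Type} [MeasurableSpace X] {μ : Measure X} (f : Lp ℂ 2 μ) :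
    ‖f‖ₑ ^ 2 = ∫⁻ x, ‖f x‖ₑ ^ 2 ∂μ := by
  rw [Lp.enorm_def, eLpNorm_eq_lintegral_rpow_enorm_toReal (by norm_num) (by norm_num)]
  simp only [ENNReal.toReal_ofNat, ENNReal.rpow_ofNat, one_div]
  rw [← ENNReal.rpow_two, ← ENNReal.rpow_mul]
  simp

theorem lintegral_enorm_slice (K : L2 (ι ⊕ κ) d) :
    ∫⁻ x : Conf ι d, ‖slice K x‖ₑ ^ 2 = ‖K‖ₑ ^ 2 := by
  rw [enorm_sq_eq_lintegral, ← measurePreserving_glueEquiv.lintegral_comp_emb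
    (glueEquiv ι κ d).measurableEmbedding]
  simp only [glueEquiv_apply]
  rw [lintegral_prod _ ((memLp_glue K).aestronglyMeasurable.enorm.pow_const 2)]
  refine lintegral_congr_ae ?_
  filter_upwards [ae_coeFn_slice K] with x hx
  rw [enorm_sq_eq_lintegral]
  refine lintegral_congr_ae ?_
  filter_upwards [hx] with y hy
  rw [hy, RCLike.enorm_conj]

theorem ae_inner_slice (K : L2 (ι ⊕ κ) d) (u : L2 κ d) :
    ∀ᵐ x : Conf ι d, ⟪slice K x, u⟫_ℂ = ∫ y, K (glue x y) * u y := by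
  filter_upwards [ae_coeFn_slice K] with x hx
  rw [L2.inner_def]
  refine integral_congr_ae ?_
  filter_upwards [hx] with y hy
  rw [hy, RCLike.inner_apply, Complex.conj_conj, mul_comm]

theorem memLp_inner_slice (K : L2 (ι ⊕ κ) d) (u : L2 κ d) :
    MemLp (fun x : Conf ι d => ⟪slice K x, u⟫_ℂ) 2 volume := by
  have hm : AEStronglyMeasurable (fun x : Conf ι d => ⟪slice K x, u⟫_ℂ) volume := by
    have : AEStronglyMeasurable (fun p : Conf ι d × Conf κ d => K (glue p.1 p.2) * u p.2)
        (volume.prod volume) :=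
      (memLp_glue K).aestronglyMeasurable.mul (Lp.aestronglyMeasurable u).comp_snd
    refine this.integral_prod_right'.congr ?_
    filter_upwards [ae_inner_slice K u] with x hx using hx.symm
  refine ⟨hm, ?_⟩
  rw [eLpNorm_lt_top_iff_lintegral_rpow_enorm_lt_top (by norm_num) (by norm_num)]
  simp only [ENNReal.toReal_ofNat, ENNReal.rpow_ofNat]
  calc ∫⁻ x : Conf ι d, ‖⟪slice K x, u⟫_ℂ‖ₑ ^ 2
      ≤ ∫⁻ x : Conf ι d, ‖slice K x‖ₑ ^ 2 * ‖u‖ₑ ^ 2 := by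
        refine lintegral_mono fun x => ?_
        rw [← mul_pow]
        gcongr
        rw [← ofReal_norm, ← ofReal_norm, ← ofReal_norm, ← ENNReal.ofReal_mul (norm_nonneg _)]
        exact ENNReal.ofReal_le_ofReal (norm_inner_le_norm _ _)
    _ = ‖K‖ₑ ^ 2 * ‖u‖ₑ ^ 2 := by
        rw [lintegral_mul_const' _ _ (by finiteness), lintegral_enorm_slice]
    _ < ⊤ := by finiteness

/-- The adjoint of `v ↦ v(x) \bar u(y)` is the partial integral `K ↦ ∫ K(x, y) u(y) dy`. -/
theorem coeFn_adjoint_ketL (K : L2 (ι ⊕ κ) d) (u : L2 κ d) :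
    (ketL ι u).adjoint K =ᵐ[volume] fun x => ⟪slice K x, u⟫_ℂ := by
  set F := (memLp_inner_slice K u).toLp with hF
  have hFc : F =ᵐ[volume] fun x => ⟪slice K x, u⟫_ℂ := MemLp.coeFn_toLp _
  suffices h : (ketL ι u).adjoint K = F by rw [h]; exact hFc
  refine ext_inner_left ℂ fun f => ?_
  rw [ContinuousLinearMap.adjoint_inner_right, ketL_apply]
  have hint : Integrable (fun p : Conf ι d × Conf κ d =>
      inner ℂ (ket f u (glue p.1 p.2)) (K (glue p.1 p.2))) (volume.prod volume) :=
    measurePreserving_glueEquiv.integrable_comp_of_integrable (L2.integrable_inner (𝕜 := ℂ) (ket f u) K)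
  rw [L2.inner_def, integral_glue, integral_prod _ hint, L2.inner_def]
  refine integral_congr_ae ?_
  filter_upwards [hFc, ae_inner_slice K u, Measure.ae_ae_of_ae_prod (ae_glue (coeFn_ket f u))]
    with x h1 h2 h3
  rw [h1, h2, RCLike.inner_apply, ← integral_mul_const]
  refine integral_congr_ae ?_
  filter_upwards [h3] with y hy
  rw [hy, RCLike.inner_apply]
  simp only [leftConf_glue, rightConf_glue, map_mul, Complex.conj_conj]
  ring

end Ket

/-! ### Traces and weak* convergence -/

section KetSums

variable {H : Type} [NormedAddCommGroup H] [InnerProductSpace ℂ H] {I I' : Type}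

/-- `A = ∑ᵢ |vᵢ⟩⟨uᵢ|` with `∑ᵢ ‖uᵢ‖ ‖vᵢ‖ < ∞`. -/
def HasKets (A : H →L[ℂ] H) (u v : I → H) : Prop :=
  Summable (fun i => ‖u i‖ * ‖v i‖) ∧ ∀ x, HasSum (fun i => ⟪u i, x⟫_ℂ • v i) (A x)

theorem HasKets.sub {A B : H →L[ℂ] H} {u v : I → H} {u' v' : I' → H} (hA : HasKets A u v)
    (hB : HasKets B u' v') : HasKets (A - B) (Sum.elim u u') (Sum.elim v fun i => -v' i) := by
  constructor
  · refine Summable.sum _ ?_ ?_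
    · exact hA.1
    · simpa [Function.comp_def] using hB.1
  · intro x
    rw [sub_apply, sub_eq_add_neg]
    refine HasSum.sum (f := fun i => ⟪Sum.elim u u' i, x⟫_ℂ • (Sum.elim v fun i => -v' i) i) ?_ ?_
    · exact hA.2 x
    · simpa [Function.comp_def] using (hB.2 x).neg

/-- Cauchy–Schwarz together with Bessel's inequality. -/
theorem sum_norm_inner_mul_norm_inner_le {J : Type*} (b : HilbertBasis J ℂ H) (u w : H)
    (s : Finset J) : ∑ i ∈ s, ‖⟪u, b i⟫_ℂ * ⟪b i, w⟫_ℂ‖ ≤ ‖u‖ * ‖w‖ := by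
  simp only [norm_mul]
  refine (Real.sum_mul_le_sqrt_mul_sqrt _ _ _).trans ?_
  have h : ∀ x : H, √(∑ i ∈ s, ‖⟪b i, x⟫_ℂ‖ ^ 2) ≤ ‖x‖ := fun x =>
    (Real.sqrt_le_left (norm_nonneg x)).2 (b.orthonormal.sum_inner_products_le x)
  refine mul_le_mul ?_ (h w) (Real.sqrt_nonneg _) (norm_nonneg _)
  simpa only [norm_inner_symm u] using h u

theorem summable_norm_inner_mul_inner {J : Type*} (b : HilbertBasis J ℂ H) (u w : H) :
    Summable (fun i => ‖⟪u, b i⟫_ℂ * ⟪b i, w⟫_ℂ‖) :=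
  summable_of_sum_le (fun _ => norm_nonneg _) (sum_norm_inner_mul_norm_inner_le b u w)

variable [CompleteSpace H]

/-- The trace in the basis chosen in `opTrace` is the sum of the diagonal of the rank one
decomposition; exchanging the two sums is justified by absolute convergence. -/
theorem HasKets.hasSum_opTrace {A : H →L[ℂ] H} {u v : I → H} (hA : HasKets A u v)
    (J : H →L[ℂ] H) : HasSum (fun i => ⟪u i, J (v i)⟫_ℂ) (opTrace (J ∘L A)) := by
  set b := (exists_hilbertBasis ℂ H).choose_spec.choose with hb
  set f : I × (exists_hilbertBasis ℂ H).choose → ℂ :=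
    fun p => ⟪u p.1, b p.2⟫_ℂ * ⟪b p.2, J (v p.1)⟫_ℂ with hf
  have hsum : Summable f := by
    refine Summable.of_norm ((summable_prod_of_nonneg fun p => norm_nonneg _).2 ⟨fun i => ?_, ?_⟩)
    · exact summable_norm_inner_mul_inner b (u i) (J (v i))
    · refine Summable.of_nonneg_of_le (fun i => tsum_nonneg fun _ => norm_nonneg _) (fun i => ?_)
        (hA.1.mul_left ‖J‖)
      refine (Real.tsum_le_of_sum_le (fun _ => norm_nonneg _)
        (sum_norm_inner_mul_norm_inner_le b (u i) (J (v i)))).trans ?_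
      calc ‖u i‖ * ‖J (v i)‖ ≤ ‖u i‖ * (‖J‖ * ‖v i‖) := by gcongr; exact J.le_opNorm _
        _ = ‖J‖ * (‖u i‖ * ‖v i‖) := by ring
  have h1 : HasSum (fun i => ⟪u i, J (v i)⟫_ℂ) (∑' p, f p) :=
    hsum.hasSum.prod_fiberwise fun i => b.hasSum_inner_mul_inner (u i) (J (v i))
  convert h1 using 1
  have hswap : Summable (f ∘ Prod.swap) := (Equiv.prodComm _ _).summable_iff.2 hsum
  have h2 := hswap.hasSum.prod_fiberwise (g := fun k => ⟪b k, J (A (b k))⟫_ℂ) fun k => by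
    have h3 := ((innerSL ℂ (b k)) ∘L J).hasSum (hA.2 (b k))
    have h4 : HasSum (fun i => (f ∘ Prod.swap) (k, i)) (((innerSL ℂ (b k)) ∘L J) (A (b k))) := by
      refine h3.congr_fun fun i => ?_
      simp [hf]
    exact h4
  rw [← (Equiv.prodComm _ _).tsum_eq f]
  exact h2.tsum_eq

theorem HasKets.norm_opTrace_le {A : H →L[ℂ] H} {u v : I → H} (hA : HasKets A u v)
    (J : H →L[ℂ] H) : ‖opTrace (J ∘L A)‖ ≤ ‖J‖ * ∑' i, ‖u i‖ * ‖v i‖ := by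
  rw [← (hA.hasSum_opTrace J).tsum_eq, ← tsum_mul_left]
  refine tsum_of_norm_bounded (hA.1.mul_left ‖J‖).hasSum fun i => ?_
  calc ‖⟪u i, J (v i)⟫_ℂ‖ ≤ ‖u i‖ * ‖J (v i)‖ := norm_inner_le_norm _ _
    _ ≤ ‖u i‖ * (‖J‖ * ‖v i‖) := by gcongr; exact J.le_opNorm _
    _ = ‖J‖ * (‖u i‖ * ‖v i‖) := by ring

theorem HasKets.opTrace_sub {A B : H →L[ℂ] H} {u v : I → H} {u' v' : I' → H} (hA : HasKets A u v)
    (hB : HasKets B u' v') (J : H →L[ℂ] H) :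
    opTrace (J ∘L (A - B)) = opTrace (J ∘L A) - opTrace (J ∘L B) := by
  refine ((hA.sub hB).hasSum_opTrace J).unique ?_
  rw [sub_eq_add_neg]
  refine HasSum.sum (f := fun i => ⟪Sum.elim u u' i, J ((Sum.elim v fun i => -v' i) i)⟫_ℂ) ?_ ?_
  · exact hA.hasSum_opTrace J
  · simpa [Function.comp_def] using (hB.hasSum_opTrace J).neg

theorem HasKets.opTrace_eq_add {A : H →L[ℂ] H} {u v : I → H} (hA : HasKets A u v)
    (K J : H →L[ℂ] H) (c : ℂ) :
    opTrace (K ∘L A) = opTrace ((K - c • J) ∘L A) + c * opTrace (J ∘L A) := by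
  refine (hA.hasSum_opTrace K).unique ?_
  convert (hA.hasSum_opTrace (K - c • J)).add ((hA.hasSum_opTrace J).mul_left c) using 2 with i
  rw [sub_apply, smul_apply, inner_sub_right, inner_smul_right, sub_add_cancel]

/-- Every absolutely convergent sum of rank one operators is a compact operator. -/
theorem exists_isCompactOperator_hasKets {u v : I → H} (h : Summable fun i => ‖u i‖ * ‖v i‖) :
    ∃ A : H →L[ℂ] H, IsCompactOperator A ∧ HasKets A u v := by
  have hs : Summable fun i => InnerProductSpace.rankOne ℂ (v i) (u i) :=
    Summable.of_norm (h.congr fun i => by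
      rw [InnerProductSpace.norm_rankOne, mul_comm])
  refine ⟨∑' i, InnerProductSpace.rankOne ℂ (v i) (u i), ?_, h, fun x => ?_⟩
  rotate_left
  · have hF : ∀ i, InnerProductSpace.rankOne ℂ (v i) (u i) x = ⟪u i, x⟫_ℂ • v i := fun i =>
      InnerProductSpace.rankOne_apply ..
    have h2 := (ContinuousLinearMap.apply ℂ H x).hasSum hs.hasSum
    simp only [ContinuousLinearMap.apply_apply, hF] at h2
    exact h2
  · refine isCompactOperator_of_tendsto hs.hasSum (Eventually.of_forall fun s => ?_)
    classical
    induction s using Finset.induction_on with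
    | empty => simpa using isCompactOperator_zero
    | insert i s hi ih =>
      rw [Finset.sum_insert hi]
      refine IsCompactOperator.add ?_ ih
      rw [InnerProductSpace.rankOne_def']
      exact (isCompactOperator_of_locallyCompactSpace_rng
        (ContinuousLinearMap.toSpanSingleton ℂ (v i))).comp_clm (innerSL ℂ (u i))

/-- On sequences that are bounded in trace norm, the metric of the weak* topology controls the
traces against all compact operators. -/
theorem tendsto_opTrace {J : ℕ → H →L[ℂ] H} (hJ : IsDenseInCompactBall J) {A : ℕ → H →L[ℂ] H}
    {A₀ : H →L[ℂ] H} {M : ℝ} (hA : ∀ᶠ m in atTop, ∃ (I : Type) (u v : I → H),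
      HasKets (A m) u v ∧ ∑' i, ‖u i‖ * ‖v i‖ ≤ M) {u₀ v₀ : I → H} (h₀ : HasKets A₀ u₀ v₀)
    (hlim : Tendsto (fun m => weakStarDist J (A m) A₀) atTop (𝓝 0)) {K : H →L[ℂ] H}
    (hK : IsCompactOperator K) :
    Tendsto (fun m => opTrace (K ∘L A m)) atTop (𝓝 (opTrace (K ∘L A₀))) := by
  rw [Metric.tendsto_atTop']
  intro ε hε
  set M₀ := ∑' i, ‖u₀ i‖ * ‖v₀ i‖
  have hM₀ : 0 ≤ M₀ := tsum_nonneg fun i => by positivity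
  set M' := |M| + M₀ + 1 with hM'
  have hM'0 : 0 < M' := by positivity
  -- approximate `K` by a multiple of some `J i`
  set c : ℝ := ‖K‖ + 1 with hc
  have hc0 : 0 < c := by positivity
  obtain ⟨i, hi⟩ := hJ.2 (((c⁻¹ : ℝ) : ℂ) • K) (hK.smul _) (by
    rw [norm_smul, Complex.norm_real, Real.norm_eq_abs, abs_of_pos (by positivity),
      inv_mul_le_iff₀ hc0]; linarith) (ε / (2 * (c * M'))) (by positivity)
  have hi' : ‖K - (c : ℂ) • J i‖ < ε / (2 * M') := by
    have e : K - (c : ℂ) • J i = (c : ℂ) • ((((c⁻¹ : ℝ) : ℂ) • K) - J i) := by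
      rw [smul_sub, smul_smul, ← Complex.ofReal_mul, mul_inv_cancel₀ hc0.ne', Complex.ofReal_one,
        one_smul]
    rw [e, norm_smul, Complex.norm_real, Real.norm_eq_abs, abs_of_pos hc0]
    calc _ < c * (ε / (2 * (c * M'))) := by gcongr
      _ = _ := by field_simp
  have h1 := (hlim.const_mul (c * 2 ^ (i + 1))).eventually_lt_const (u := ε / 2)
    (by simpa using half_pos hε)
  obtain ⟨m₀, hm₀⟩ := eventually_atTop.1 (h1.and hA)
  refine ⟨m₀, fun m hm => ?_⟩
  obtain ⟨h2, I', u, v, hkets, hle⟩ := hm₀ m hm.le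
  have hD := hkets.sub h₀
  have hDM : ∑' i, ‖Sum.elim u u₀ i‖ * ‖(Sum.elim v fun i => -v₀ i) i‖ ≤ M' := by
    have e : HasSum (fun i => ‖Sum.elim u u₀ i‖ * ‖(Sum.elim v fun i => -v₀ i) i‖)
        (∑' i, ‖u i‖ * ‖v i‖ + M₀) :=
      HasSum.sum (f := fun i => ‖Sum.elim u u₀ i‖ * ‖(Sum.elim v fun i => -v₀ i) i‖)
        hkets.1.hasSum (by simpa [Function.comp_def] using h₀.1.hasSum)
    rw [e.tsum_eq]
    linarith [le_abs_self M]
  have hterm : (1 / 2 : ℝ) ^ (i + 1) * ‖opTrace (J i ∘L (A m - A₀))‖ ≤ weakStarDist J (A m) A₀ := by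
    refine Summable.le_tsum (f := fun i : ℕ => (1 / 2 : ℝ) ^ (i + 1) *
      ‖opTrace (J i ∘L (A m - A₀))‖) ?_ i fun _ _ => by positivity
    refine Summable.of_nonneg_of_le (fun _ => by positivity) (fun l => ?_)
      (((summable_nat_add_iff 1).2 summable_geometric_two).mul_right M')
    refine mul_le_mul_of_nonneg_left ((hD.norm_opTrace_le (J l)).trans ?_) (by positivity)
    exact (mul_le_of_le_one_left (tsum_nonneg fun _ => by positivity) (hJ.1 l).2).trans hDM
  rw [dist_eq_norm, ← hkets.opTrace_sub h₀, hD.opTrace_eq_add K (J i) c]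
  have h3 : ‖opTrace ((K - (c : ℂ) • J i) ∘L (A m - A₀))‖ ≤ ε / 2 := by
    refine (hD.norm_opTrace_le _).trans ?_
    calc _ ≤ ε / (2 * M') * M' := mul_le_mul hi'.le hDM (tsum_nonneg fun _ => by positivity)
          (by positivity)
      _ = ε / 2 := by field_simp
  have h4 : ‖(c : ℂ) * opTrace (J i ∘L (A m - A₀))‖ < ε / 2 := by
    rw [norm_mul, Complex.norm_real, Real.norm_eq_abs, abs_of_pos hc0]
    refine lt_of_le_of_lt ?_ h2
    rw [mul_assoc]
    gcongr
    calc _ = 2 ^ (i + 1) * ((1 / 2 : ℝ) ^ (i + 1) * ‖opTrace (J i ∘L (A m - A₀))‖) := by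
          rw [← mul_assoc, ← mul_pow]; norm_num
      _ ≤ _ := by gcongr
  calc _ ≤ _ := norm_add_le _ _
    _ < ε / 2 + ε / 2 := add_lt_add_of_le_of_lt h3 h4
    _ = ε := add_halves ε

end KetSums

/-! ### Kernels of trace class operators -/

section Multipliers

variable {ι κ : Type} [Fintype ι] [Fintype κ] {d : ℕ}

theorem transl_ket (w : Conf (ι ⊕ κ) d) (v : L2 ι d) (u : L2 κ d) :
    transl w (ket v u) = ket (transl (leftConf w) v) (transl (rightConf w) u) := by
  apply Lp.ext
  filter_upwards [coeFn_transl w (ket v u), coeFn_ket (transl (leftConf w) v) (transl (rightConf w) u),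
    (measurePreserving_add_right volume w).quasiMeasurePreserving.ae (coeFn_ket v u),
    ae_leftConf (κ := κ) (coeFn_transl (leftConf w) v),
    ae_rightConf (ι := ι) (coeFn_transl (rightConf w) u)] with z h1 h2 h3 h4 h5
  rw [h1, h2, h3, h4, h5]
  rfl

theorem transl_zero {E : Type} [NormedAddCommGroup E] [InnerProductSpace ℝ E]
    [FiniteDimensional ℝ E] [MeasurableSpace E] [BorelSpace E] (f : Lp ℂ 2 (volume : Measure E)) :
    transl 0 f = f := by
  apply Lp.ext
  filter_upwards [coeFn_transl 0 f] with x hx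
  rw [hx, add_zero]

theorem leftConf_shiftVec_inl (i : ι) (a : Fin d) (h : ℝ) :
    leftConf (shiftVec (Sum.inl i : ι ⊕ κ) a h) = shiftVec i a h := by
  classical
  ext ⟨j, b⟩; simp [leftConf, shiftVec, Prod.ext_iff]

theorem rightConf_shiftVec_inl (i : ι) (a : Fin d) (h : ℝ) :
    rightConf (shiftVec (Sum.inl i : ι ⊕ κ) a h) = 0 := by
  classical
  ext ⟨j, b⟩; simp [rightConf, shiftVec]

theorem leftConf_shiftVec_inr (i : κ) (a : Fin d) (h : ℝ) :
    leftConf (shiftVec (Sum.inr i : ι ⊕ κ) a h) = 0 := by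
  classical
  ext ⟨j, b⟩; simp [leftConf, shiftVec]

theorem rightConf_shiftVec_inr (i : κ) (a : Fin d) (h : ℝ) :
    rightConf (shiftVec (Sum.inr i : ι ⊕ κ) a h) = shiftVec i a h := by
  classical
  ext ⟨j, b⟩; simp [rightConf, shiftVec, Prod.ext_iff]

theorem ket_sum_left {I : Type*} (s : Finset I) (v : I → L2 ι d) (u : L2 κ d) :
    ket (∑ i ∈ s, v i) u = ∑ i ∈ s, ket (v i) u :=
  map_sum (AddMonoidHom.mk' (fun v => ket v u) fun v v' => ket_add_left v v' u) v s

theorem ket_sum_right {I : Type*} (s : Finset I) (v : L2 ι d) (u : I → L2 κ d) :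
    ket v (∑ i ∈ s, u i) = ∑ i ∈ s, ket v (u i) :=
  map_sum (AddMonoidHom.mk' (fun u => ket v u) fun u u' => ket_add_right v u u') u s

theorem mult_latSym_apply (h : ℝ) (i : ι) (f : L2 ι d) :
    mult (fun ξ : Conf ι d => (latSym h i ξ : ℂ)) f =
      ((1 + d * ((h ^ 2)⁻¹ * 2) : ℝ) : ℂ) • f + ∑ a : Fin d, ((-(h ^ 2)⁻¹ : ℝ) : ℂ) •
        (transl (shiftVec i a h) f + transl (shiftVec i a (-h)) f) := by
  refine (DFunLike.congr_fun (mult_latSym h i) f).trans ?_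
  generalize ((1 + d * ((h ^ 2)⁻¹ * 2) : ℝ) : ℂ) = c
  generalize ((-(h ^ 2)⁻¹ : ℝ) : ℂ) = c'
  refine (add_apply _ _ f).trans (congrArg₂ _ rfl ?_)
  exact sum_apply _ _ f

theorem mult_latSym_inl_ket (h : ℝ) (i : ι) (v : L2 ι d) (u : L2 κ d) :
    mult (fun ξ : Conf (ι ⊕ κ) d => (latSym h (Sum.inl i) ξ : ℂ)) (ket v u) =
      ket (mult (fun ξ => (latSym h i ξ : ℂ)) v) u := by
  rw [mult_latSym_apply, mult_latSym_apply, ket_add_left, ket_sum_left, ket_smul_left]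
  congr 1
  refine Finset.sum_congr rfl fun a _ => ?_
  rw [ket_smul_left, ket_add_left, transl_ket, transl_ket]
  simp only [leftConf_shiftVec_inl, rightConf_shiftVec_inl, transl_zero]

theorem mult_latSym_inr_ket (h : ℝ) (i : κ) (v : L2 ι d) (u : L2 κ d) :
    mult (fun ξ : Conf (ι ⊕ κ) d => (latSym h (Sum.inr i) ξ : ℂ)) (ket v u) =
      ket v (mult (fun ξ => (latSym h i ξ : ℂ)) u) := by
  rw [mult_latSym_apply, mult_latSym_apply, ket_add_right, ket_sum_right, ket_smul_right,
    Complex.conj_ofReal]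
  congr 1
  refine Finset.sum_congr rfl fun a _ => ?_
  rw [ket_smul_right, ket_add_right, transl_ket, transl_ket, Complex.conj_ofReal]
  simp only [leftConf_shiftVec_inr, rightConf_shiftVec_inr, transl_zero]

theorem ofReal_prodSym (h : ℝ) (f : κ → ι) : (fun ξ : Conf ι d => (prodSym h f ξ : ℂ)) =
    ∏ l, fun ξ : Conf ι d => (latSym h (f l) ξ : ℂ) := by
  ext ξ; simp [prodSym]

theorem mult_prodSym_inl_ket (h : ℝ) (v : L2 ι d) (u : L2 κ d) :
    mult (fun ξ : Conf (ι ⊕ κ) d => (prodSym h (Sum.inl : ι → ι ⊕ κ) ξ : ℂ)) (ket v u) =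
      ket (mult (fun ξ => (prodSym h id ξ : ℂ)) v) u := by
  classical
  suffices hs : ∀ s : Finset ι,
      mult (∏ i ∈ s, fun ξ : Conf (ι ⊕ κ) d => (latSym h (Sum.inl i) ξ : ℂ)) (ket v u) =
        ket (mult (∏ i ∈ s, fun ξ : Conf ι d => (latSym h i ξ : ℂ)) v) u by
    rw [ofReal_prodSym, ofReal_prodSym]; exact hs Finset.univ
  intro s
  induction s using Finset.induction_on with
  | empty =>
    have e1 : (1 : Conf (ι ⊕ κ) d → ℂ) = fun _ => 1 := rfl
    have e2 : (1 : Conf ι d → ℂ) = fun _ => 1 := rfl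
    simp [e1, e2, mult_const]
  | insert i s hi ih =>
    rw [Finset.prod_insert hi, Finset.prod_insert hi,
      mult_mul (isSymbol_latSym h _) (IsSymbol.prod s fun l _ => isSymbol_latSym h _),
      mult_mul (isSymbol_latSym h _) (IsSymbol.prod s fun l _ => isSymbol_latSym h _),
      mul_apply_eq_comp, mul_apply_eq_comp, ih, mult_latSym_inl_ket]

theorem mult_prodSym_inr_ket (h : ℝ) (v : L2 ι d) (u : L2 κ d) :
    mult (fun ξ : Conf (ι ⊕ κ) d => (prodSym h (Sum.inr : κ → ι ⊕ κ) ξ : ℂ)) (ket v u) =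
      ket v (mult (fun ξ => (prodSym h id ξ : ℂ)) u) := by
  classical
  suffices hs : ∀ s : Finset κ,
      mult (∏ i ∈ s, fun ξ : Conf (ι ⊕ κ) d => (latSym h (Sum.inr i) ξ : ℂ)) (ket v u) =
        ket v (mult (∏ i ∈ s, fun ξ : Conf κ d => (latSym h i ξ : ℂ)) u) by
    rw [ofReal_prodSym, ofReal_prodSym]; exact hs Finset.univ
  intro s
  induction s using Finset.induction_on with
  | empty =>
    have e1 : (1 : Conf (ι ⊕ κ) d → ℂ) = fun _ => 1 := rfl
    have e2 : (1 : Conf κ d → ℂ) = fun _ => 1 := rfl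
    simp [e1, e2, mult_const]
  | insert i s hi ih =>
    rw [Finset.prod_insert hi, Finset.prod_insert hi,
      mult_mul (isSymbol_latSym h _) (IsSymbol.prod s fun l _ => isSymbol_latSym h _),
      mult_mul (isSymbol_latSym h _) (IsSymbol.prod s fun l _ => isSymbol_latSym h _),
      mul_apply_eq_comp, mul_apply_eq_comp, ih, mult_latSym_inr_ket]

/-- The product of the lattice operators over all particles of a pair factorizes over the two halves.
The symbols are even in `ξ`, so the complex conjugation in the second half does no harm. -/
theorem mult_prodSym_ket (h : ℝ) (v : L2 ι d) (u : L2 κ d) :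
    mult (fun ξ : Conf (ι ⊕ κ) d => (prodSym h id ξ : ℂ)) (ket v u) =
      ket (mult (fun ξ => (prodSym h id ξ : ℂ)) v) (mult (fun ξ => (prodSym h id ξ : ℂ)) u) := by
  have e : (fun ξ : Conf (ι ⊕ κ) d => (prodSym h id ξ : ℂ)) =
      (fun ξ => (prodSym h (Sum.inl : ι → ι ⊕ κ) ξ : ℂ)) *
        fun ξ => (prodSym h (Sum.inr : κ → ι ⊕ κ) ξ : ℂ) := by
    ext ξ; simp [prodSym, Fintype.prod_sum_type]
  rw [e, mult_mul (isSymbol_prodSym h _) (isSymbol_prodSym h _), mul_apply_eq_comp,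
    mult_prodSym_inr_ket, mult_prodSym_inl_ket]

/-- An operator on the first variables commutes with the integration over the remaining ones. -/
theorem adjoint_ketL_mult (h : ℝ) (u : L2 κ d) (K : L2 (ι ⊕ κ) d) :
    (ketL ι u).adjoint (mult (fun ξ => (prodSym h (Sum.inl : ι → ι ⊕ κ) ξ : ℂ)) K) =
      mult (fun ξ => (prodSym h id ξ : ℂ)) ((ketL ι u).adjoint K) := by
  refine ext_inner_left ℂ fun v => ?_
  rw [ContinuousLinearMap.adjoint_inner_right, ← inner_mult_real_left (isSymbol_prodSym h _),
    ← inner_mult_real_left (isSymbol_prodSym h _), ContinuousLinearMap.adjoint_inner_right,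
    ketL_apply, ketL_apply, mult_prodSym_inl_ket]

end Multipliers

section Kernels

variable {ι κ : Type} [Fintype ι] [Fintype κ] {d : ℕ} {I : Type}

theorem adjoint_ketL_ket (v : L2 ι d) (u y : L2 κ d) :
    (ketL ι y).adjoint (ket v u) = ⟪u, y⟫_ℂ • v := by
  refine ext_inner_left ℂ fun x => ?_
  rw [ContinuousLinearMap.adjoint_inner_right, ketL_apply, inner_ket_ket, inner_smul_right, mul_comm]

theorem summable_ket {u : I → L2 κ d} {v : I → L2 ι d} (h : Summable fun i => ‖u i‖ * ‖v i‖) :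
    Summable fun i => ket (v i) (u i) :=
  Summable.of_norm (h.congr fun i => by rw [norm_ket, mul_comm])

theorem HasKets.adjoint_ketL_tsum {A : Op ι d} {u v : I → L2 ι d} (hA : HasKets A u v) (y : L2 ι d) :
    (ketL ι y).adjoint (∑' i, ket (v i) (u i)) = A y := by
  refine HasSum.unique ?_ (hA.2 y)
  have := ((ketL ι y).adjoint).hasSum (summable_ket hA.1).hasSum
  simpa only [adjoint_ketL_ket] using this

/-- The kernel of `∑ᵢ |vᵢ⟩⟨uᵢ|` is `∑ᵢ vᵢ(x) \bar uᵢ(x')`. -/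
theorem HasKets.hasKernel {A : Op ι d} {u v : I → L2 ι d} (hA : HasKets A u v) :
    HasKernel A (∑' i, ket (v i) (u i) : L2 (ι ⊕ ι) d) := by
  refine ⟨Lp.memLp _, fun f => ?_⟩
  rw [← hA.adjoint_ketL_tsum f]
  filter_upwards [coeFn_adjoint_ketL (∑' i, ket (v i) (u i)) f,
    ae_inner_slice (∑' i, ket (v i) (u i)) f] with x h1 h2
  rw [h1, h2]

theorem HasKernel.eq_opOfKernel {A : Op ι d} {K : Conf (ι ⊕ ι) d → ℂ} (h : HasKernel A K) :
    opOfKernel K = A := by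
  have hex : ∃ A : Op ι d, HasKernel A K := ⟨A, h⟩
  rw [opOfKernel, dif_pos hex]
  ext1 f
  apply Lp.ext
  filter_upwards [hex.choose_spec.2 f, h.2 f] with x h1 h2
  rw [h1, h2]

theorem HasKernel.congr {A : Op ι d} {K K' : Conf (ι ⊕ ι) d → ℂ} (h : HasKernel A K)
    (hK : K =ᵐ[volume] K') : HasKernel A K' := by
  refine ⟨h.1.ae_eq hK, fun f => ?_⟩
  filter_upwards [h.2 f, Measure.ae_ae_of_ae_prod (ae_glue hK)] with x h1 h2
  rw [h1]
  refine integral_congr_ae ?_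
  filter_upwards [h2] with y hy
  rw [hy]

theorem countable_hilbertBasis {H : Type} [NormedAddCommGroup H] [InnerProductSpace ℂ H]
    [TopologicalSpace.SeparableSpace H] (b : HilbertBasis I ℂ H) : Countable I := by
  have hb := b.orthonormal
  have h : (Set.univ : Set I).Countable := by
    refine Set.PairwiseDisjoint.countable_of_isOpen (s := fun i => Metric.ball (b i) (1 / 2))
      (fun i _ j _ hij => ?_) (fun i _ => Metric.isOpen_ball)
      fun i _ => ⟨b i, Metric.mem_ball_self (by norm_num)⟩
    refine Metric.ball_disjoint_ball ?_
    rw [dist_eq_norm]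
    have h2 : ‖b i - b j‖ ^ 2 = 2 := by
      rw [@norm_sub_sq ℂ, hb.1 i, hb.1 j, hb.2 hij]; norm_num
    nlinarith [norm_nonneg (b i - b j)]
  exact Set.countable_univ_iff.1 h

theorem exists_countable_hilbertBasis (κ : Type) [Fintype κ] (d : ℕ) :
    ∃ (I : Type) (_ : HilbertBasis I ℂ (L2 κ d)), Countable I := by
  obtain ⟨w, b, -⟩ := exists_hilbertBasis ℂ (L2 κ d)
  have : Fact ((2 : ℝ≥0∞) ≠ ⊤) := ⟨by norm_num⟩
  exact ⟨w, b, countable_hilbertBasis b⟩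

theorem hasSum_norm_sq_repr {H : Type} [NormedAddCommGroup H] [InnerProductSpace ℂ H]
    (b : HilbertBasis I ℂ H) (x : H) : HasSum (fun i => ‖⟪x, b i⟫_ℂ‖ ^ 2) (‖x‖ ^ 2) := by
  have h := b.hasSum_inner_mul_inner x x
  have hx : ((‖x‖ ^ 2 : ℝ) : ℂ) = ⟪x, x⟫_ℂ := by
    rw [inner_self_eq_norm_sq_to_K]; exact Complex.ofReal_pow _ _
  have e : ∀ i, ⟪x, b i⟫_ℂ * ⟪b i, x⟫_ℂ = ((‖⟪x, b i⟫_ℂ‖ ^ 2 : ℝ) : ℂ) := fun i => by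
    rw [← inner_conj_symm (b i) x, RCLike.mul_conj]; norm_cast
  simp only [e] at h
  refine Complex.hasSum_ofReal.1 ?_
  rw [hx]
  exact h

/-- The vectors `φ_l = ∫ ψ(·, y) e_l(y) dy` for an orthonormal basis `(e_l)` satisfy
`∑_l ‖φ_l‖² = ‖ψ‖²`. -/
theorem hasSum_norm_sq_adjoint_ketL [Countable I] (b : HilbertBasis I ℂ (L2 κ d))
    (ψ : L2 (ι ⊕ κ) d) : HasSum (fun i => ‖(ketL ι (b i)).adjoint ψ‖ ^ 2) (‖ψ‖ ^ 2) := by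
  have h : ∑' i, ‖(ketL ι (b i)).adjoint ψ‖ₑ ^ 2 = ‖ψ‖ₑ ^ 2 := by
    rw [← lintegral_enorm_slice]
    simp only [enorm_sq_eq_lintegral ((ketL ι (b _)).adjoint ψ)]
    rw [← lintegral_tsum fun i => (Lp.aestronglyMeasurable _).enorm.pow_const 2]
    refine lintegral_congr_ae ?_
    filter_upwards [ae_all_iff.2 fun i => coeFn_adjoint_ketL ψ (b i)] with x hx
    simp only [hx]
    have h1 := hasSum_norm_sq_repr b (slice ψ x)
    have h2 : HasSum (fun i => ‖⟪slice ψ x, b i⟫_ℂ‖₊ ^ 2) (‖slice ψ x‖₊ ^ 2) := by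
      refine NNReal.hasSum_coe.1 ?_
      simpa only [NNReal.coe_pow, coe_nnnorm] using h1
    have h3 := ENNReal.hasSum_coe.2 h2
    simp only [ENNReal.coe_pow] at h3
    exact h3.tsum_eq
  have h2 : HasSum (fun i => ‖(ketL ι (b i)).adjoint ψ‖₊ ^ 2) (‖ψ‖₊ ^ 2) := by
    rw [← ENNReal.hasSum_coe]
    simp only [ENNReal.coe_pow]
    rw [Summable.hasSum_iff ENNReal.summable]
    exact h
  simpa only [NNReal.coe_pow, coe_nnnorm] using NNReal.hasSum_coe.2 h2

/-- Polarization of `hasSum_norm_sq_adjoint_ketL`. -/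
theorem hasSum_inner_adjoint_ketL [Countable I] (b : HilbertBasis I ℂ (L2 κ d))
    (ψ ψ' : L2 (ι ⊕ κ) d) : HasSum (fun i => ⟪(ketL ι (b i)).adjoint ψ, (ketL ι (b i)).adjoint ψ'⟫_ℂ)
      ⟪ψ, ψ'⟫_ℂ := by
  have hc : ∀ ψ : L2 (ι ⊕ κ) d, HasSum (fun i => ((‖(ketL ι (b i)).adjoint ψ‖ : ℝ) : ℂ) ^ 2)
      (((‖ψ‖ : ℝ) : ℂ) ^ 2) := fun ψ => by
    exact_mod_cast hasSum_norm_sq_adjoint_ketL b ψ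
  simp only [inner_eq_sum_norm_sq_div_four, ← map_add, ← map_sub, ← map_smul]
  exact ((((hc _).sub (hc _)).add (((hc _).sub (hc _)).mul_right _)).div_const 4)

/-- The marginal of the pure state `ψ` as a sum of rank one operators. -/
theorem exists_hasKets_marginal [Countable I] (b : HilbertBasis I ℂ (L2 κ d)) (ψ : L2 (ι ⊕ κ) d) :
    ∃ A : Op ι d, HasKets A (fun i => (ketL ι (b i)).adjoint ψ) (fun i => (ketL ι (b i)).adjoint ψ) ∧
      HasKernel A fun z => ∫ y, ψ (glue (leftConf z) y) *
        starRingEnd ℂ (ψ (glue (rightConf z) y)) := by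
  have hs : Summable fun i => ‖(ketL ι (b i)).adjoint ψ‖ * ‖(ketL ι (b i)).adjoint ψ‖ := by
    simpa only [sq] using (hasSum_norm_sq_adjoint_ketL b ψ).summable
  obtain ⟨A, -, hA⟩ := exists_isCompactOperator_hasKets hs
  refine ⟨A, hA, hA.hasKernel.congr ?_⟩
  have hne : ∑' i, ‖ket ((ketL ι (b i)).adjoint ψ) ((ketL ι (b i)).adjoint ψ)‖ₑ ≠ ⊤ := by
    have : Summable fun i => ‖ket ((ketL ι (b i)).adjoint ψ) ((ketL ι (b i)).adjoint ψ)‖₊ := by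
      rw [← NNReal.summable_coe]
      refine hs.congr fun i => ?_
      rw [coe_nnnorm, norm_ket]
    exact ENNReal.tsum_coe_ne_top_iff_summable.2 this
  filter_upwards [Lp.hasSum_coeFn_tsum hne,
    ae_all_iff.2 fun i => coeFn_ket ((ketL ι (b i)).adjoint ψ) ((ketL ι (b i)).adjoint ψ),
    ae_leftConf (κ := ι) (ae_all_iff.2 fun i => coeFn_adjoint_ketL ψ (b i)),
    ae_rightConf (ι := ι) (ae_all_iff.2 fun i => coeFn_adjoint_ketL ψ (b i)),
    ae_leftConf (κ := ι) (ae_coeFn_slice ψ), ae_rightConf (ι := ι) (ae_coeFn_slice ψ)]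
    with z h1 h2 h3 h4 h5 h6
  simp only [h2, h3, h4, inner_conj_symm] at h1
  refine (h1.unique (b.hasSum_inner_mul_inner _ _)).trans ?_
  rw [L2.inner_def]
  refine integral_congr_ae ?_
  filter_upwards [h5, h6] with y h7 h8
  rw [h7, h8, RCLike.inner_apply, Complex.conj_conj, mul_comm]

end Kernels

/-! ### The energy bound for limit points -/

section Marginal

variable {d N k : ℕ}

/-- Splitting `N` particles into the first `k` and the remaining ones. -/
def splitEquiv (hk : k ≤ N) : Fin N ≃ Fin k ⊕ Fin (N - k) :=
  (finCongr (by omega)).trans finSumFinEquiv.symm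

theorem splitEquiv_castLE (hk : k ≤ N) (i : Fin k) : splitEquiv hk (Fin.castLE hk i) = Sum.inl i := by
  rw [splitEquiv, Equiv.trans_apply, Equiv.symm_apply_eq]
  ext; simp

theorem reindex_glue (hk : k ≤ N) (x : Conf (Fin k) d) (y : Conf (Fin (N - k)) d) :
    reindex d (splitEquiv hk) (glue x y) = join N (by omega) x y := by
  rw [reindex_apply]
  unfold join
  congr 1
  funext i
  split_ifs with h
  · have : splitEquiv hk i = Sum.inl ⟨i, h⟩ := splitEquiv_castLE hk ⟨i, h⟩
    rw [this, glue_pos_inl]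
  · have : splitEquiv hk i = Sum.inr ⟨i - k, by omega⟩ := by
      rw [splitEquiv, Equiv.trans_apply, Equiv.symm_apply_eq]
      ext; simp; omega
    rw [this, glue_pos_inr]

/-- The marginal of `φ` is a sum of rank one operators `|w_i⟩⟨w_i|`, and the energy of `φ` in the
first `k` particles is the sum of the energies of the `w_i`. -/
theorem exists_hasKets_marginal_eq (hk : k ≤ N) (φ : L2 (Fin N) d) :
    ∃ (I : Type) (w : I → L2 (Fin k) d), HasKets (marginal k φ) w w ∧
      ∑' i, ‖w i‖ * ‖w i‖ = ‖φ‖ ^ 2 ∧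
      ∀ h, HasSum (fun i => ⟪w i, mult (fun ξ => (prodSym h id ξ : ℂ)) (w i)⟫_ℂ)
        ⟪φ, mult (fun ξ => (prodSym h (Fin.castLE hk) ξ : ℂ)) φ⟫_ℂ := by
  obtain ⟨I, b, hI⟩ := exists_countable_hilbertBasis (Fin (N - k)) d
  set ψ := isomComp (reindex d (splitEquiv hk)) φ with hψ
  obtain ⟨A, hA, hK⟩ := exists_hasKets_marginal b ψ
  have hmarg : marginal k φ = A := by
    rw [marginal, if_pos hk]
    refine (hK.congr ?_).eq_opOfKernel
    have h := Measure.ae_ae_of_ae_prod (ae_glue (coeFn_isomComp (reindex d (splitEquiv hk)) φ))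
    filter_upwards [ae_leftConf (κ := Fin k) h, ae_rightConf (ι := Fin k) h] with z h1 h2
    refine integral_congr_ae ?_
    filter_upwards [h1, h2] with y h3 h4
    rw [hψ, h3, h4, reindex_glue, reindex_glue]
    rfl
  refine ⟨I, _, hmarg ▸ hA, ?_, fun h => ?_⟩
  · have := (hasSum_norm_sq_adjoint_ketL b ψ).tsum_eq
    simp only [sq] at this ⊢
    rw [this, hψ, norm_isomComp]
  · have h1 := hasSum_inner_adjoint_ketL b ψ
      (mult (fun ξ => (prodSym h (Sum.inl : Fin k → Fin k ⊕ Fin (N - k)) ξ : ℂ)) ψ)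
    simp only [adjoint_ketL_mult] at h1
    have h2 := isomComp_mult (reindex d (splitEquiv hk)) (isSymbol_prodSym h (Fin.castLE hk)) φ
    have h3 : splitEquiv hk ∘ Fin.castLE hk = Sum.inl := funext fun i => splitEquiv_castLE hk i
    simp only [prodSym_reindex, h3] at h2
    rw [← inner_isomComp (reindex d (splitEquiv hk)), h2]
    exact h1

end Marginal

section Limit

variable {ι : Type} [Fintype ι] {d : ℕ} {I : Type}

/-- A square root of the product of the lattice operators. -/
theorem exists_sqrt_prodSym (h : ℝ) : ∃ C : Op ι d, (∀ x y, ⟪C x, y⟫_ℂ = ⟪x, C y⟫_ℂ) ∧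
    ∀ x, mult (fun ξ => (prodSym h id ξ : ℂ)) x = C (C x) := by
  obtain ⟨-, M, hM⟩ := isSymbol_prodSym (d := d) h (id : ι → ι)
  have hs : IsSymbol (fun ξ : Conf ι d => ((√(prodSym h id ξ) : ℝ) : ℂ)) :=
    isSymbol_ofReal (Real.continuous_sqrt.comp (continuous_finsetProd _ fun l _ =>
      continuous_latSym h l)) (C := √M) fun ξ => by
      rw [abs_of_nonneg (Real.sqrt_nonneg _)]
      refine Real.sqrt_le_sqrt ?_
      have := hM ξ
      rw [Complex.norm_real] at this
      exact (le_abs_self _).trans this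
  refine ⟨_, fun x y => inner_mult_real_left hs x y, fun x => ?_⟩
  rw [← mul_apply_eq_comp, ← mult_mul hs hs]
  congr 2
  ext ξ
  rw [Pi.mul_apply, ← Complex.ofReal_mul, Real.mul_self_sqrt (prodSym_pos h id ξ).le]

/-- The Cauchy-Schwarz inequality for the form of a product of lattice operators. -/
theorem norm_inner_prodSym_le (h : ℝ) (g w : L2 ι d) :
    ‖⟪mult (fun ξ => (prodSym h id ξ : ℂ)) g, w⟫_ℂ‖ ≤
      √(⟪g, mult (fun ξ => (prodSym h id ξ : ℂ)) g⟫_ℂ).re *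
        √(⟪w, mult (fun ξ => (prodSym h id ξ : ℂ)) w⟫_ℂ).re := by
  obtain ⟨C, hC, hCC⟩ := exists_sqrt_prodSym (ι := ι) (d := d) h
  have hn : ∀ x, √(⟪x, C (C x)⟫_ℂ).re = ‖C x‖ := fun x => by
    rw [← hC]
    exact (norm_eq_sqrt_re_inner (𝕜 := ℂ) (C x)).symm
  rw [hCC g, hCC w, hC, hn, hn]
  exact norm_inner_le_norm _ _

/-- If trace class operators `A m = ∑ |w_i⟩⟨w_i|` of energy at most `c` converge weakly* to `A₀`,
then the kernel `g` of `A₀` has energy at most `c²` in both arguments. Indeed, for the compact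
operator `K` with kernel `b g^* b` one has `Tr K A₀ = ⟨g, (b ⊗ b) g⟩`, while the Cauchy-Schwarz
inequality gives `|Tr K (A m)| ≤ ⟨g, (b ⊗ b) g⟩^{1/2} ∑ ⟨w_i, b w_i⟩`. -/
theorem inner_prodSym_limit_le {J : ℕ → Op ι d} (hJ : IsDenseInCompactBall J) {A : ℕ → Op ι d}
    {A₀ : Op ι d} {u v : I → L2 ι d} (h₀ : HasKets A₀ u v)
    (hlim : Tendsto (fun m => weakStarDist J (A m) A₀) atTop (𝓝 0)) (h : ℝ) {c : ℝ}
    (hA : ∀ ε > 0, ∀ᶠ m in atTop, ∃ (I : Type) (w : I → L2 ι d), HasKets (A m) w w ∧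
      ∑' i, ‖w i‖ * ‖w i‖ ≤ 1 ∧ ∃ s : ℂ,
        HasSum (fun i => ⟪w i, mult (fun ξ => (prodSym h id ξ : ℂ)) (w i)⟫_ℂ) s ∧ s.re ≤ c + ε) :
    (⟪∑' i, ket (v i) (u i), mult (fun ξ => (prodSym h id ξ : ℂ)) (∑' i, ket (v i) (u i))⟫_ℂ).re ≤
      c ^ 2 := by
  obtain ⟨g, hg⟩ : ∃ g : L2 (ι ⊕ ι) d, g = ∑' i, ket (v i) (u i) := ⟨_, rfl⟩
  obtain ⟨b, hb⟩ : ∃ b : Op ι d, b = mult (fun ξ => (prodSym h id ξ : ℂ)) := ⟨_, rfl⟩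
  obtain ⟨bb, hbb⟩ : ∃ bb : Op (ι ⊕ ι) d, bb = mult (fun ξ => (prodSym h id ξ : ℂ)) := ⟨_, rfl⟩
  have hket : ∀ x y : L2 ι d, bb (ket x y) = ket (b x) (b y) := fun x y => by
    rw [hb, hbb, mult_prodSym_ket]
  have hCS : ∀ w, ‖⟪bb g, w⟫_ℂ‖ ≤ √(⟪g, bb g⟫_ℂ).re * √(⟪w, bb w⟫_ℂ).re := fun w => by
    rw [hbb]; exact norm_inner_prodSym_le h g w
  have hpos : ∀ x, ∃ r : ℝ, 0 ≤ r ∧ ⟪x, b x⟫_ℂ = r := fun x => by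
    rw [hb, inner_mult_self (isSymbol_prodSym h id)]
    exact ⟨_, integral_nonneg fun ξ => mul_nonneg (prodSym_pos h id ξ).le (by positivity), rfl⟩
  have hgpos : 0 ≤ (⟪g, bb g⟫_ℂ).re := by
    rw [hbb, inner_mult_self (isSymbol_prodSym h id), Complex.ofReal_re]
    exact integral_nonneg fun ξ => mul_nonneg (prodSym_pos h id ξ).le (by positivity)
  have hbbsymm : ⟪bb g, g⟫_ℂ = ⟪g, bb g⟫_ℂ := by
    rw [hbb]; exact inner_mult_real_left (isSymbol_prodSym h id) g g
  rw [← hg, ← hbb]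
  rw [← hb] at hA
  have hsg := summable_ket h₀.1
  -- the compact operator with kernel `b g^* b`
  obtain ⟨K, hKc, hK⟩ : ∃ K : Op ι d, IsCompactOperator K ∧
      HasKets K (fun i => b (v i)) (fun i => b (u i)) := by
    refine exists_isCompactOperator_hasKets (Summable.of_nonneg_of_le (fun i => by positivity)
      (fun i => ?_) (h₀.1.mul_left (‖b‖ * ‖b‖)))
    calc ‖b (v i)‖ * ‖b (u i)‖ ≤ (‖b‖ * ‖v i‖) * (‖b‖ * ‖u i‖) := by
          gcongr <;> exact b.le_opNorm _
      _ = _ := by ring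
  have hKg : ∀ x y, ⟪y, K x⟫_ℂ = ⟪bb g, ket x y⟫_ℂ := by
    intro x y
    have h1 := (innerSL ℂ y).hasSum (hK.2 x)
    have h2 := ((innerSL ℂ (ket x y)) ∘L bb).hasSum hsg.hasSum
    rw [← hg] at h2
    have h3 := h2.star
    have e : ∀ i, star (((innerSL ℂ (ket x y)) ∘L bb) (ket (v i) (u i))) =
        (innerSL ℂ y) (⟪b (v i), x⟫_ℂ • b (u i)) := fun i => by
      rw [ContinuousLinearMap.comp_apply, hket, innerSL_apply_apply, innerSL_apply_apply,
        inner_smul_right]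
      refine (inner_conj_symm (ket (b (v i)) (b (u i))) (ket x y)).trans ?_
      rw [inner_ket_ket]
    simp only [e] at h3
    refine (h1.unique h3).trans ?_
    exact inner_conj_symm (bb g) (ket x y)
  have htr₀ : opTrace (K ∘L A₀) = ⟪g, bb g⟫_ℂ := by
    refine (h₀.hasSum_opTrace K).unique ?_
    simp only [hKg]
    rw [← hbbsymm]
    have := (innerSL ℂ (bb g)).hasSum hsg.hasSum
    rw [← hg] at this
    exact this
  set a := √(⟪g, bb g⟫_ℂ).re with ha
  have ha2 : a ^ 2 = (⟪g, bb g⟫_ℂ).re := Real.sq_sqrt hgpos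
  have hconv := tendsto_opTrace hJ (M := 1) ((hA 1 one_pos).mono fun m hm => by
    obtain ⟨I, w, h1, h2, -⟩ := hm
    exact ⟨I, w, w, h1, h2⟩) h₀ hlim hKc
  rw [htr₀] at hconv
  have hle : ∀ ε > 0, a ^ 2 ≤ a * (c + ε) := by
    intro ε hε
    rw [ha2]
    refine (Complex.re_le_norm _).trans (le_of_tendsto hconv.norm ?_)
    filter_upwards [hA ε hε] with m hm
    obtain ⟨I, w, h1, -, s, h2, h3⟩ := hm
    have h4 := h1.hasSum_opTrace K
    simp only [hKg] at h4
    have h5 : HasSum (fun i => a * (⟪w i, b (w i)⟫_ℂ).re) (a * s.re) :=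
      (Complex.hasSum_re h2).mul_left a
    rw [← h4.tsum_eq]
    refine (tsum_of_norm_bounded h5 fun i => ?_).trans
      (mul_le_mul_of_nonneg_left h3 (Real.sqrt_nonneg _))
    refine (hCS _).trans_eq ?_
    obtain ⟨r, hr, hr2⟩ := hpos (w i)
    have hr3 : ⟪b (w i), w i⟫_ℂ = r := by rw [← inner_conj_symm, hr2, Complex.conj_ofReal]
    rw [hket, inner_ket_ket, hr3, hr2, ← Complex.ofReal_mul, Complex.ofReal_re, Complex.ofReal_re,
      Real.sqrt_mul_self hr]
  rw [← ha2]
  have ha0 : 0 ≤ a := Real.sqrt_nonneg _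
  rcases ha0.eq_or_lt with h0 | h0
  · rw [← h0, sq, zero_mul]; exact sq_nonneg c
  · have : a ≤ c := le_of_forall_pos_le_add fun ε hε => by
      have := hle ε hε
      rw [sq] at this
      exact le_of_mul_le_mul_left this h0
    gcongr

/-- The Fourier weight `∏ (1 + |2πξ_l|²)`. -/
def energyWeight (ξ : Conf ι d) : ℝ := ∏ l, (1 + (2 * Real.pi * ‖ξ.pos l‖) ^ 2)

theorem energyWeight_pos (ξ : Conf ι d) : 0 < energyWeight ξ :=
  Finset.prod_pos fun l _ => by positivity

/-- The lattice energies converge pointwise to the true energy, so that Fatou's lemma transfers a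
bound that is uniform in the lattice spacing. -/
theorem lintegral_energyWeight_le (g : L2 ι d) {c : ℝ}
    (hg : ∀ h : ℝ, h ≠ 0 → (⟪g, mult (fun ξ => (prodSym h id ξ : ℂ)) g⟫_ℂ).re ≤ c) :
    ∫⁻ ξ, ENNReal.ofReal (energyWeight ξ) * ‖(𝓕 g : L2 ι d) ξ‖ₑ ^ 2 ≤ ENNReal.ofReal c := by
  have hlim : ∀ ξ : Conf ι d, Tendsto (fun n : ℕ => ENNReal.ofReal
      (prodSym (1 / ((n : ℝ) + 1)) id ξ * ‖(𝓕 g : L2 ι d) ξ‖ ^ 2)) atTop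
      (𝓝 (ENNReal.ofReal (energyWeight ξ) * ‖(𝓕 g : L2 ι d) ξ‖ₑ ^ 2)) := by
    intro ξ
    have e : ENNReal.ofReal (energyWeight ξ) * ‖(𝓕 g : L2 ι d) ξ‖ₑ ^ 2 =
        ENNReal.ofReal (energyWeight ξ * ‖(𝓕 g : L2 ι d) ξ‖ ^ 2) := by
      rw [ENNReal.ofReal_mul (energyWeight_pos ξ).le, ← ofReal_norm,
        ENNReal.ofReal_pow (norm_nonneg _)]
    rw [e]
    exact ENNReal.tendsto_ofReal ((tendsto_finsetProd _ fun l _ => tendsto_latSym l ξ).mul_const _)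
  have hmeas : ∀ n : ℕ, AEMeasurable (fun ξ : Conf ι d => ENNReal.ofReal
      (prodSym (1 / ((n : ℝ) + 1)) id ξ * ‖(𝓕 g : L2 ι d) ξ‖ ^ 2)) := fun n => by
    refine AEMeasurable.ennreal_ofReal (AEMeasurable.mul ?_
      ((Lp.aestronglyMeasurable _).norm.aemeasurable.pow_const 2))
    exact (continuous_finsetProd _ fun l _ => continuous_latSym _ l).aemeasurable
  calc _ = ∫⁻ ξ, liminf (fun n : ℕ => ENNReal.ofReal
        (prodSym (1 / ((n : ℝ) + 1)) id ξ * ‖(𝓕 g : L2 ι d) ξ‖ ^ 2)) atTop := by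
        refine lintegral_congr fun ξ => (hlim ξ).liminf_eq.symm
    _ ≤ liminf (fun n : ℕ => ∫⁻ ξ, ENNReal.ofReal
        (prodSym (1 / ((n : ℝ) + 1)) id ξ * ‖(𝓕 g : L2 ι d) ξ‖ ^ 2)) atTop :=
        lintegral_liminf_le' hmeas
    _ ≤ _ := by
        refine liminf_le_of_le (by isBoundedDefault) fun b hb => ?_
        obtain ⟨n, hn⟩ := hb.exists
        refine hn.trans ?_
        have hs := isSymbol_prodSym (d := d) (1 / ((n : ℝ) + 1)) (id : ι → ι)
        rw [← ofReal_integral_eq_lintegral_ofReal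
          (integrable_mul_norm_sq (by simpa using hs.memLp.re) _)
          (ae_of_all _ fun ξ => mul_nonneg (prodSym_pos _ id ξ).le (by positivity))]
        refine ENNReal.ofReal_le_ofReal ?_
        have := hg (1 / ((n : ℝ) + 1)) (by positivity)
        rwa [inner_mult_self hs, Complex.ofReal_re] at this

end Limit

/-- Every limit point of the marginals consists of operators whose kernel `g` satisfies
`∫ ∏ (1 + |2πξ_l|²) |ĝ(ξ)|² dξ ≤ (2/κ + 1)^{2k}`. -/
theorem exists_kernel_limitPoint {d p₀ : ℕ} {V : ∀ p : ℕ, Conf (Fin p) d → ℝ} {β : ℝ}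
    (hV : ∀ p, 1 ≤ p → p ≤ p₀ → IsAdmissiblePotential (V p)) {κ : ℝ} (hκ : 0 < κ) (hβ : 0 ≤ β)
    (hβ1 : (p₀ : ℝ) * d * β < 1) {χ : ℝ → ℝ} (hχ : Continuous χ) (hχ1 : ∀ s, 0 ≤ χ s ∧ χ s ≤ 1)
    (hχ2 : ∀ s, 2 ≤ s → χ s = 0) {ψ : ∀ N : ℕ, L2 (Fin N) d} (hψ : ∀ N, 1 ≤ N → IsBosonic (ψ N))
    {T : ℝ} {J : ∀ k : ℕ, ℕ → Op (Fin k) d} (hJ : ∀ k, 1 ≤ k → IsDenseInCompactBall (J k))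
    {Γ : ∀ k : ℕ, ℝ → Op (Fin k) d}
    (hΓ : IsLimitPoint J T (fun N k t => regularizedMarginal d p₀ V β χ κ N (ψ N) k t) Γ)
    {k : ℕ} (hk : 1 ≤ k) {t : ℝ} (ht : t ∈ Icc 0 T) :
    ∃ g : L2 (Fin k ⊕ Fin k) d, HasKernel (Γ k t) g ∧
      ∫⁻ ξ, ENNReal.ofReal (energyWeight ξ) * ‖(𝓕 g : L2 (Fin k ⊕ Fin k) d) ξ‖ₑ ^ 2 ≤
        ENNReal.ofReal (((2 / κ + 1) ^ k) ^ 2) := by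
  obtain ⟨hpath, n, hn, hconv⟩ := hΓ
  obtain ⟨u, v, hsum, hA⟩ := (hpath k hk).1 t ht
  have h₀ : HasKets (Γ k t) u v := ⟨hsum, hA⟩
  refine ⟨_, h₀.hasKernel, lintegral_energyWeight_le _ fun h hh => ?_⟩
  have hlim : Tendsto (fun m => weakStarDist (J k)
      (regularizedMarginal d p₀ V β χ κ (n m) (ψ (n m)) k t) (Γ k t)) atTop (𝓝 0) := by
    have h1 : Tendsto (fun m => ENNReal.ofReal (weakStarDist (J k)
        (regularizedMarginal d p₀ V β χ κ (n m) (ψ (n m)) k t) (Γ k t))) atTop (𝓝 0) :=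
      tendsto_of_tendsto_of_tendsto_of_le_of_le tendsto_const_nhds (hconv k hk)
        (fun _ => zero_le) fun m => le_iSup₂ (f := fun t _ => ENNReal.ofReal (weakStarDist (J k)
        (regularizedMarginal d p₀ V β χ κ (n m) (ψ (n m)) k t) (Γ k t))) t ht
    have h2 := (ENNReal.tendsto_toReal ENNReal.zero_ne_top).comp h1
    refine h2.congr fun m => ENNReal.toReal_ofReal (tsum_nonneg fun i => by positivity)
  refine inner_prodSym_limit_le (hJ k hk) h₀ hlim h fun ε hε => ?_
  have hev := hn.tendsto_atTop.eventually ((eventually_inner_prodSym_le hV hκ hβ hβ1 k hh hε).and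
    ((eventually_ge_atTop k).and (eventually_ge_atTop 1)))
  filter_upwards [hev] with m hm
  obtain ⟨h1, hkN, hN⟩ := hm
  obtain ⟨φ, hφ⟩ : ∃ φ, φ = evolution (hamiltonianGraph d p₀ V β (n m)) t
    (regularize (hamiltonianGraph d p₀ V β (n m)) χ κ (n m) (ψ (n m))) := ⟨_, rfl⟩
  have hnorm := (norm_evolution_regularize_le hV hκ hN hχ hχ1 hχ2 t (hψ _ hN) hφ).1
  obtain ⟨I, w, h2, h3, h4⟩ := exists_hasKets_marginal_eq hkN φ
  refine ⟨I, w, ?_, ?_, _, h4 h, ?_⟩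
  · rw [regularizedMarginal, ← hφ]; exact h2
  · rw [h3]; exact pow_le_one₀ (norm_nonneg _) hnorm
  · exact h1 χ hχ hχ1 hχ2 t _ φ (hψ _ hN) hφ _ (Fin.castLE_injective hkN)

/-! ### Integrals of products over the particles -/

section ProductIntegral

variable {d : ℕ}

/-- A configuration of one particle is a point of `ℝ^d`. -/
def unitIsom (d : ℕ) : Conf Unit d ≃ₗᵢ[ℝ] EuclideanSpace ℝ (Fin d) where
  toFun y := y.pos ()
  invFun q := Conf.mk fun _ => q
  left_inv y := by ext ⟨i, a⟩; simp
  right_inv q := by ext a; simp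
  map_add' y y' := by ext a; simp
  map_smul' c y := by ext a; simp
  norm_map' y := by
    change ‖y.pos ()‖ = ‖y‖
    refine (sq_eq_sq₀ (norm_nonneg _) (norm_nonneg _)).1 ?_
    rw [norm_conf_sq]; simp

theorem measurable_pos {κ : Type} [Fintype κ] (l : κ) :
    Measurable (fun η : Conf κ d => η.pos l) := by
  have : Continuous (fun η : Conf κ d => η.pos l) :=
    (PiLp.continuous_toLp 2 _).comp (by fun_prop)
  exact this.measurable

/-- Tonelli's theorem for a function of product form, by induction on the set of labels. -/
theorem lintegral_prod_pos {f : EuclideanSpace ℝ (Fin d) → ℝ≥0∞} (hf : Measurable f) (κ : Type)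
    [Fintype κ] : ∫⁻ η : Conf κ d, ∏ l, f (η.pos l) = (∫⁻ q, f q) ^ Fintype.card κ := by
  suffices h : ∀ P : Type → Prop, (∀ κ : Type, P κ ↔ ∀ _ : Fintype κ,
      ∫⁻ η : Conf κ d, ∏ l, f (η.pos l) = (∫⁻ q, f q) ^ Fintype.card κ) → P κ from
    (h _ fun κ => Iff.rfl) inferInstance
  intro P hP
  refine Finite.induction_empty_option (P := P) ?_ ?_ ?_ κ
  · intro α β e
    rw [hP, hP]
    intro ih _
    have : Fintype α := Fintype.ofEquiv β e.symm
    rw [← Fintype.card_congr e, ← ih this,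
      ← (reindex d e).measurePreserving.lintegral_comp_emb
        (reindex d e).toMeasurableEquiv.measurableEmbedding]
    refine lintegral_congr fun η => ?_
    rw [← e.prod_comp]
    simp [reindex_apply]
  · rw [hP]
    intro _
    have : (volume : Measure (Conf PEmpty d)) Set.univ = 1 := by
      have h := (EuclideanSpace.volume_preserving_symm_measurableEquiv_toLp (PEmpty × Fin d)).map_eq
      have h2 := congrArg (fun μ => μ Set.univ) h
      simp only [MeasurableEquiv.map_apply, preimage_univ] at h2
      rw [h2, volume_pi, Measure.pi_univ]
      simp
    simp [this]
  · intro α _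
    rw [hP, hP]
    intro ih _
    have e : Option α ≃ α ⊕ Unit := Equiv.optionEquivSumPUnit α
    rw [← (reindex d e).measurePreserving.lintegral_comp_emb
        (reindex d e).toMeasurableEquiv.measurableEmbedding,
      ← measurePreserving_glueEquiv.lintegral_comp_emb (glueEquiv α Unit d).measurableEmbedding,
      Fintype.card_congr e, Fintype.card_sum, Fintype.card_unit, pow_succ, ← ih inferInstance,
      ← (unitIsom d).measurePreserving.lintegral_comp_emb
        (unitIsom d).toMeasurableEquiv.measurableEmbedding,
      ← lintegral_prod_mul ?_ ?_]
    · refine lintegral_congr fun p => ?_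
      rw [← e.symm.prod_comp, Fintype.prod_sum_type]
      simp only [reindex_apply, Conf.pos_mk, Equiv.apply_symm_apply, glueEquiv_apply, glue_pos_inl,
        glue_pos_inr, Finset.univ_unique, Finset.prod_singleton]
      rfl
    · exact (Finset.measurable_prod _ fun l _ => hf.comp (measurable_pos l)).aemeasurable
    · exact (hf.comp (unitIsom d).continuous.measurable).aemeasurable

/-- A linear involution has determinant `±1`. -/
theorem measurePreserving_of_involutive {E : Type} [NormedAddCommGroup E] [InnerProductSpace ℝ E]
    [FiniteDimensional ℝ E] [MeasurableSpace E] [BorelSpace E] {L : E →ₗ[ℝ] E}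
    (hL : ∀ x, L (L x) = x) : MeasurePreserving L volume volume := by
  have hcont : Continuous L := L.continuous_of_finiteDimensional
  have hLL : L ∘ₗ L = LinearMap.id := LinearMap.ext hL
  have hdet : LinearMap.det L * LinearMap.det L = 1 := by
    rw [← LinearMap.det_comp, hLL, LinearMap.det_id]
  have hne : LinearMap.det L ≠ 0 := fun h => by simp [h] at hdet
  have habs : |(LinearMap.det L)⁻¹| = 1 := by
    rcases mul_self_eq_one_iff.1 hdet with h | h <;> rw [h] <;> norm_num
  refine ⟨hcont.measurable, ?_⟩
  rw [Measure.map_linearMap_addHaar_eq_smul_addHaar volume hne, habs]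
  simp

end ProductIntegral

/-! ### The weight estimate for the contraction -/

section Weight

variable {d : ℕ}

/-- The symbol `1 + |2πq|²` of `1 - Δ`. -/
def jap (q : EuclideanSpace ℝ (Fin d)) : ℝ := 1 + (2 * Real.pi * ‖q‖) ^ 2

theorem one_le_jap (q : EuclideanSpace ℝ (Fin d)) : 1 ≤ jap q := by
  unfold jap; nlinarith [sq_nonneg (2 * Real.pi * ‖q‖)]

theorem jap_pos (q : EuclideanSpace ℝ (Fin d)) : 0 < jap q := zero_lt_one.trans_le (one_le_jap q)

theorem continuous_jap : Continuous (jap : EuclideanSpace ℝ (Fin d) → ℝ) := by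
  unfold jap; fun_prop

theorem measurable_jap_rpow (s : ℝ) :
    Measurable (fun q : EuclideanSpace ℝ (Fin d) => ENNReal.ofReal (jap q ^ s)) :=
  ((continuous_jap.rpow_const fun q => Or.inl (jap_pos q).ne').measurable).ennreal_ofReal

/-- The weight `(1 + |2πq|²)^{-s}` is integrable on `ℝ^d` for `2s > d`. -/
theorem lintegral_jap_rpow_lt_top {s : ℝ} (hs : (d : ℝ) < 2 * s) :
    ∫⁻ q : EuclideanSpace ℝ (Fin d), ENNReal.ofReal (jap q ^ (-s)) < ⊤ := by
  have h := integrable_rpow_neg_one_add_norm_sq (E := EuclideanSpace ℝ (Fin d)) (μ := volume)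
    (r := 2 * s) (by simpa using hs)
  refine lt_of_le_of_lt (lintegral_mono fun q => ENNReal.ofReal_le_ofReal ?_) h.lintegral_lt_top
  have e : -(2 * s) / 2 = -s := by ring
  have hs0 : 0 ≤ s := by linarith [Nat.cast_nonneg (α := ℝ) d]
  rw [e]
  refine Real.rpow_le_rpow_of_nonpos (by positivity) ?_ (by linarith)
  unfold jap
  have h1 : 1 ≤ 2 * Real.pi := by linarith [Real.pi_gt_three]
  have h2 : ‖q‖ ≤ 2 * Real.pi * ‖q‖ := le_mul_of_one_le_left (norm_nonneg _) h1
  gcongr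

/-- The largest of several numbers `x_i ≥ 1` can be spread over the other ones. -/
theorem rpow_mul_prod_inv_le {O : Type} [Fintype O] [DecidableEq O] {n : ℕ} (hn : 1 ≤ n)
    (hO : Fintype.card O = n + 1) {x : O → ℝ} (hx : ∀ i, 1 ≤ x i) {i₀ : O} (hi₀ : ∀ i, x i ≤ x i₀)
    {a : ℝ} (ha : a ≤ 1) :
    x i₀ ^ a * (∏ i, x i)⁻¹ ≤ ∏ i ∈ Finset.univ.erase i₀, x i ^ (-(1 + (1 - a) / n)) := by
  have hx0 : ∀ i, 0 < x i := fun i => zero_lt_one.trans_le (hx i)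
  have hn0 : (0 : ℝ) < n := by exact_mod_cast hn
  rw [← Finset.mul_prod_erase Finset.univ x (Finset.mem_univ i₀), mul_inv, ← mul_assoc]
  have e1 : x i₀ ^ a * (x i₀)⁻¹ = ∏ _i ∈ Finset.univ.erase i₀, x i₀ ^ (-((1 - a) / n)) := by
    rw [Finset.prod_const, Finset.card_erase_of_mem (Finset.mem_univ _), Finset.card_univ, hO,
      Nat.add_sub_cancel, ← Real.rpow_natCast, ← Real.rpow_mul (hx0 i₀).le, ← Real.rpow_neg_one,
      ← Real.rpow_add (hx0 i₀)]
    congr 1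
    field_simp
    ring
  rw [e1, ← Finset.prod_inv_distrib, ← Finset.prod_mul_distrib]
  refine Finset.prod_le_prod (fun i _ => by have := hx0 i; have := hx0 i₀; positivity) fun i _ => ?_
  rw [neg_add, Real.rpow_add (hx0 i), Real.rpow_neg_one, mul_comm]
  refine mul_le_mul_of_nonneg_left ?_ (inv_nonneg.2 (hx0 i).le)
  exact Real.rpow_le_rpow_of_nonpos (hx0 i) (hi₀ i)
    (neg_nonpos.2 (div_nonneg (sub_nonneg.2 ha) hn0.le))

/-- If `v₀ + ⋯ + v_n = q`, the weight of `q` is controlled by that of the largest `v_i`; what is left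
of it after compensating the factor `jap q ^ a` is spread over the `n` other vectors. -/
theorem jap_rpow_mul_prod_inv_le {O : Type} [Fintype O] [DecidableEq O] {n : ℕ} (hn : 1 ≤ n)
    (hO : Fintype.card O = n + 1) (v : O → EuclideanSpace ℝ (Fin d)) {a : ℝ} (ha0 : 0 ≤ a)
    (ha : a ≤ 1) :
    jap (∑ i, v i) ^ a * (∏ i, jap (v i))⁻¹ ≤
      ((n : ℝ) + 1) ^ 2 * ∑ i₀, ∏ i ∈ Finset.univ.erase i₀, jap (v i) ^ (-(1 + (1 - a) / n)) := by
  have : Nonempty O := Fintype.card_pos_iff.1 (by omega)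
  obtain ⟨i₀, hi₀⟩ := Finite.exists_max fun i => ‖v i‖
  have hmono : ∀ i, jap (v i) ≤ jap (v i₀) := fun i => by
    unfold jap; have := hi₀ i; gcongr
  have hsum : jap (∑ i, v i) ≤ ((n : ℝ) + 1) ^ 2 * jap (v i₀) := by
    have h1 : ‖∑ i, v i‖ ≤ ((n : ℝ) + 1) * ‖v i₀‖ :=
      (norm_sum_le_of_le _ fun i _ => hi₀ i).trans_eq (by simp [hO])
    have h2 : (2 * Real.pi * ‖∑ i, v i‖) ^ 2 ≤ (2 * Real.pi * (((n : ℝ) + 1) * ‖v i₀‖)) ^ 2 := by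
      gcongr
    have h3 : (1 : ℝ) ≤ ((n : ℝ) + 1) ^ 2 := one_le_pow₀ (by linarith [Nat.cast_nonneg (α := ℝ) n])
    unfold jap
    nlinarith
  have h4 : jap (∑ i, v i) ^ a ≤ ((n : ℝ) + 1) ^ 2 * jap (v i₀) ^ a := by
    refine (Real.rpow_le_rpow (jap_pos _).le hsum ha0).trans ?_
    rw [Real.mul_rpow (by positivity) (jap_pos _).le]
    refine mul_le_mul_of_nonneg_right ?_ (Real.rpow_nonneg (jap_pos _).le _)
    exact (Real.rpow_le_rpow_of_exponent_le
      (one_le_pow₀ (by linarith [Nat.cast_nonneg (α := ℝ) n])) ha).trans_eq (Real.rpow_one _)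
  have hprod : 0 ≤ (∏ i, jap (v i))⁻¹ := inv_nonneg.2 (Finset.prod_nonneg fun i _ => (jap_pos _).le)
  refine (mul_le_mul_of_nonneg_right h4 hprod).trans ?_
  rw [mul_assoc]
  refine mul_le_mul_of_nonneg_left ?_ (by positivity)
  refine (rpow_mul_prod_inv_le hn hO (fun i => one_le_jap (v i)) hmono ha).trans ?_
  exact Finset.single_le_sum
    (f := fun i₀ => ∏ i ∈ Finset.univ.erase i₀, jap (v i) ^ (-(1 + (1 - a) / n)))
    (fun i₀ _ => Finset.prod_nonneg fun i _ => Real.rpow_nonneg (jap_pos _).le _)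
    (Finset.mem_univ i₀)

variable {κ : Type} [Fintype κ]

open Classical in
/-- The linear involution that replaces `η_l` by `-∑ η`. -/
def reflectSum (l : κ) : Conf κ d →ₗ[ℝ] Conf κ d where
  toFun η := Conf.mk (Function.update η.pos l (-∑ i, η.pos i))
  map_add' η η' := by
    ext ⟨i, a⟩
    by_cases h : i = l
    · subst h; simp [Finset.sum_add_distrib]; ring
    · simp [h]
  map_smul' c η := by
    ext ⟨i, a⟩
    by_cases h : i = l
    · subst h; simp [Finset.mul_sum]
    · simp [h]

open Classical in
theorem reflectSum_pos (l : κ) (η : Conf κ d) (i : κ) :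
    (reflectSum l η).pos i = if i = l then -∑ i, η.pos i else η.pos i := by
  ext a
  by_cases h : i = l
  · subst h; simp [reflectSum]
  · simp [reflectSum, h]

theorem reflectSum_reflectSum (l : κ) (η : Conf κ d) : reflectSum l (reflectSum l η) = η := by
  classical
  have hsum : ∑ i, (reflectSum l η).pos i = -η.pos l := by
    have herase : ∑ i ∈ Finset.univ.erase l, (reflectSum l η).pos i =
        ∑ i ∈ Finset.univ.erase l, η.pos i := Finset.sum_congr rfl fun i hi => by
      rw [reflectSum_pos, if_neg (Finset.ne_of_mem_erase hi)]
    rw [← Finset.add_sum_erase _ _ (Finset.mem_univ l), reflectSum_pos, if_pos rfl, herase, ← Finset.add_sum_erase _ (fun i => η.pos i) (Finset.mem_univ l)]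
    abel
  have h : ∀ i, (reflectSum l (reflectSum l η)).pos i = η.pos i := fun i => by
    rw [reflectSum_pos, hsum, neg_neg]
    split_ifs with hi
    · rw [hi]
    · rw [reflectSum_pos, if_neg hi]
  ext ⟨i, a⟩
  have := congrArg (fun q => q a) (h i)
  simpa using this

/-- The integral over all momenta with total momentum `q` of the product of the weights `jap⁻¹` is
`O(jap q ^ (-α))`. This is where `α ≤ 1` (`d = 1`) or `α < 1` (`d = 2`) enters: at least one
momentum is comparable with `q`, and the integrals over the other ones converge. -/
theorem exists_weight_bound (κ : Type) [Fintype κ] [Nonempty κ] (hd : d = 1 ∨ d = 2) {α : ℝ}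
    (hα : (d = 1 → α ≤ 1) ∧ (d = 2 → α < 1)) :
    ∃ c : ℝ, 0 ≤ c ∧ ∀ q : EuclideanSpace ℝ (Fin d), ∫⁻ η : Conf κ d, ENNReal.ofReal
      (jap q ^ α * (jap (q - ∑ l, η.pos l) * ∏ l, jap (η.pos l))⁻¹) ≤ ENNReal.ofReal c := by
  classical
  set n := Fintype.card κ with hn
  have hn1 : 1 ≤ n := Fintype.card_pos
  have hn0 : (0 : ℝ) < n := by exact_mod_cast hn1
  set a := max α 0 with ha
  have ha0 : 0 ≤ a := le_max_right _ _
  have ha1 : a ≤ 1 := by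
    rcases hd with h | h
    · exact max_le (hα.1 h) zero_le_one
    · exact max_le (hα.2 h).le zero_le_one
  -- negative exponents follow from the exponent `0`, as `jap ≥ 1`
  set s := 1 + (1 - a) / n with hs
  have hs1 : 1 ≤ s := le_add_of_nonneg_right (div_nonneg (sub_nonneg.2 ha1) hn0.le)
  have hsd : (d : ℝ) < 2 * s := by
    rcases hd with h | h
    · rw [h, Nat.cast_one]; linarith
    · have : 0 < (1 - a) / n := div_pos (sub_pos.2 (max_lt (hα.2 h) zero_lt_one)) hn0
      rw [h, Nat.cast_two]; linarith
  set f : EuclideanSpace ℝ (Fin d) → ℝ≥0∞ := fun q => ENNReal.ofReal (jap q ^ (-s)) with hf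
  have hfm : Measurable f := measurable_jap_rpow _
  have hI : (∫⁻ q, f q) ^ n < ⊤ := ENNReal.pow_lt_top (lintegral_jap_rpow_lt_top hsd)
  set M : ℝ≥0∞ := ENNReal.ofReal (((n : ℝ) + 1) ^ 2) * (((n + 1 : ℕ) : ℝ≥0∞) * (∫⁻ q, f q) ^ n)
    with hM
  have hMtop : M ≠ ⊤ := ENNReal.mul_ne_top ENNReal.ofReal_ne_top
    (ENNReal.mul_ne_top (ENNReal.natCast_ne_top _) hI.ne)
  refine ⟨M.toReal, ENNReal.toReal_nonneg, fun q => ?_⟩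
  rw [ENNReal.ofReal_toReal hMtop]
  set v : Conf κ d → Option κ → EuclideanSpace ℝ (Fin d) :=
    fun η i => i.elim (q - ∑ l, η.pos l) η.pos with hv
  have hvsum : ∀ η, ∑ i, v η i = q := fun η => by simp [hv, Fintype.sum_option]
  have hpt : ∀ η : Conf κ d, ENNReal.ofReal
      (jap q ^ α * (jap (q - ∑ l, η.pos l) * ∏ l, jap (η.pos l))⁻¹) ≤
      ENNReal.ofReal (((n : ℝ) + 1) ^ 2) * ∑ i₀, ∏ i ∈ Finset.univ.erase i₀, f (v η i) := by
    intro η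
    have h1 := jap_rpow_mul_prod_inv_le hn1 (by rw [Fintype.card_option]) (v η) ha0 ha1
    rw [hvsum, Fintype.prod_option] at h1
    have h2 : jap q ^ α ≤ jap q ^ a :=
      Real.rpow_le_rpow_of_exponent_le (one_le_jap q) (le_max_left _ _)
    have hn2 : ∀ i₀, 0 ≤ ∏ i ∈ Finset.univ.erase i₀, jap (v η i) ^ (-s) := fun i₀ =>
      Finset.prod_nonneg fun i _ => Real.rpow_nonneg (jap_pos _).le _
    have h3 : ∑ i₀, ∏ i ∈ Finset.univ.erase i₀, f (v η i) =
        ENNReal.ofReal (∑ i₀, ∏ i ∈ Finset.univ.erase i₀, jap (v η i) ^ (-s)) := by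
      rw [ENNReal.ofReal_sum_of_nonneg fun i₀ _ => hn2 i₀]
      refine Finset.sum_congr rfl fun i₀ _ => ?_
      rw [ENNReal.ofReal_prod_of_nonneg fun i _ => Real.rpow_nonneg (jap_pos _).le _]
    rw [h3, ← ENNReal.ofReal_mul (by positivity)]
    refine ENNReal.ofReal_le_ofReal (le_trans ?_ h1)
    refine mul_le_mul_of_nonneg_right h2 (inv_nonneg.2 ?_)
    exact mul_nonneg (jap_pos _).le (Finset.prod_nonneg fun l _ => (jap_pos _).le)
  have hint : ∀ i₀, ∫⁻ η, ∏ i ∈ Finset.univ.erase i₀, f (v η i) = (∫⁻ q, f q) ^ n := by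
    intro i₀
    rw [hn, ← lintegral_prod_pos hfm κ]
    rcases i₀ with _ | l
    · refine lintegral_congr fun η => ?_
      have e : (Finset.univ.erase (none : Option κ)) = Finset.univ.map Function.Embedding.some := by
        ext i; cases i <;> simp
      rw [e, Finset.prod_map]
      rfl
    · -- the affine involution `η_l ↦ q - ∑ η` turns this term into the first one
      have hmp := (measurePreserving_add_right (volume : Measure (Conf κ d))
        (Conf.mk (Function.update 0 l q))).comp
        (measurePreserving_of_involutive (reflectSum_reflectSum (d := d) l))
      rw [← hmp.lintegral_comp (f := fun η : Conf κ d => ∏ l, f (η.pos l))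
        (Finset.measurable_prod _ fun l _ => hfm.comp (measurable_pos l))]
      refine lintegral_congr fun η => ?_
      have e1 : (reflectSum l η + Conf.mk (Function.update 0 l q)).pos l = q - ∑ i, η.pos i := by
        have : (reflectSum l η).pos l = -∑ i, η.pos i := by rw [reflectSum_pos, if_pos rfl]
        ext a
        have h2 := congrArg (fun q => q a) this
        simp only [Conf.pos_apply] at h2
        simp only [Conf.pos_apply, PiLp.add_apply, h2]
        simp
        ring
      have e2 : ∀ i ≠ l, (reflectSum l η + Conf.mk (Function.update 0 l q)).pos i = η.pos i := by
        intro i hi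
        have : (reflectSum l η).pos i = η.pos i := by rw [reflectSum_pos, if_neg hi]
        ext a
        have h2 := congrArg (fun q => q a) this
        simp only [Conf.pos_apply] at h2
        simp only [Conf.pos_apply, PiLp.add_apply, h2]
        simp [hi]
      have e3 : (Finset.univ.erase (some l) : Finset (Option κ)) =
          insert none ((Finset.univ.erase l).map Function.Embedding.some) := by
        ext i; cases i <;> simp
      simp only [Function.comp]
      rw [e3, Finset.prod_insert (by simp), Finset.prod_map,
        ← Finset.mul_prod_erase Finset.univ _ (Finset.mem_univ l), e1]
      congr 1
      refine Finset.prod_congr rfl fun i hi => ?_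
      rw [e2 i (Finset.ne_of_mem_erase hi)]
      rfl
  have hvm : ∀ i, Measurable fun η => f (v η i) := by
    intro i
    refine hfm.comp ?_
    rcases i with _ | l
    · exact measurable_const.sub (Finset.measurable_sum _ fun l _ => measurable_pos l)
    · exact measurable_pos l
  refine (lintegral_mono hpt).trans ?_
  rw [lintegral_const_mul' _ _ ENNReal.ofReal_ne_top, lintegral_finsetSum' _ fun i₀ _ =>
    (Finset.measurable_prod _ fun i _ => hvm i).aemeasurable]
  simp only [hint, Finset.sum_const, Finset.card_univ, Fintype.card_option, nsmul_eq_mul, hM, ← hn]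
  exact le_rfl

end Weight

/-! ### The contraction in Fourier space -/

section Shear

variable {ι κ : Type} [Fintype ι] [Fintype κ] {d : ℕ}

open Classical in
/-- The momentum `∑ η` placed at the particle `j`. It is the adjoint of `diagAt`. -/
def sumAt (κ : Type) [Fintype κ] (d : ℕ) (j : ι) : Conf κ d →ₗ[ℝ] Conf ι d where
  toFun η := Conf.mk fun i => if i = j then ∑ l, η.pos l else 0
  map_add' η η' := by
    ext ⟨i, a⟩
    by_cases h : i = j <;> simp [h, Finset.sum_add_distrib]
  map_smul' c η := by
    ext ⟨i, a⟩
    by_cases h : i = j <;> simp [h, Finset.mul_sum]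

/-- The configuration in which every particle sits at the position `z_j`. -/
def diagAt (κ : Type) (d : ℕ) (j : ι) : Conf ι d →ₗ[ℝ] Conf κ d where
  toFun z := Conf.mk fun _ => z.pos j
  map_add' z z' := by ext ⟨i, a⟩; simp
  map_smul' c z := by ext ⟨i, a⟩; simp

open Classical in
theorem sumAt_pos (j : ι) (η : Conf κ d) (i : ι) :
    (sumAt κ d j η).pos i = if i = j then ∑ l, η.pos l else 0 := by
  ext a
  by_cases h : i = j <;> simp [h, sumAt]

theorem continuous_sumAt (j : ι) : Continuous (sumAt κ d j) :=
  (sumAt κ d j).continuous_of_finiteDimensional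

theorem continuous_diagAt (j : ι) : Continuous (diagAt κ d j) :=
  (diagAt κ d j).continuous_of_finiteDimensional

theorem inner_diagAt (j : ι) (z : Conf ι d) (η : Conf κ d) :
    ⟪diagAt κ d j z, η⟫_ℝ = ⟪z, sumAt κ d j η⟫_ℝ := by
  classical
  simp only [PiLp.inner_apply, diagAt, sumAt, LinearMap.coe_mk, AddHom.coe_mk, Conf.mk_apply,
    Fintype.sum_prod_type]
  rw [Finset.sum_eq_single j (fun i _ hi => by simp [hi]) (by simp), Finset.sum_comm]
  refine Finset.sum_congr rfl fun a _ => ?_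
  simp [Finset.sum_mul]

/-- The shear `(ξ, η) ↦ (ξ - ∑ η at j, η)`. -/
theorem measurePreserving_shear (j : ι) :
    MeasurePreserving (fun p : Conf ι d × Conf κ d => (p.1 - sumAt κ d j p.2, p.2))
      (volume.prod volume) (volume.prod volume) := by
  have h : MeasurePreserving (fun q : Conf κ d × Conf ι d => (q.1, q.2 - sumAt κ d j q.1))
      (volume.prod volume) (volume.prod volume) := by
    refine MeasurePreserving.skew_product (f := id) (MeasurePreserving.id _)
      (g := fun η ξ => ξ - sumAt κ d j η) ?_ (ae_of_all _ fun η => ?_)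
    · exact (continuous_snd.sub ((continuous_sumAt j).comp continuous_fst)).measurable
    · exact (measurePreserving_sub_right volume (sumAt κ d j η)).map_eq
  exact (Measure.measurePreserving_swap.comp h).comp Measure.measurePreserving_swap

theorem measurePreserving_glue_shear (j : ι) :
    MeasurePreserving (fun p : Conf ι d × Conf κ d => glue (p.1 - sumAt κ d j p.2) p.2)
      (volume.prod volume) volume :=
  measurePreserving_glueEquiv.comp (measurePreserving_shear j)

end Shear

section WeightedBound

variable {ι κ : Type} [Fintype ι] [Fintype κ] {d : ℕ}

/-- The Fourier symbol `∏_l (1 + |2πξ_l|²)^s`. -/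
def japWeight (s : ℝ) (ξ : Conf ι d) : ℝ := ∏ l, jap (ξ.pos l) ^ s

theorem japWeight_pos (s : ℝ) (ξ : Conf ι d) : 0 < japWeight s ξ :=
  Finset.prod_pos fun _ _ => Real.rpow_pos_of_pos (jap_pos _) _

theorem measurable_japWeight (s : ℝ) : Measurable (japWeight s : Conf ι d → ℝ) :=
  Finset.measurable_prod _ fun l _ =>
    ((continuous_jap.rpow_const fun q => Or.inl (jap_pos q).ne').measurable).comp (measurable_pos l)

theorem measurable_energyWeight : Measurable (energyWeight : Conf ι d → ℝ) :=
  Finset.measurable_prod _ fun l _ => continuous_jap.measurable.comp (measurable_pos l)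

/-- The energy of the sheared momenta: the momenta of the particles other than `j` are unchanged. -/
theorem energyWeight_glue_shear (j : ι) (ξ : Conf ι d) (η : Conf κ d) [DecidableEq ι] :
    energyWeight (glue (ξ - sumAt κ d j η) η) =
      (∏ i ∈ Finset.univ.erase j, jap (ξ.pos i)) *
        (jap (ξ.pos j - ∑ l, η.pos l) * ∏ l, jap (η.pos l)) := by
  have hpos : ∀ i, (ξ - sumAt κ d j η).pos i = ξ.pos i - (sumAt κ d j η).pos i := fun i => by
    ext a; simp
  have h : energyWeight (glue (ξ - sumAt κ d j η) η) =
      ∏ l, jap ((glue (ξ - sumAt κ d j η) η).pos l) := rfl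
  rw [h, Fintype.prod_sum_type, ← Finset.mul_prod_erase Finset.univ _ (Finset.mem_univ j)]
  simp only [glue_pos_inl, glue_pos_inr]
  have h2 : ∏ i ∈ Finset.univ.erase j, jap ((ξ - sumAt κ d j η).pos i) =
      ∏ i ∈ Finset.univ.erase j, jap (ξ.pos i) := Finset.prod_congr rfl fun i hi => by
    rw [hpos, sumAt_pos, if_neg (Finset.ne_of_mem_erase hi), sub_zero]
  rw [h2, hpos, sumAt_pos, if_pos rfl]
  ring

/-- The weight estimate `exists_weight_bound` for the momentum of the particle `j`; the other particles
contribute `jap ^ (α - 1) ≤ 1`. -/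
theorem lintegral_japWeight_mul_inv_le {α : ℝ} (hα : α ≤ 1) {c : ℝ}
    (hc : ∀ q : EuclideanSpace ℝ (Fin d), ∫⁻ η : Conf κ d, ENNReal.ofReal
      (jap q ^ α * (jap (q - ∑ l, η.pos l) * ∏ l, jap (η.pos l))⁻¹) ≤ ENNReal.ofReal c)
    (j : ι) (ξ : Conf ι d) :
    ENNReal.ofReal (japWeight α ξ) *
      ∫⁻ η : Conf κ d, ENNReal.ofReal (energyWeight (glue (ξ - sumAt κ d j η) η))⁻¹ ≤
      ENNReal.ofReal c := by
  classical
  rw [← lintegral_const_mul' _ _ ENNReal.ofReal_ne_top]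
  refine (lintegral_mono fun η => ?_).trans (hc (ξ.pos j))
  rw [← ENNReal.ofReal_mul (japWeight_pos _ _).le]
  refine ENNReal.ofReal_le_ofReal ?_
  have hP : 0 < ∏ i ∈ Finset.univ.erase j, jap (ξ.pos i) := Finset.prod_pos fun i _ => jap_pos _
  have hQ : 0 < jap (ξ.pos j - ∑ l, η.pos l) * ∏ l, jap (η.pos l) :=
    mul_pos (jap_pos _) (Finset.prod_pos fun i _ => jap_pos _)
  rw [energyWeight_glue_shear, japWeight,
    ← Finset.mul_prod_erase Finset.univ _ (Finset.mem_univ j), mul_inv, mul_mul_mul_comm]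
  have h1 : (jap (ξ.pos j) ^ α * (∏ i ∈ Finset.univ.erase j, jap (ξ.pos i))⁻¹) *
      ((∏ i ∈ Finset.univ.erase j, jap (ξ.pos i) ^ α) *
        (jap (ξ.pos j - ∑ l, η.pos l) * ∏ l, jap (η.pos l))⁻¹) =
      ((∏ i ∈ Finset.univ.erase j, jap (ξ.pos i) ^ α) *
        (∏ i ∈ Finset.univ.erase j, jap (ξ.pos i))⁻¹) *
      (jap (ξ.pos j) ^ α * (jap (ξ.pos j - ∑ l, η.pos l) * ∏ l, jap (η.pos l))⁻¹) := by ring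
  rw [h1]
  refine mul_le_of_le_one_left
    (mul_nonneg (Real.rpow_nonneg (jap_pos _).le _) (inv_nonneg.2 hQ.le)) ?_
  refine mul_inv_le_one_of_le₀ (Finset.prod_le_prod
    (fun i _ => Real.rpow_nonneg (jap_pos _).le _) fun i _ => ?_) hP.le
  exact (Real.rpow_le_rpow_of_exponent_le (one_le_jap _) hα).trans_eq (Real.rpow_one _)

/-- The Cauchy–Schwarz inequality with a weight. -/
theorem sq_lintegral_enorm_le {X : Type*} [MeasurableSpace X] {μ : Measure X} {F : X → ℂ}
    (hF : Measurable F) {w : X → ℝ} (hw : Measurable w) (hw0 : ∀ x, 0 < w x) :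
    (∫⁻ x, ‖F x‖ₑ ∂μ) ^ 2 ≤
      (∫⁻ x, ENNReal.ofReal (w x)⁻¹ ∂μ) * ∫⁻ x, ENNReal.ofReal (w x) * ‖F x‖ₑ ^ 2 ∂μ := by
  have hs : ∀ x, ENNReal.ofReal (√(w x)⁻¹) * ENNReal.ofReal (√(w x)) = 1 := fun x => by
    rw [← ENNReal.ofReal_mul (Real.sqrt_nonneg _), ← Real.sqrt_mul (inv_nonneg.2 (hw0 x).le),
      inv_mul_cancel₀ (hw0 x).ne', Real.sqrt_one, ENNReal.ofReal_one]
  have h2 : ∀ r : ℝ, 0 ≤ r → ENNReal.ofReal (√r) ^ (2 : ℝ) = ENNReal.ofReal r := fun r hr => by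
    rw [ENNReal.rpow_two, ← ENNReal.ofReal_pow (Real.sqrt_nonneg _), Real.sq_sqrt hr]
  have h := ENNReal.lintegral_mul_le_Lp_mul_Lq μ Real.HolderConjugate.two_two
    (f := fun x => ENNReal.ofReal (√(w x)⁻¹)) (g := fun x => ENNReal.ofReal (√(w x)) * ‖F x‖ₑ)
    hw.inv.sqrt.ennreal_ofReal.aemeasurable
    (hw.sqrt.ennreal_ofReal.mul hF.enorm).aemeasurable
  simp only [Pi.mul_apply, ← mul_assoc, hs, one_mul, ENNReal.mul_rpow_of_nonneg _ _ zero_le_two,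
    h2 _ (inv_nonneg.2 (hw0 _).le), h2 _ (hw0 _).le] at h
  simp only [ENNReal.rpow_two] at h
  refine (pow_le_pow_left' h 2).trans_eq ?_
  rw [mul_pow]
  congr 1 <;> rw [← ENNReal.rpow_two, ← ENNReal.rpow_mul] <;> norm_num

/-- Cauchy–Schwarz in the contracted momenta. -/
theorem lintegral_japWeight_mul_sq_le {α : ℝ} (hα : α ≤ 1) {c : ℝ}
    (hc : ∀ q : EuclideanSpace ℝ (Fin d), ∫⁻ η : Conf κ d, ENNReal.ofReal
      (jap q ^ α * (jap (q - ∑ l, η.pos l) * ∏ l, jap (η.pos l))⁻¹) ≤ ENNReal.ofReal c)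
    (j : ι) {f : Conf (ι ⊕ κ) d → ℂ} (hf : Measurable f) :
    ∫⁻ ξ : Conf ι d, ENNReal.ofReal (japWeight α ξ) *
      (∫⁻ η : Conf κ d, ‖f (glue (ξ - sumAt κ d j η) η)‖ₑ) ^ 2 ≤
      ENNReal.ofReal c * ∫⁻ ζ, ENNReal.ofReal (energyWeight ζ) * ‖f ζ‖ₑ ^ 2 := by
  have hmp := measurePreserving_glue_shear (κ := κ) (d := d) j
  have hW : Measurable fun ζ : Conf (ι ⊕ κ) d => ENNReal.ofReal (energyWeight ζ) * ‖f ζ‖ₑ ^ 2 :=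
    measurable_energyWeight.ennreal_ofReal.mul (hf.enorm.pow_const 2)
  have hsec : ∀ ξ : Conf ι d, Measurable fun η : Conf κ d => glue (ξ - sumAt κ d j η) η :=
    fun ξ => hmp.measurable.comp measurable_prodMk_left
  rw [← hmp.lintegral_comp hW, lintegral_prod (fun p : Conf ι d × Conf κ d =>
      ENNReal.ofReal (energyWeight (glue (p.1 - sumAt κ d j p.2) p.2)) *
        ‖f (glue (p.1 - sumAt κ d j p.2) p.2)‖ₑ ^ 2) (hW.comp hmp.measurable).aemeasurable,
    ← lintegral_const_mul' _ _ ENNReal.ofReal_ne_top]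
  refine lintegral_mono fun ξ => ?_
  have h1 := sq_lintegral_enorm_le (μ := (volume : Measure (Conf κ d))) (hf.comp (hsec ξ))
    (measurable_energyWeight.comp (hsec ξ)) fun η => energyWeight_pos _
  refine (mul_le_mul_right h1 _).trans ?_
  rw [← mul_assoc]
  exact mul_le_mul_left (lintegral_japWeight_mul_inv_le hα hc j ξ) _

/-- The Fourier transform of the contraction of a kernel with Fourier transform `f`. -/
def contractFourier (j : ι) (f : Conf (ι ⊕ κ) d → ℂ) (ξ : Conf ι d) : ℂ :=
  ∫ η : Conf κ d, f (glue (ξ - sumAt κ d j η) η)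

theorem measurable_contractFourier (j : ι) {f : Conf (ι ⊕ κ) d → ℂ} (hf : Measurable f) :
    Measurable (contractFourier j f) := by
  have h : StronglyMeasurable (fun p : Conf ι d × Conf κ d =>
      f (glue (p.1 - sumAt κ d j p.2) p.2)) :=
    (hf.comp (measurePreserving_glue_shear j).measurable).stronglyMeasurable
  exact h.integral_prod_right.measurable

theorem enorm_contractFourier_le (j : ι) (f : Conf (ι ⊕ κ) d → ℂ) (ξ : Conf ι d) :
    ‖contractFourier j f ξ‖ₑ ≤ ∫⁻ η : Conf κ d, ‖f (glue (ξ - sumAt κ d j η) η)‖ₑ :=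
  enorm_integral_le_lintegral_enorm _

/-- The Fourier transform of the kernel is integrable against `L²` functions of the contracted
momenta. This is the dominating function in the limit `ε → 0`. -/
theorem integrable_shear_mul {c : ℝ}
    (hc : ∀ q : EuclideanSpace ℝ (Fin d), ∫⁻ η : Conf κ d, ENNReal.ofReal
      (jap q ^ (0 : ℝ) * (jap (q - ∑ l, η.pos l) * ∏ l, jap (η.pos l))⁻¹) ≤ ENNReal.ofReal c)
    (j : ι) {f : Conf (ι ⊕ κ) d → ℂ} (hf : Measurable f)
    (hE : ∫⁻ ζ, ENNReal.ofReal (energyWeight ζ) * ‖f ζ‖ₑ ^ 2 < ⊤) {u : Conf ι d → ℂ}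
    (hu : Measurable u) (hu2 : ∫⁻ ξ, ‖u ξ‖ₑ ^ 2 < ⊤) :
    Integrable (fun p : Conf ι d × Conf κ d => f (glue (p.1 - sumAt κ d j p.2) p.2) * u p.1)
      (volume.prod volume) := by
  have hfm : Measurable (fun p : Conf ι d × Conf κ d => f (glue (p.1 - sumAt κ d j p.2) p.2)) :=
    hf.comp (measurePreserving_glue_shear j).measurable
  have hm : Measurable (fun p : Conf ι d × Conf κ d =>
      f (glue (p.1 - sumAt κ d j p.2) p.2) * u p.1) := hfm.mul (hu.comp measurable_fst)
  refine ⟨hm.aestronglyMeasurable, ?_⟩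
  have h0 := lintegral_japWeight_mul_sq_le zero_le_one hc j hf
  simp only [japWeight, Real.rpow_zero, Finset.prod_const_one, ENNReal.ofReal_one, one_mul] at h0
  have h1 := h0.trans_lt (ENNReal.mul_lt_top ENNReal.ofReal_lt_top hE)
  have hA : Measurable fun ξ : Conf ι d =>
      ∫⁻ η : Conf κ d, ‖f (glue (ξ - sumAt κ d j η) η)‖ₑ := hfm.enorm.lintegral_prod_right'
  rw [HasFiniteIntegral, lintegral_prod _ hm.enorm.aemeasurable]
  have hab : ∀ a b : ℝ≥0∞, a * b ≤ a ^ 2 + b ^ 2 := fun a b => by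
    rcases le_total a b with h | h
    · exact (mul_le_mul_left h b).trans ((sq b).symm.le.trans le_add_self)
    · exact (mul_le_mul_right h a).trans ((sq a).symm.le.trans le_self_add)
  refine lt_of_le_of_lt (lintegral_mono (g := fun ξ =>
    (∫⁻ η : Conf κ d, ‖f (glue (ξ - sumAt κ d j η) η)‖ₑ) ^ 2 + ‖u ξ‖ₑ ^ 2) fun ξ => ?_) ?_
  · simp only [enorm_mul]
    rw [lintegral_mul_const' _ _ enorm_ne_top]
    exact hab _ _
  · rw [lintegral_add_left (hA.pow_const 2)]
    exact ENNReal.add_lt_top.2 ⟨h1, hu2⟩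

theorem memLp_two_of_lintegral_sq {X : Type*} [MeasurableSpace X] {μ : Measure X} {F : X → ℂ}
    (hF : Measurable F) (h : ∫⁻ x, ‖F x‖ₑ ^ 2 ∂μ < ⊤) : MemLp F 2 μ := by
  refine ⟨hF.aestronglyMeasurable, ?_⟩
  rw [eLpNorm_lt_top_iff_lintegral_rpow_enorm_lt_top two_ne_zero ENNReal.ofNat_ne_top]
  simpa using h

/-- The contraction and its image under the Sobolev weight exist in `L²`. -/
theorem exists_contraction_sobolev {α : ℝ} (hα : α ≤ 1) {c c₀ : ℝ}
    (hc : ∀ q : EuclideanSpace ℝ (Fin d), ∫⁻ η : Conf κ d, ENNReal.ofReal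
      (jap q ^ α * (jap (q - ∑ l, η.pos l) * ∏ l, jap (η.pos l))⁻¹) ≤ ENNReal.ofReal c)
    (hc₀ : ∀ q : EuclideanSpace ℝ (Fin d), ∫⁻ η : Conf κ d, ENNReal.ofReal
      (jap q ^ (0 : ℝ) * (jap (q - ∑ l, η.pos l) * ∏ l, jap (η.pos l))⁻¹) ≤ ENNReal.ofReal c₀)
    (hc0 : 0 ≤ c) (j : ι) {f : Conf (ι ⊕ κ) d → ℂ} (hf : Measurable f) {E : ℝ} (hE0 : 0 ≤ E)
    (hE : ∫⁻ ζ, ENNReal.ofReal (energyWeight ζ) * ‖f ζ‖ₑ ^ 2 ≤ ENNReal.ofReal E) :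
    ∃ G F : L2 ι d, (∀ᵐ ξ, (𝓕 G : L2 ι d) ξ = contractFourier j f ξ) ∧
      (∀ᵐ ξ, (𝓕 F : L2 ι d) ξ = (japWeight (α / 2) ξ : ℂ) * contractFourier j f ξ) ∧
      ‖F‖ ^ 2 ≤ c * E := by
  have hlt : ∀ r : ℝ, ENNReal.ofReal r *
      ∫⁻ ζ, ENNReal.ofReal (energyWeight ζ) * ‖f ζ‖ₑ ^ 2 < ⊤ := fun r =>
    ENNReal.mul_lt_top ENNReal.ofReal_lt_top (hE.trans_lt ENNReal.ofReal_lt_top)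
  have hm := measurable_contractFourier (κ := κ) j hf
  have h0 := lintegral_japWeight_mul_sq_le zero_le_one hc₀ j hf
  simp only [japWeight, Real.rpow_zero, Finset.prod_const_one, ENNReal.ofReal_one, one_mul] at h0
  have hG : MemLp (contractFourier (κ := κ) j f) 2 volume :=
    memLp_two_of_lintegral_sq hm (lt_of_le_of_lt
      ((lintegral_mono fun ξ => pow_le_pow_left' (enorm_contractFourier_le j f ξ) 2).trans h0)
      (hlt _))
  have hFm : Measurable fun ξ => (japWeight (α / 2) ξ : ℂ) * contractFourier (κ := κ) j f ξ :=
    (Complex.measurable_ofReal.comp (measurable_japWeight _)).mul hm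
  have hsq : ∀ ξ : Conf ι d, ‖(japWeight (α / 2) ξ : ℂ) * contractFourier (κ := κ) j f ξ‖ₑ ^ 2 ≤
      ENNReal.ofReal (japWeight α ξ) *
        (∫⁻ η : Conf κ d, ‖f (glue (ξ - sumAt κ d j η) η)‖ₑ) ^ 2 := fun ξ => by
    have e : ‖(japWeight (α / 2) ξ : ℂ)‖ₑ ^ 2 = ENNReal.ofReal (japWeight α ξ) := by
      rw [← ofReal_norm, Complex.norm_real, Real.norm_of_nonneg (japWeight_pos _ _).le,
        ← ENNReal.ofReal_pow (japWeight_pos _ _).le]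
      congr 1
      unfold japWeight
      rw [← Finset.prod_pow]
      refine Finset.prod_congr rfl fun l _ => ?_
      rw [← Real.rpow_natCast, ← Real.rpow_mul (jap_pos _).le]
      norm_num
    rw [enorm_mul, mul_pow, e]
    exact mul_le_mul_right (pow_le_pow_left' (enorm_contractFourier_le j f ξ) 2) _
  have hFint := (lintegral_mono hsq).trans (lintegral_japWeight_mul_sq_le hα hc j hf)
  have hF := memLp_two_of_lintegral_sq hFm (hFint.trans_lt (hlt _))
  refine ⟨𝓕⁻ (hG.toLp _), 𝓕⁻ (hF.toLp _), ?_, ?_, ?_⟩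
  · rw [FourierTransform.fourier_fourierInv_eq]
    exact hG.coeFn_toLp
  · rw [FourierTransform.fourier_fourierInv_eq]
    exact hF.coeFn_toLp
  · have h1 : ‖(𝓕⁻ (hF.toLp _) : L2 ι d)‖ = ‖hF.toLp _‖ := by
      rw [← Lp.norm_fourier_eq, FourierTransform.fourier_fourierInv_eq]
    rw [h1]
    have h2 : ‖hF.toLp _‖ₑ ^ 2 ≤ ENNReal.ofReal (c * E) := by
      rw [enorm_sq_eq_lintegral, lintegral_congr_ae (hF.coeFn_toLp.mono fun ξ h => by
        rw [h]), ENNReal.ofReal_mul hc0]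
      exact hFint.trans (mul_le_mul_right hE _)
    rw [← ofReal_norm, ← ENNReal.ofReal_pow (norm_nonneg _)] at h2
    exact (ENNReal.ofReal_le_ofReal_iff (mul_nonneg hc0 hE0)).1 h2

end WeightedBound

/-! ### Mollifiers and their Fourier transforms -/

section FourierPairing

variable {ι κ : Type} [Fintype ι] [Fintype κ] {d : ℕ}

/-- Parseval's formula for the bilinear pairing of an `L²` function with a test function. -/
theorem integral_mul_eq_integral_fourier_mul (g : L2 ι d) {Φ : Conf ι d → ℂ}
    (hΦ : ContDiff ℝ ∞ Φ) (hc : HasCompactSupport Φ) :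
    ∫ x, g x * Φ x = ∫ ξ, (𝓕 g : L2 ι d) ξ * 𝓕⁻ Φ ξ := by
  set S : 𝓢(Conf ι d, ℂ) := hc.toSchwartzMap hΦ with hS
  have h := congrArg (fun u : 𝓢'(Conf ι d, ℂ) => u (𝓕⁻ S)) (Lp.fourier_toTemperedDistribution_eq g)
  simp only [TemperedDistribution.fourier_apply, FourierTransform.fourier_fourierInv_eq,
    Lp.toTemperedDistribution_apply, smul_eq_mul] at h
  have e : ⇑(𝓕⁻ S : 𝓢(Conf ι d, ℂ)) = 𝓕⁻ Φ := SchwartzMap.fourierInv_coe S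
  rw [e] at h
  simp only [mul_comm (g _), mul_comm ((𝓕 g : L2 ι d) _)]
  exact h

theorem fourierInv_sq_integrable {Φ : Conf ι d → ℂ} (hΦ : ContDiff ℝ ∞ Φ)
    (hc : HasCompactSupport Φ) : Measurable (𝓕⁻ Φ) ∧ ∫⁻ ξ, ‖𝓕⁻ Φ ξ‖ₑ ^ 2 < ⊤ := by
  set S : 𝓢(Conf ι d, ℂ) := hc.toSchwartzMap hΦ with hS
  have e : ⇑(𝓕⁻ S : 𝓢(Conf ι d, ℂ)) = 𝓕⁻ Φ := SchwartzMap.fourierInv_coe S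
  rw [← e]
  refine ⟨(𝓕⁻ S : 𝓢(Conf ι d, ℂ)).continuous.measurable, ?_⟩
  have h := ((𝓕⁻ S : 𝓢(Conf ι d, ℂ)).memLp 2).2
  rw [eLpNorm_lt_top_iff_lintegral_rpow_enorm_lt_top two_ne_zero ENNReal.ofNat_ne_top] at h
  simpa using h

theorem inner_glue (x x' : Conf ι d) (y y' : Conf κ d) :
    ⟪glue x y, glue x' y'⟫_ℝ = ⟪x, x'⟫_ℝ + ⟪y, y'⟫_ℝ := by
  simp [PiLp.inner_apply, Fintype.sum_prod_type, glue]

/-- The test function `φ(z) H(z_j - y_1, z_j - y_2, …)` on pairs `(z, y)`. -/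
def contractionTest (j : ι) (φ : Conf ι d → ℂ) (H : Conf κ d → ℂ) (ζ : Conf (ι ⊕ κ) d) : ℂ :=
  φ (leftConf ζ) * H (diagAt κ d j (leftConf ζ) - rightConf ζ)

theorem contDiff_leftConf : ContDiff ℝ ∞ (leftConf : Conf (ι ⊕ κ) d → Conf ι d) := by
  rw [contDiff_euclidean]; intro i; unfold leftConf Conf.mk Conf.pos; fun_prop

theorem contDiff_rightConf : ContDiff ℝ ∞ (rightConf : Conf (ι ⊕ κ) d → Conf κ d) := by
  rw [contDiff_euclidean]; intro i; unfold rightConf Conf.mk Conf.pos; fun_prop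

theorem contDiff_contractionTest (j : ι) {φ : Conf ι d → ℂ} {H : Conf κ d → ℂ}
    (hφ : ContDiff ℝ ∞ φ) (hH : ContDiff ℝ ∞ H) : ContDiff ℝ ∞ (contractionTest j φ H) := by
  have hD : ContDiff ℝ ∞ (diagAt κ d j) :=
    (LinearMap.toContinuousLinearMap (diagAt κ d j)).contDiff
  exact (hφ.comp contDiff_leftConf).mul
    (hH.comp ((hD.comp contDiff_leftConf).sub contDiff_rightConf))

theorem hasCompactSupport_contractionTest (j : ι) {φ : Conf ι d → ℂ} {H : Conf κ d → ℂ}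
    (hφ : HasCompactSupport φ) (hH : HasCompactSupport H) :
    HasCompactSupport (contractionTest j φ H) := by
  set K : Set (Conf ι d × Conf κ d) := (tsupport φ) ×ˢ (tsupport H) with hK
  set m : Conf ι d × Conf κ d → Conf (ι ⊕ κ) d := fun p => glue p.1 (diagAt κ d j p.1 - p.2) with hm
  have hmc : Continuous m := by
    have h : Continuous fun p : Conf ι d × Conf κ d =>
        (WithLp.toLp 2 (p.1, diagAt κ d j p.1 - p.2) : WithLp 2 (Conf ι d × Conf κ d)) :=
      (WithLp.prod_continuous_toLp 2 _ _).comp (continuous_fst.prodMk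
        (((continuous_diagAt j).comp continuous_fst).sub continuous_snd))
    exact (glueIsom ι κ d).continuous.comp h
  refine HasCompactSupport.of_support_subset_isCompact ((hφ.prod hH).image hmc) fun ζ hζ => ?_
  rw [Function.mem_support, contractionTest, mul_ne_zero_iff] at hζ
  refine ⟨(leftConf ζ, diagAt κ d j (leftConf ζ) - rightConf ζ),
    ⟨subset_tsupport _ hζ.1, subset_tsupport _ hζ.2⟩, ?_⟩
  simp [hm]

/-- In Fourier variables the contraction shifts the momentum of the particle `j` by `∑ η`. -/
theorem fourierInv_contractionTest (j : ι) {φ : Conf ι d → ℂ} {H : Conf κ d → ℂ}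
    (hφ : ContDiff ℝ ∞ φ) (hφc : HasCompactSupport φ) (hH : ContDiff ℝ ∞ H)
    (hHc : HasCompactSupport H) (ξ : Conf ι d) (η : Conf κ d) :
    𝓕⁻ (contractionTest j φ H) (glue ξ η) = 𝓕⁻ φ (ξ + sumAt κ d j η) * 𝓕 H η := by
  have hint : Integrable (fun ζ : Conf (ι ⊕ κ) d =>
      Real.fourierChar ⟪ζ, glue ξ η⟫_ℝ • contractionTest j φ H ζ) := by
    have h := (Real.fourierIntegral_convergent_iff (μ := volume) (-glue ξ η)).2
      ((contDiff_contractionTest j hφ hH).continuous.integrable_of_hasCompactSupport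
        (hasCompactSupport_contractionTest j hφc hHc))
    simpa using h
  rw [Real.fourierInv_eq, integral_glue, integral_prod]
  · rw [Real.fourierInv_eq, ← integral_mul_const]
    refine integral_congr_ae (ae_of_all _ fun z => ?_)
    simp only [inner_glue, contractionTest, leftConf_glue, rightConf_glue]
    rw [← integral_sub_left_eq_self _ volume (diagAt κ d j z), Real.fourier_eq,
      ← integral_const_mul]
    refine integral_congr_ae (ae_of_all _ fun u => ?_)
    simp only [sub_sub_cancel, inner_sub_left, inner_add_right, inner_diagAt, Circle.smul_def,
      smul_eq_mul]
    rw [sub_eq_add_neg, ← add_assoc, AddChar.map_add_eq_mul, Circle.coe_mul]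
    ring
  · exact (measurePreserving_glueEquiv.integrable_comp_emb
      (glueEquiv ι κ d).measurableEmbedding).2 hint

end FourierPairing

section Mollifier

variable {κ : Type} [Fintype κ] {d : ℕ} {h : EuclideanSpace ℝ (Fin d) → ℝ}

/-- The product `∏_l h(u_l)` of mollifiers. -/
def mollProd (h : EuclideanSpace ℝ (Fin d) → ℝ) (u : Conf κ d) : ℂ := ((∏ l, h (u.pos l) : ℝ) : ℂ)

theorem IsMollifier.contDiff_mollProd (hh : IsMollifier h) :
    ContDiff ℝ ∞ (mollProd h : Conf κ d → ℂ) := by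
  have hpos : ∀ l : κ, ContDiff ℝ ∞ fun u : Conf κ d => u.pos l := fun l => by
    rw [contDiff_euclidean]; intro i; unfold Conf.pos; fun_prop
  have h1 : ContDiff ℝ ∞ fun u : Conf κ d => ∏ l, h (u.pos l) :=
    contDiff_prod fun l _ => hh.smooth.comp (hpos l)
  exact Complex.ofRealCLM.contDiff.comp h1

theorem IsMollifier.hasCompactSupport_mollProd (hh : IsMollifier h) :
    HasCompactSupport (mollProd h : Conf κ d → ℂ) := by
  have hcont : Continuous fun q : κ → EuclideanSpace ℝ (Fin d) => Conf.mk q := by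
    unfold Conf.mk
    exact (PiLp.continuous_toLp 2 _).comp (by fun_prop)
  refine HasCompactSupport.of_support_subset_isCompact
    ((isCompact_univ_pi fun _ : κ => hh.compact).image hcont) fun u hu => ?_
  rw [Function.mem_support, mollProd, Complex.ofReal_ne_zero, Finset.prod_ne_zero_iff] at hu
  exact ⟨u.pos, fun l _ => subset_tsupport _ (hu l (Finset.mem_univ l)), rfl⟩

theorem IsMollifier.scaled (hh : IsMollifier h) {ε : ℝ} (hε : 0 < ε) : IsMollifier (scaled h ε) where
  smooth := contDiff_const.mul (hh.smooth.comp (contDiff_const_smul ε⁻¹))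
  compact := (hh.compact.comp_smul (inv_ne_zero hε.ne')).mul_left
  nonneg x := mul_nonneg (by positivity) (hh.nonneg _)
  integral_eq_one := by
    unfold GPHierarchy.scaled
    rw [integral_const_mul, Measure.integral_comp_smul, hh.integral_eq_one,
      finrank_euclideanSpace_fin, abs_of_nonneg (by positivity), smul_eq_mul, mul_one, inv_pow,
      inv_inv, inv_mul_cancel₀ (by positivity)]

theorem mollProd_scaled (ε : ℝ) (u : Conf κ d) :
    mollProd (scaled h ε) u = (((ε ^ d)⁻¹ ^ Fintype.card κ : ℝ) : ℂ) * mollProd h (ε⁻¹ • u) := by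
  have hpos : ∀ l, (ε⁻¹ • u).pos l = ε⁻¹ • u.pos l := fun l => by ext a; simp
  simp only [mollProd, scaled, Finset.prod_mul_distrib, Finset.prod_const, Finset.card_univ,
    Complex.ofReal_mul, hpos]

/-- Scaling by `ε` in position space is scaling by `ε` of the argument in Fourier space. -/
theorem fourier_mollProd_scaled {ε : ℝ} (hε : 0 < ε) (η : Conf κ d) :
    𝓕 (mollProd (scaled h ε) : Conf κ d → ℂ) η =
      𝓕 (mollProd h : Conf κ d → ℂ) (ε • η) := by
  rw [Real.fourier_eq, Real.fourier_eq]
  have e : ∀ u : Conf κ d, Real.fourierChar (-⟪u, η⟫_ℝ) • mollProd (scaled h ε) u =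
      (fun w : Conf κ d => (((ε ^ d)⁻¹ ^ Fintype.card κ : ℝ) : ℂ) *
        (Real.fourierChar (-⟪w, ε • η⟫_ℝ) • mollProd h w)) (ε⁻¹ • u) := fun u => by
    simp only [mollProd_scaled, inner_smul_left, inner_smul_right, Circle.smul_def, smul_eq_mul,
      conj_trivial]
    rw [mul_inv_cancel_left₀ hε.ne']
    ring
  refine (integral_congr_ae (ae_of_all _ e)).trans ((Measure.integral_comp_smul volume
    (fun w : Conf κ d => (((ε ^ d)⁻¹ ^ Fintype.card κ : ℝ) : ℂ) *
      (Real.fourierChar (-⟪w, ε • η⟫_ℝ) • mollProd h w)) ε⁻¹).trans ?_)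
  rw [integral_const_mul, finrank_euclideanSpace, Fintype.card_prod,
    Fintype.card_fin, abs_of_nonneg (by positivity), Complex.real_smul, ← mul_assoc,
    ← Complex.ofReal_mul]
  have : ((ε⁻¹ ^ (Fintype.card κ * d))⁻¹ * (ε ^ d)⁻¹ ^ Fintype.card κ : ℝ) = 1 := by
    rw [mul_comm (Fintype.card κ), pow_mul, inv_pow ε d]
    exact inv_mul_cancel₀ (by positivity)
  rw [this, Complex.ofReal_one, one_mul]

theorem IsMollifier.integral_mollProd (hh : IsMollifier h) :
    ∫ u : Conf κ d, ‖mollProd h u‖ = 1 ∧ ∫ u : Conf κ d, mollProd h u = 1 := by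
  have hnn : ∀ u : Conf κ d, 0 ≤ ∏ l, h (u.pos l) := fun u => Finset.prod_nonneg fun l _ => hh.nonneg _
  have hm : Measurable h := hh.smooth.continuous.measurable
  have h1 : ∫⁻ q, ENNReal.ofReal (h q) = 1 := by
    rw [← ofReal_integral_eq_lintegral_ofReal
      (hh.smooth.continuous.integrable_of_hasCompactSupport hh.compact) (ae_of_all _ hh.nonneg),
      hh.integral_eq_one, ENNReal.ofReal_one]
  have h2 : ∫ u : Conf κ d, ∏ l, h (u.pos l) = 1 := by
    rw [integral_eq_lintegral_of_nonneg_ae (ae_of_all _ hnn)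
      (Finset.measurable_prod _ fun l _ => hm.comp (measurable_pos l)).aestronglyMeasurable]
    have e : ∀ u : Conf κ d, ENNReal.ofReal (∏ l, h (u.pos l)) = ∏ l, ENNReal.ofReal (h (u.pos l)) :=
      fun u => ENNReal.ofReal_prod_of_nonneg fun l _ => hh.nonneg _
    simp only [e]
    rw [lintegral_prod_pos hm.ennreal_ofReal, h1, one_pow, ENNReal.toReal_one]
  constructor
  · simp only [mollProd, Complex.norm_real, Real.norm_of_nonneg (hnn _), h2]
  · simp only [mollProd]
    rw [integral_complex_ofReal, h2, Complex.ofReal_one]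

theorem IsMollifier.norm_fourier_mollProd_le (hh : IsMollifier h) (η : Conf κ d) :
    ‖𝓕 (mollProd h : Conf κ d → ℂ) η‖ ≤ 1 :=
  (VectorFourier.norm_fourierIntegral_le_integral_norm _ _ _ _ _).trans_eq hh.integral_mollProd.1

theorem IsMollifier.continuous_fourier_mollProd (hh : IsMollifier h) :
    Continuous (𝓕 (mollProd h : Conf κ d → ℂ)) := by
  have e : ⇑(𝓕 (hh.hasCompactSupport_mollProd.toSchwartzMap hh.contDiff_mollProd) :
    𝓢(Conf κ d, ℂ)) = 𝓕 (mollProd h : Conf κ d → ℂ) := SchwartzMap.fourier_coe _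
  rw [← e]
  exact SchwartzMap.continuous _

theorem IsMollifier.tendsto_fourier_mollProd (hh : IsMollifier h) (η : Conf κ d) :
    Tendsto (fun ε : ℝ => 𝓕 (mollProd (GPHierarchy.scaled h ε) : Conf κ d → ℂ) η) (𝓝[>] 0) (𝓝 1) := by
  have hc := hh.continuous_fourier_mollProd (κ := κ)
  have hchar : ∀ v : Conf κ d,
      Real.fourierChar (-⟪v, (0 : Conf κ d)⟫_ℝ) • mollProd h v = mollProd h v := fun v => by
    rw [inner_zero_right, neg_zero, AddChar.map_zero_eq_one, one_smul]
  have h0 : 𝓕 (mollProd h : Conf κ d → ℂ) ((0 : ℝ) • η) = 1 := by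
    rw [zero_smul]
    exact (Real.fourier_eq _ _).trans
      ((integral_congr_ae (ae_of_all _ hchar)).trans (hh.integral_mollProd (κ := κ)).2)
  have h1 : Tendsto (fun ε : ℝ => 𝓕 (mollProd h : Conf κ d → ℂ) (ε • η)) (𝓝 0) (𝓝 1) :=
    h0 ▸ (hc.comp (continuous_id.smul (continuous_const (y := η)))).tendsto (0 : ℝ)
  refine (h1.mono_left nhdsWithin_le_nhds).congr' ?_
  filter_upwards [self_mem_nhdsWithin] with ε hε
  exact (fourier_mollProd_scaled hε η).symm

end Mollifier

/-! ### The limit of the mollified contractions -/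

section Limit

variable {ι κ : Type} [Fintype ι] [Fintype κ] {d : ℕ} {h : EuclideanSpace ℝ (Fin d) → ℝ}

/-- Pairings with the mollified contraction converge. In Fourier space the mollifier is the factor
`𝓕 (mollProd h) (ε η)`, which is bounded by `1` and tends to `1`; the limit is taken by dominated
convergence. -/
theorem tendsto_integral_contractionTest (hh : IsMollifier h) {c : ℝ}
    (hc : ∀ q : EuclideanSpace ℝ (Fin d), ∫⁻ η : Conf κ d, ENNReal.ofReal
      (jap q ^ (0 : ℝ) * (jap (q - ∑ l, η.pos l) * ∏ l, jap (η.pos l))⁻¹) ≤ ENNReal.ofReal c)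
    (j : ι) {g : L2 (ι ⊕ κ) d} {G : L2 ι d}
    (hE : ∫⁻ ζ, ENNReal.ofReal (energyWeight ζ) * ‖(𝓕 g : L2 (ι ⊕ κ) d) ζ‖ₑ ^ 2 < ⊤)
    (hG : ∀ᵐ ξ, (𝓕 G : L2 ι d) ξ = contractFourier j (𝓕 g : L2 (ι ⊕ κ) d) ξ)
    {φ : Conf ι d → ℂ} (hφ : ContDiff ℝ ∞ φ) (hφc : HasCompactSupport φ) :
    Tendsto (fun ε : ℝ => ∫ ζ, g ζ * contractionTest j φ (mollProd (scaled h ε) : Conf κ d → ℂ) ζ)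
      (𝓝[>] 0) (𝓝 (∫ z, G z * φ z)) := by
  obtain ⟨f, hf⟩ : ∃ f : Conf (ι ⊕ κ) d → ℂ, f = (𝓕 g : L2 (ι ⊕ κ) d) := ⟨_, rfl⟩
  have hfm : Measurable f := hf ▸ (Lp.stronglyMeasurable (𝓕 g : L2 (ι ⊕ κ) d)).measurable
  rw [← hf] at hE hG
  obtain ⟨hum, hu2⟩ := fourierInv_sq_integrable hφ hφc
  obtain ⟨u, hu⟩ : ∃ u : Conf ι d → ℂ, u = 𝓕⁻ φ := ⟨_, rfl⟩
  rw [← hu] at hum hu2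
  have hmp := measurePreserving_glue_shear (κ := κ) (d := d) j
  have hint := integrable_shear_mul hc j hfm hE hum hu2
  have hlim : ∫ z, G z * φ z = ∫ p : Conf ι d × Conf κ d,
      f (glue (p.1 - sumAt κ d j p.2) p.2) * u p.1 ∂(volume.prod volume) := by
    rw [integral_mul_eq_integral_fourier_mul G hφ hφc, integral_prod _ hint]
    refine integral_congr_ae (hG.mono fun ξ hξ => ?_)
    simp only [hξ, ← hu]
    rw [integral_mul_const]
    rfl
  have hpre : ∀ ε : ℝ, 0 < ε →
      ∫ ζ, g ζ * contractionTest j φ (mollProd (scaled h ε) : Conf κ d → ℂ) ζ =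
      ∫ p : Conf ι d × Conf κ d, f (glue (p.1 - sumAt κ d j p.2) p.2) * u p.1 *
        𝓕 (mollProd (scaled h ε) : Conf κ d → ℂ) p.2 ∂(volume.prod volume) := fun ε hε => by
    have hm := hh.scaled hε
    obtain ⟨hum', -⟩ := fourierInv_sq_integrable
      (contDiff_contractionTest j hφ (hm.contDiff_mollProd (κ := κ)))
      (hasCompactSupport_contractionTest j hφc (hm.hasCompactSupport_mollProd (κ := κ)))
    rw [integral_mul_eq_integral_fourier_mul g
      (contDiff_contractionTest j hφ hm.contDiff_mollProd)
      (hasCompactSupport_contractionTest j hφc hm.hasCompactSupport_mollProd), ← hf,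
      ← hmp.map_eq]
    refine (integral_map hmp.measurable.aemeasurable (hfm.mul hum').aestronglyMeasurable).trans ?_
    refine integral_congr_ae (ae_of_all _ fun p => ?_)
    simp only [Pi.mul_apply]
    rw [fourierInv_contractionTest j hφ hφc hm.contDiff_mollProd hm.hasCompactSupport_mollProd,
      sub_add_cancel, ← hu, mul_assoc]
  rw [hlim]
  have hT : Tendsto (fun ε : ℝ => ∫ p : Conf ι d × Conf κ d,
      f (glue (p.1 - sumAt κ d j p.2) p.2) * u p.1 *
        𝓕 (mollProd (scaled h ε) : Conf κ d → ℂ) p.2 ∂(volume.prod volume)) (𝓝[>] 0)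
      (𝓝 (∫ p : Conf ι d × Conf κ d,
        f (glue (p.1 - sumAt κ d j p.2) p.2) * u p.1 ∂(volume.prod volume))) := by
    refine tendsto_integral_filter_of_dominated_convergence
      (fun p => ‖f (glue (p.1 - sumAt κ d j p.2) p.2) * u p.1‖) ?_ ?_ hint.norm ?_
    · filter_upwards [self_mem_nhdsWithin] with ε hε
      have hm := hh.scaled hε
      have hcont := hm.continuous_fourier_mollProd (κ := κ)
      exact hint.aestronglyMeasurable.mul (hcont.comp continuous_snd).aestronglyMeasurable
    · filter_upwards [self_mem_nhdsWithin] with ε hε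
      refine ae_of_all _ fun p => ?_
      rw [norm_mul]
      exact mul_le_of_le_one_right (norm_nonneg _) ((hh.scaled hε).norm_fourier_mollProd_le _)
    · refine ae_of_all _ fun p => ?_
      have := (hh.tendsto_fourier_mollProd p.2).const_mul
        (f (glue (p.1 - sumAt κ d j p.2) p.2) * u p.1)
      rwa [mul_one] at this
  refine hT.congr' ?_
  filter_upwards [self_mem_nhdsWithin] with ε hε
  exact (hpre ε hε).symm

theorem integrable_mul_contractionTest (hh : IsMollifier h) (j : ι) (g : L2 (ι ⊕ κ) d)
    {φ : Conf ι d → ℂ} (hφ : ContDiff ℝ ∞ φ) (hφc : HasCompactSupport φ) :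
    Integrable fun p : Conf ι d × Conf κ d => g (glue p.1 p.2) *
      contractionTest j φ (mollProd h : Conf κ d → ℂ) (glue p.1 p.2) := by
  have h1 : MemLp (contractionTest j φ (mollProd h : Conf κ d → ℂ)) 2 volume :=
    (contDiff_contractionTest j hφ hh.contDiff_mollProd).continuous.memLp_of_hasCompactSupport
      (hasCompactSupport_contractionTest j hφc hh.hasCompactSupport_mollProd)
  have h2 := (Lp.memLp g).integrable_mul h1
  exact (measurePreserving_glueEquiv.integrable_comp_emb
    (glueEquiv ι κ d).measurableEmbedding).2 h2

/-- The contraction at the particle `j` with the delta functions replaced by `h`. -/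
def mollContract (h : EuclideanSpace ℝ (Fin d) → ℝ) (j : ι) (g : Conf (ι ⊕ κ) d → ℂ)
    (z : Conf ι d) : ℂ :=
  ∫ y : Conf κ d, ((∏ l, h (z.pos j - y.pos l) : ℝ) : ℂ) * g (glue z y)

theorem mollContract_mul (j : ι) (g : Conf (ι ⊕ κ) d → ℂ) (φ : Conf ι d → ℂ) (z : Conf ι d) :
    mollContract h j g z * φ z =
      ∫ y : Conf κ d, g (glue z y) * contractionTest j φ (mollProd h : Conf κ d → ℂ) (glue z y) := by
  rw [mollContract, ← integral_mul_const]
  refine integral_congr_ae (ae_of_all _ fun y => ?_)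
  have hpos : ∀ l, (diagAt κ d j z - y).pos l = z.pos j - y.pos l := fun l => by
    ext a; simp [diagAt]
  simp only [contractionTest, leftConf_glue, rightConf_glue, mollProd, hpos]
  ring

/-- The integrability is part of the claim: it allows to treat `B⁺` and `B⁻` separately. -/
theorem integrable_mollContract_mul (hh : IsMollifier h) (j : ι) (g : L2 (ι ⊕ κ) d)
    {φ : Conf ι d → ℂ} (hφ : ContDiff ℝ ∞ φ) (hφc : HasCompactSupport φ) :
    Integrable (fun z => mollContract h j g z * φ z) ∧
    ∫ z, mollContract h j g z * φ z =
      ∫ ζ, g ζ * contractionTest j φ (mollProd h : Conf κ d → ℂ) ζ := by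
  have hi := integrable_mul_contractionTest hh j g hφ hφc
  simp only [mollContract_mul]
  refine ⟨hi.integral_prod_left, ?_⟩
  rw [integral_glue]
  exact (integral_prod _ hi).symm

end Limit

section Arrangement

variable {k p d : ℕ}

/-- The arrangement `(x_k, x_p; x'_k, x'_p) ↦ ((x_k; x'_k), (x_p; x'_p))` of the labels. -/
def splitLabels (k p : ℕ) :
    Fin (k + p) ⊕ Fin (k + p) ≃ (Fin k ⊕ Fin k) ⊕ (Fin p ⊕ Fin p) :=
  (Equiv.sumCongr finSumFinEquiv.symm finSumFinEquiv.symm).trans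
    (Equiv.sumSumSumComm (Fin k) (Fin p) (Fin k) (Fin p))

theorem glue_join_eq_reindex (z : Conf (Fin k ⊕ Fin k) d) (y : Conf (Fin p ⊕ Fin p) d) :
    glue (join (k + p) le_rfl (Conf.mk fun i => z.pos (Sum.inl i))
        (Conf.mk fun i => y.pos (Sum.inl i)))
      (join (k + p) le_rfl (Conf.mk fun i => z.pos (Sum.inr i))
        (Conf.mk fun i => y.pos (Sum.inr i))) =
      reindex d (splitLabels k p) (glue z y) := by
  rw [reindex_apply]
  ext ⟨i | i, a⟩
  all_goals
    refine Fin.addCases (fun i => ?_) (fun i => ?_) i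
    · simp [glue, join, splitLabels]
    · simp [glue, join, splitLabels]

theorem energyWeight_reindex {ι κ : Type} [Fintype ι] [Fintype κ] (e : κ ≃ ι) (ξ : Conf ι d) :
    energyWeight (reindex d e ξ) = energyWeight ξ := by
  have h : ∀ i, (reindex d e ξ).pos i = ξ.pos (e i) := fun i => by
    rw [reindex_apply]; ext a; simp
  unfold energyWeight
  simp only [h]
  exact e.prod_comp fun i => 1 + (2 * Real.pi * ‖ξ.pos i‖) ^ 2

theorem lintegral_energyWeight_isomComp {ι κ : Type} [Fintype ι] [Fintype κ] (e : κ ≃ ι)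
    (g : L2 κ d) :
    ∫⁻ ξ, ENNReal.ofReal (energyWeight ξ) *
        ‖(𝓕 (isomComp (reindex d e) g : L2 ι d) : L2 ι d) ξ‖ₑ ^ 2 =
      ∫⁻ ξ, ENNReal.ofReal (energyWeight ξ) * ‖(𝓕 g : L2 κ d) ξ‖ₑ ^ 2 := by
  have h1 : (𝓕 (isomComp (reindex d e) g : L2 ι d) : L2 ι d) =ᵐ[volume]
      fun ξ => (𝓕 g : L2 κ d) (reindex d e ξ) := by
    rw [fourier_isomComp]
    exact coeFn_isomComp _ _
  rw [lintegral_congr_ae (h1.mono fun ξ hξ => by rw [hξ]),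
    ← (reindex d e).measurePreserving.lintegral_comp_emb
      (reindex d e).toMeasurableEquiv.measurableEmbedding]
  simp only [energyWeight_reindex]

theorem mollifiedPart_ae_eq (h : EuclideanSpace ℝ (Fin d) → ℝ) (ε : ℝ)
    (g : L2 (Fin (k + p) ⊕ Fin (k + p)) d) (j : Fin k ⊕ Fin k) :
    ∀ᵐ z : Conf (Fin k ⊕ Fin k) d, mollifiedPart h ε g (z.pos j) z =
      mollContract (scaled h ε) j (isomComp (reindex d (splitLabels k p)) g) z := by
  have h1 := Measure.ae_ae_of_ae_prod (ae_glue (coeFn_isomComp (reindex d (splitLabels k p)) g))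
  filter_upwards [h1] with z hz
  refine integral_congr_ae (hz.mono fun y hy => ?_)
  simp only [hy, glue_join_eq_reindex]

end Arrangement

/-! ### The contraction of a kernel of finite energy -/

variable {k p d : ℕ}

/-- A kernel of finite energy `E` has a contraction `B⁺ - B⁻` in the sense of distributions, and its
weighted `L²` norm is at most `2 (c E)^{1/2}`, one `(c E)^{1/2}` for each of `B⁺` and `B⁻`. -/
theorem exists_contraction_of_energy (hp : 1 ≤ p) (hd : d = 1 ∨ d = 2) {α : ℝ}
    (hα : (d = 1 → α ≤ 1) ∧ (d = 2 → α < 1)) {c : ℝ} (hc0 : 0 ≤ c)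
    (hc : ∀ q : EuclideanSpace ℝ (Fin d), ∫⁻ η : Conf (Fin p ⊕ Fin p) d, ENNReal.ofReal
      (jap q ^ α * (jap (q - ∑ l, η.pos l) * ∏ l, jap (η.pos l))⁻¹) ≤ ENNReal.ofReal c)
    {γ : Op (Fin (k + p)) d} {g : L2 (Fin (k + p) ⊕ Fin (k + p)) d} (hg : HasKernel γ g)
    {E : ℝ} (hE0 : 0 ≤ E) (hE : ∫⁻ ξ, ENNReal.ofReal (energyWeight ξ) *
      ‖(𝓕 g : L2 (Fin (k + p) ⊕ Fin (k + p)) d) ξ‖ₑ ^ 2 ≤ ENNReal.ofReal E) (j : Fin k) :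
    ∃ G F : L2 (Fin k ⊕ Fin k) d, IsContraction j γ G ∧ IsSobolevImage α G F ∧
      ‖F‖ ≤ 2 * √(c * E) := by
  have : NeZero p := ⟨by omega⟩
  have hα1 : α ≤ 1 := by
    rcases hd with h | h
    · exact hα.1 h
    · exact (hα.2 h).le
  obtain ⟨c₀, -, hc₀⟩ := exists_weight_bound (Fin p ⊕ Fin p) hd (α := 0)
    ⟨fun _ => zero_le_one, fun _ => zero_lt_one⟩
  obtain ⟨g', hg'⟩ : ∃ g' : L2 ((Fin k ⊕ Fin k) ⊕ (Fin p ⊕ Fin p)) d,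
    g' = isomComp (reindex d (splitLabels k p)) g := ⟨_, rfl⟩
  have hE' : ∫⁻ ξ, ENNReal.ofReal (energyWeight ξ) *
      ‖(𝓕 g' : L2 ((Fin k ⊕ Fin k) ⊕ (Fin p ⊕ Fin p)) d) ξ‖ₑ ^ 2 ≤ ENNReal.ofReal E := by
    rw [hg', lintegral_energyWeight_isomComp]
    exact hE
  have key := fun j' : Fin k ⊕ Fin k => exists_contraction_sobolev hα1 hc hc₀ hc0 j'
    (Lp.stronglyMeasurable (𝓕 g' : L2 ((Fin k ⊕ Fin k) ⊕ (Fin p ⊕ Fin p)) d)).measurable hE0 hE'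
  obtain ⟨G₁, F₁, hG₁, hF₁, hn₁⟩ := key (Sum.inl j)
  obtain ⟨G₂, F₂, hG₂, hF₂, hn₂⟩ := key (Sum.inr j)
  have hfs : ∀ a b : L2 (Fin k ⊕ Fin k) d, (𝓕 (a - b) : L2 (Fin k ⊕ Fin k) d) = 𝓕 a - 𝓕 b :=
    fun a b => map_sub (Lp.fourierTransformₗᵢ (Conf (Fin k ⊕ Fin k) d) ℂ) a b
  refine ⟨G₁ - G₂, F₁ - F₂, ⟨g, hg, fun h hh φ hφ hφc => ?_⟩, ?_, ?_⟩
  · have ht := (tendsto_integral_contractionTest hh hc₀ (Sum.inl j)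
      (hE'.trans_lt ENNReal.ofReal_lt_top) hG₁ hφ hφc).sub
      (tendsto_integral_contractionTest hh hc₀ (Sum.inr j)
      (hE'.trans_lt ENNReal.ofReal_lt_top) hG₂ hφ hφc)
    have hφ2 : MemLp φ 2 (volume : Measure (Conf (Fin k ⊕ Fin k) d)) :=
      hφ.continuous.memLp_of_hasCompactSupport hφc
    have hsub : ∫ z, (G₁ - G₂) z * φ z = (∫ z, G₁ z * φ z) - ∫ z, G₂ z * φ z := by
      refine Eq.trans ?_ (integral_sub ((Lp.memLp G₁).integrable_mul hφ2)
        ((Lp.memLp G₂).integrable_mul hφ2))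
      refine integral_congr_ae ((Lp.coeFn_sub G₁ G₂).mono fun z hz => ?_)
      simp only [hz, Pi.sub_apply, sub_mul]
    rw [hsub]
    refine ht.congr' ?_
    filter_upwards [self_mem_nhdsWithin] with ε hε
    have hm := hh.scaled hε
    obtain ⟨hi₁, he₁⟩ := integrable_mollContract_mul hm (Sum.inl j) g' hφ hφc
    obtain ⟨hi₂, he₂⟩ := integrable_mollContract_mul hm (Sum.inr j) g' hφ hφc
    rw [← he₁, ← he₂, ← integral_sub hi₁ hi₂]
    refine integral_congr_ae ?_
    filter_upwards [mollifiedPart_ae_eq h ε g (Sum.inl j), mollifiedPart_ae_eq h ε g (Sum.inr j)]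
      with z h₁ h₂
    rw [mollifiedContraction, h₁, h₂, ← hg', sub_mul]
  · unfold IsSobolevImage
    rw [hfs, hfs]
    filter_upwards [Lp.coeFn_sub (𝓕 F₁ : L2 (Fin k ⊕ Fin k) d) (𝓕 F₂),
      Lp.coeFn_sub (𝓕 G₁ : L2 (Fin k ⊕ Fin k) d) (𝓕 G₂), hG₁, hG₂, hF₁, hF₂]
      with ξ h₁ h₂ h₃ h₄ h₅ h₆
    rw [h₁, h₂, Pi.sub_apply, Pi.sub_apply, h₃, h₄, h₅, h₆, ← mul_sub]
    rfl
  · refine (norm_sub_le _ _).trans ?_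
    have h₁ := Real.le_sqrt_of_sq_le hn₁
    have h₂ := Real.le_sqrt_of_sq_le hn₂
    linarith

end GPHierarchy

end

theorem theorem3p1 (d p₀ : ℕ) (hd : d = 1 ∨ d = 2) (hp₀ : 1 ≤ p₀)
    (V : ∀ p : ℕ, GPHierarchy.Conf (Fin p) d → ℝ)
    (hV : ∀ p, 1 ≤ p → p ≤ p₀ → GPHierarchy.IsAdmissiblePotential (V p))
    (κ : ℝ) (hκ : 0 < κ)
    (α : ℝ) (hα : (d = 1 → α ≤ 1) ∧ (d = 2 → α < 1)) :
    ∃ C : ℝ, 0 < C ∧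
      ∀ (β : ℝ), 0 < β → β < 1 / (2 * d * p₀ + 2) →
      ∀ (χ : ℝ → ℝ), ContDiff ℝ ∞ χ → (∀ s, 0 ≤ χ s ∧ χ s ≤ 1) → (∀ s, 2 ≤ s → χ s = 0) →
      ∀ (ψ : ∀ N : ℕ, GPHierarchy.L2 (Fin N) d),
        (∀ N, 1 ≤ N → GPHierarchy.IsBosonic (ψ N) ∧ ‖ψ N‖ = 1) →
      ∀ (T : ℝ), 0 < T →
      ∀ (J : ∀ k : ℕ, ℕ → GPHierarchy.Op (Fin k) d),
        (∀ k, 1 ≤ k → GPHierarchy.IsDenseInCompactBall (J k)) →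
      ∀ (Γ : ∀ k : ℕ, ℝ → GPHierarchy.Op (Fin k) d),
        GPHierarchy.IsLimitPoint J T
          (fun N k t => GPHierarchy.regularizedMarginal d p₀ V β χ κ N (ψ N) k t) Γ →
      ∀ (p : ℕ), 1 ≤ p → p ≤ p₀ → ∀ (k : ℕ), 1 ≤ k → ∀ (j : Fin k), ∀ t ∈ Set.Icc 0 T,
        ∃ G F : GPHierarchy.L2 (Fin k ⊕ Fin k) d,
          GPHierarchy.IsContraction j (Γ (k + p) t) G ∧
          GPHierarchy.IsSobolevImage α G F ∧
          ‖F‖ ≤ C ^ (k + p) := by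
  classical
  -- `c p` bounds the weight integral over the `2p` momenta removed by the contraction.
  have hex : ∀ p : ℕ, ∃ c : ℝ, 0 ≤ c ∧ (1 ≤ p → ∀ q : EuclideanSpace ℝ (Fin d),
      ∫⁻ η : GPHierarchy.Conf (Fin p ⊕ Fin p) d, ENNReal.ofReal (GPHierarchy.jap q ^ α *
        (GPHierarchy.jap (q - ∑ l, η.pos l) * ∏ l, GPHierarchy.jap (η.pos l))⁻¹) ≤
      ENNReal.ofReal c) := fun p => by
    rcases Nat.eq_zero_or_pos p with rfl | hp
    · exact ⟨0, le_rfl, fun h => absurd h (by norm_num)⟩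
    · have : NeZero p := ⟨hp.ne'⟩
      obtain ⟨c, hc0, hc⟩ := GPHierarchy.exists_weight_bound (Fin p ⊕ Fin p) hd hα
      exact ⟨c, hc0, fun _ => hc⟩
  choose c hc0 hc using hex
  -- Each of `B⁺` and `B⁻` costs a factor `√(c p)`; the energy of `γ^{(k+p)}` contributes
  -- `(2/κ + 1)^(k+p)`. As `1 ≤ M`, the prefactor is absorbed in `M^(k+p)`.
  obtain ⟨M, hM⟩ : ∃ M : ℝ, M = 1 + ∑ p ∈ Finset.Icc 1 p₀, 2 * √(c p) := ⟨_, rfl⟩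
  have hM1 : 1 ≤ M := by
    rw [hM]
    exact le_add_of_nonneg_right (Finset.sum_nonneg fun p _ => by positivity)
  have hA : 0 < 2 / κ + 1 := by positivity
  refine ⟨M * (2 / κ + 1), by positivity, ?_⟩
  intro β hβ hβ' χ hχ hχ1 hχ2 ψ hψ T _ J hJ Γ hΓ p hp hpp₀ k hk j t ht
  -- A one-particle translation costs `O(N^(p₀dβ))`, which is `o(N)`.
  have hβ1 : (p₀ : ℝ) * d * β < 1 := by
    have h1 : β * (2 * d * p₀ + 2) < 1 := (lt_div_iff₀ (by positivity)).1 hβ'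
    have h2 : 0 ≤ (p₀ : ℝ) * d * β := by positivity
    linarith
  obtain ⟨g, hg, hE⟩ := GPHierarchy.exists_kernel_limitPoint hV hκ hβ.le hβ1 hχ.continuous hχ1 hχ2
    (fun N hN => (hψ N hN).1) hJ hΓ (k := k + p) (by omega) ht
  obtain ⟨G, F, hG, hF, hn⟩ := GPHierarchy.exists_contraction_of_energy hp hd hα (hc0 p) (hc p hp)
    hg (sq_nonneg _) hE j
  refine ⟨G, F, hG, hF, hn.trans ?_⟩
  rw [Real.sqrt_mul (hc0 p), Real.sqrt_sq (by positivity), mul_pow, ← mul_assoc]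
  refine mul_le_mul_of_nonneg_right ?_ (by positivity)
  have h1 : 2 * √(c p) ≤ M := by
    rw [hM]
    have := Finset.single_le_sum (f := fun p => 2 * √(c p)) (fun p _ => by positivity)
      (Finset.mem_Icc.2 ⟨hp, hpp₀⟩)
    linarith
  exact h1.trans (le_self_pow₀ hM1 (by omega))
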